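/- Let $\Omega\subset\mathbb R^d$ be a bounded open set with $C^1$ boundary, let $f\in C^1(\mathbb R^d;\mathbb R^d)$, and suppose that $\overline\Omega$ is flow-invariant for $x'=f(x)$: for every $z\in\overline\Omega$ the solution $t\mapsto\Phi^t(z)$ with $\Phi^0(z)=z$ exists for all $t\ge 0$ and stays in $\overline\Omega$. Let $w$ be a weight on $\Omega$, positive almost everywhere, with $w^{-1}\in W^{1,\infty}(\Omega)$; write $\nabla w:=-w^2\,\nabla(w^{-1})$, where $\nabla (w^{-1})$ is the weak gradient. Assume that 1. $f_i\,w\in L^\infty(\Omega)$ for $i=1,\dots,d$; 2. $\operatorname{ess\,sup}_{x\in\Omega}\,-\dfrac{f(x)^\top\nabla w(x)}{w(x)}<\infty$. Let $L^1_w(\Omega)$, $L^2_{w^2}(\Omega)$ and $L^\infty_w(\Omega)$ be the weighted spaces with norms $\int_\Omega|\varphi|\,w\,dx$, $\bigl(\int_\Omega|\varphi|^2w^2\,dx\bigr)^{1/2}$ and $\operatorname{ess\,sup}_\Omega|\varphi\, w|$. Let $(Y,Y^*)$ be either $(L^1_w(\Omega),L^\infty_w(\Omega))$ or $(L^2_{w^2}(\Omega),L^2_{w^2}(\Omega))$,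 with duality pairing $\langle\rho,\varphi\rangle=\int_\Omega\rho\,\varphi\,w^2\,dx$. Then: (a) For every $t\ge0$, $S^*(t)\varphi:=\varphi\circ\Phi^t$ is well defined on $Y^*$ (independently of the representative of $\varphi$) and is a bounded linear operator on $Y^*$. (b) $(S^*(t))_{t\ge0}$ is a weak-* continuous semigroup on $Y^*$: $S^*(0)=I$, $S^*(t+s)=S^*(t)S^*(s)$, the map $t\mapsto\langle\rho,S^*(t)\varphi\rangle$ is continuous on $[0,\infty)$ for all $\rho\in Y$, $\varphi\in Y^*$, and each $S^*(t)$ is weak-* continuous (for every $\rho \in Y$ there is $\sigma\in Y$ with $\langle\rho,S^*(t)\varphi\rangle=\langle\sigma,\varphi\rangle$ for all $\varphi\in Y^*$). (c) Its infinitesimal generator $A^*\colon\mathcal D(A^*)\subseteq Y^*\to Y^*$, that is, $A^*\varphi=\lim_{t\to0+}\frac{S^*(t)\varphi-\varphi}{t}$ in the weak-* sense on the set $\mathcal D(A^*)$ of all $\varphi$ for which this limit exists in $Y^*$, is $A^*\varphi=f^\top\nabla\varphi$. Precisely, for $\varphi,\psi\in Y^*$ one has $\varphi\in\mathcal D(A^*)$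 and $A^*\varphi=\psi$ if and only if $f^\top\nabla\varphi=\psi$ weakly, i.e. $\int_\Omega\varphi\,\operatorname{div}(\eta f)\,dx=-\int_\Omega\psi\,\eta\,dx$ for all $\eta\in C_c^\infty(\Omega)$; and if $\varphi\in\mathcal D(A^*)$ has a locally integrable weak gradient $\nabla\varphi$, then $A^*\varphi=f^\top\nabla\varphi$ almost everywhere on $\Omega$. (d) $W^{1,\infty}(\Omega)\cap L^\infty_w(\Omega)\subseteq\mathcal D(A^*)$ in the case $Y=L^1_w(\Omega)$, and $W^{1,2}(\Omega)\cap L^2_{w^2}(\Omega)\subseteq\mathcal D(A^*)$ in the case $Y=L^2_{w^2}(\Omega)$. -/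

import Mathlib

open MeasureTheory Filter Topology
open scoped NNReal ENNReal

noncomputable section

namespace Koopman

/-- The space `ℝ^d` with its Euclidean structure. -/
abbrev Eucl (d : ℕ) : Type := EuclideanSpace ℝ (Fin d)

variable {d : ℕ}

/-! ### Domains, test functions, weak derivatives -/

/-- `Ω` has `C¹` boundary: near each boundary point, `Ω` is the sublevel set `{ρ < 0}` of a `C¹`
function `ρ` whose differential does not vanish at that point. -/
def HasC1Boundary (Ω : Set (Eucl d)) : Prop :=
  ∀ x ∈ frontier Ω, ∃ U : Set (Eucl d), IsOpen U ∧ x ∈ U ∧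
    ∃ ρ : Eucl d → ℝ, ContDiffOn ℝ 1 ρ U ∧ fderiv ℝ ρ x ≠ 0 ∧ Ω ∩ U = {y ∈ U | ρ y < 0}

/-- `η ∈ C_c^∞(Ω)`. -/
structure IsTestFunction (Ω : Set (Eucl d)) (η : Eucl d → ℝ) : Prop where
  smooth : ContDiff ℝ (⊤ : ℕ∞) η
  compact : HasCompactSupport η
  support_subset : tsupport η ⊆ Ω

/-- `g` is the weak gradient of `u` on `Ω`; both are locally integrable on `Ω`. -/
structure HasWeakGradient (Ω : Set (Eucl d)) (u : Eucl d → ℝ) (g : Eucl d → Eucl d) : Prop where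
  locInt : LocallyIntegrableOn u Ω
  locInt_grad : LocallyIntegrableOn g Ω
  integral_eq : ∀ η, IsTestFunction Ω η → ∀ i : Fin d,
    ∫ x in Ω, u x * fderiv ℝ η x (EuclideanSpace.single i 1) = - ∫ x in Ω, g x i * η x

/-- `u ∈ W^{1,p}(Ω)`. -/
def MemSobolev (Ω : Set (Eucl d)) (p : ℝ≥0∞) (u : Eucl d → ℝ) : Prop :=
  MemLp u p (volume.restrict Ω) ∧
    ∃ g : Eucl d → Eucl d, MemLp g p (volume.restrict Ω) ∧ HasWeakGradient Ω u g

/-- The divergence of a vector field. -/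
def divergence (F : Eucl d → Eucl d) (x : Eucl d) : ℝ :=
  ∑ i : Fin d, fderiv ℝ F x (EuclideanSpace.single i 1) i

/-- `fᵀ∇φ = ψ` on `Ω` in the weak sense: `∫ φ div(η f) = - ∫ ψ η` for every `η ∈ C_c^∞(Ω)`, where
`φ` and `ψ` are locally integrable on `Ω`. -/
structure HasWeakDerivAlong (Ω : Set (Eucl d)) (f : Eucl d → Eucl d) (φ ψ : Eucl d → ℝ) :
    Prop where
  locInt : LocallyIntegrableOn φ Ω
  locInt_deriv : LocallyIntegrableOn ψ Ω
  integral_eq : ∀ η, IsTestFunction Ω η →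
    ∫ x in Ω, φ x * divergence (fun y => η y • f y) x = - ∫ x in Ω, ψ x * η x

/-! ### The flow -/

/-- `t ↦ Φ t z`, `t ≥ 0`, solves `x' = f(x)`, `x(0) = z`, for every `z ∈ K`. -/
structure IsSolutionMap (f : Eucl d → Eucl d) (K : Set (Eucl d)) (Φ : ℝ≥0 → Eucl d → Eucl d) :
    Prop where
  initial : ∀ z ∈ K, Φ 0 z = z
  ode : ∀ z ∈ K, ∀ t : ℝ, 0 ≤ t →
    HasDerivWithinAt (fun s : ℝ => Φ s.toNNReal z) (f (Φ t.toNNReal z)) (Set.Ici 0) t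

/-- `K` is flow-invariant: `Φ t z ∈ K` for all `z ∈ K` and `t ≥ 0`. -/
def FlowInvariant (K : Set (Eucl d)) (Φ : ℝ≥0 → Eucl d → Eucl d) : Prop :=
  ∀ z ∈ K, ∀ t, Φ t z ∈ K

/-! ### Weights -/

/-- A weight on `Ω`: positive almost everywhere, with `w⁻¹ ∈ W^{1,∞}(Ω)` (hence `w` is
a.e. measurable on `Ω`). The weight may have poles on a null set; its value there is irrelevant. -/
structure IsWeight (Ω : Set (Eucl d)) (w : Eucl d → ℝ) : Prop where
  pos : ∀ᵐ x ∂(volume.restrict Ω), 0 < w x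
  inv_sobolev : MemSobolev Ω ∞ (fun x => (w x)⁻¹)

/-- `W` is the gradient of the weight `w`, in the a.e. sense: `∇w = -w² ∇(w⁻¹)`, with the weak
gradient of `w⁻¹` (the function `w` itself need not be locally integrable). -/
def IsWeightGradient (Ω : Set (Eucl d)) (w : Eucl d → ℝ) (W : Eucl d → Eucl d) : Prop :=
  ∃ g : Eucl d → Eucl d, HasWeakGradient Ω (fun x => (w x)⁻¹) g ∧
    ∀ᵐ x ∂(volume.restrict Ω), W x = -((w x) ^ 2 • g x)

/-- Compatibility of weight and dynamics: `f_i ∈ L^∞_w(Ω) ∩ C¹` and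
`ess sup_Ω (- fᵀ∇w / w) < ∞`. -/
structure WeightCompatible (Ω : Set (Eucl d)) (f : Eucl d → Eucl d) (w : Eucl d → ℝ) :
    Prop where
  contDiff : ContDiff ℝ 1 f
  bounded : ∀ i : Fin d, MemLp (fun x => f x i * w x) ∞ (volume.restrict Ω)
  decay : ∃ W : Eucl d → Eucl d, IsWeightGradient Ω w W ∧
    ∃ ω₀ : ℝ, ∀ᵐ x ∂(volume.restrict Ω), -(inner ℝ (f x) (W x) / w x) ≤ ω₀

/-! ### Weighted Lebesgue spaces -/

/-- The space of (classes of) functions `φ` on `Ω` with `φ w ∈ L^p(Ω)`. For `p = 1`, `p = 2`,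
`p = ∞` these are the weighted spaces `L¹_w(Ω)` (norm `∫ |φ| w`), `L²_{w²}(Ω)`
(norm `(∫ |φ|² w²)^{1/2}`) and `L^∞_w(Ω)` (norm `ess sup |φ w|`). -/
def weightedLp (Ω : Set (Eucl d)) (w : Eucl d → ℝ) (p : ℝ≥0∞) :
    Submodule ℝ (Eucl d →ₘ[volume.restrict Ω] ℝ) where
  carrier := {φ | MemLp (fun x => φ x * w x) p (volume.restrict Ω)}
  zero_mem' := by
    refine (memLp_congr_ae ?_).2 (MemLp.zero (ε := ℝ))
    filter_upwards [AEEqFun.coeFn_zero (α := Eucl d) (μ := volume.restrict Ω) (β := ℝ)] with x hx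
    simp [hx]
  add_mem' := by
    intro φ ψ hφ hψ
    refine (memLp_congr_ae ?_).2 (MemLp.add hφ hψ)
    filter_upwards [AEEqFun.coeFn_add φ ψ] with x hx
    simp [hx, add_mul]
  smul_mem' := by
    intro c φ hφ
    refine (memLp_congr_ae ?_).2 (MemLp.const_smul hφ c)
    filter_upwards [AEEqFun.coeFn_smul c φ] with x hx
    simp [hx, mul_assoc]

/-- The norm `‖φ w‖_{L^p(Ω)}`. -/
def weightedLp.normFun {Ω : Set (Eucl d)} {w : Eucl d → ℝ} {p : ℝ≥0∞}
    (φ : weightedLp Ω w p) : ℝ :=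
  (eLpNorm (fun x => φ.1 x * w x) p (volume.restrict Ω)).toReal

theorem weightedLp.normFun_smul {Ω : Set (Eucl d)} {w : Eucl d → ℝ} {p : ℝ≥0∞}
    (c : ℝ) (φ : weightedLp Ω w p) : normFun (c • φ) = ‖c‖ * normFun φ := by
  have h : (fun x => (c • φ).1 x * w x) =ᵐ[volume.restrict Ω]
      c • (fun x => φ.1 x * w x) := by
    filter_upwards [AEEqFun.coeFn_smul c φ.1] with x hx
    simp [hx, mul_assoc]
  rw [normFun, normFun, eLpNorm_congr_ae h, eLpNorm_const_smul]
  simp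

/-- The seminorm axioms (definiteness holds as soon as `w ≠ 0` almost everywhere on `Ω`). -/
def weightedLp.seminorm (Ω : Set (Eucl d)) (w : Eucl d → ℝ) (p : ℝ≥0∞) [hp : Fact (1 ≤ p)] :
    AddGroupSeminorm (weightedLp Ω w p) where
  toFun φ := normFun φ
  map_zero' := by
    have h := weightedLp.normFun_smul (0 : ℝ) (0 : weightedLp Ω w p)
    simpa using h
  add_le' φ ψ := by
    have h : (fun x => (φ + ψ).1 x * w x) =ᵐ[volume.restrict Ω]
        (fun x => φ.1 x * w x) + (fun x => ψ.1 x * w x) := by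
      filter_upwards [AEEqFun.coeFn_add φ.1 ψ.1] with x hx
      simp [hx, add_mul]
    have h1 : MemLp (fun x => φ.1 x * w x) p (volume.restrict Ω) := φ.2
    have h2 : MemLp (fun x => ψ.1 x * w x) p (volume.restrict Ω) := ψ.2
    rw [normFun, normFun, normFun, eLpNorm_congr_ae h,
      ← ENNReal.toReal_add h1.2.ne h2.2.ne]
    exact ENNReal.toReal_mono (ENNReal.add_ne_top.2 ⟨h1.2.ne, h2.2.ne⟩)
      (eLpNorm_add_le h1.1 h2.1 hp.out)
  neg' φ := by
    rw [← neg_one_smul ℝ φ, weightedLp.normFun_smul]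
    simp

instance weightedLp.instSeminormedAddCommGroup (Ω : Set (Eucl d)) (w : Eucl d → ℝ) (p : ℝ≥0∞)
    [Fact (1 ≤ p)] : SeminormedAddCommGroup (weightedLp Ω w p) :=
  (weightedLp.seminorm Ω w p).toSeminormedAddCommGroup

theorem weightedLp.norm_def {Ω : Set (Eucl d)} {w : Eucl d → ℝ} {p : ℝ≥0∞} [Fact (1 ≤ p)]
    (φ : weightedLp Ω w p) :
    ‖φ‖ = (eLpNorm (fun x => φ.1 x * w x) p (volume.restrict Ω)).toReal := rfl

instance weightedLp.instNormedSpace (Ω : Set (Eucl d)) (w : Eucl d → ℝ) (p : ℝ≥0∞)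
    [Fact (1 ≤ p)] : NormedSpace ℝ (weightedLp Ω w p) where
  norm_smul_le c φ := (weightedLp.normFun_smul c φ).le

/-- The dual pairing `⟨ρ, φ⟩ = ∫_Ω ρ φ w²`, between `L¹_w` and `L^∞_w` as well as on `L²_{w²}`. -/
def pairing (Ω : Set (Eucl d)) (w : Eucl d → ℝ) (ρ φ : Eucl d →ₘ[volume.restrict Ω] ℝ) : ℝ :=
  ∫ x in Ω, ρ x * φ x * w x ^ 2

/-! ### Weak-* continuous semigroups and their generators

`weightedLp Ω w p` is regarded as the dual space of `weightedLp Ω w q` through `pairing`. -/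

variable {Ω : Set (Eucl d)} {w : Eucl d → ℝ} {p : ℝ≥0∞} [Fact (1 ≤ p)]

/-- A semigroup of bounded operators on the dual of `weightedLp Ω w q` whose orbits are weak-*
continuous and each of whose members is weak-* continuous, that is, each functional
`φ ↦ ⟨ρ, S(t)φ⟩` is given by an element of the predual. -/
structure IsWeakStarSemigroup (q : ℝ≥0∞)
    (S : ℝ≥0 → (weightedLp Ω w p →L[ℝ] weightedLp Ω w p)) : Prop where
  zero : S 0 = ContinuousLinearMap.id ℝ (weightedLp Ω w p)
  add : ∀ s t, S (s + t) = (S s).comp (S t)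
  continuous_orbit : ∀ (ρ : weightedLp Ω w q) (φ : weightedLp Ω w p),
    Continuous fun t => pairing Ω w ρ (S t φ)
  weakStar_continuous : ∀ (t : ℝ≥0) (ρ : weightedLp Ω w q), ∃ σ : weightedLp Ω w q,
    ∀ φ : weightedLp Ω w p, pairing Ω w ρ (S t φ) = pairing Ω w σ φ

/-- `A` is the infinitesimal generator of `S` in the weak-* sense: `φ ∈ D(A)` and `Aφ = ψ` iff
`(S(t)φ - φ)/t → ψ` in the weak-* topology as `t → 0+`. -/
def IsWeakStarGenerator (q : ℝ≥0∞)
    (S : ℝ≥0 → (weightedLp Ω w p →L[ℝ] weightedLp Ω w p))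
    (A : weightedLp Ω w p →ₗ.[ℝ] weightedLp Ω w p) : Prop :=
  ∀ φ ψ : weightedLp Ω w p, (φ, ψ) ∈ A.graph ↔
    ∀ ρ : weightedLp Ω w q,
      Tendsto (fun t : ℝ≥0 =>
          pairing Ω w ρ ((t : ℝ)⁻¹ • (S t φ - φ) : weightedLp Ω w p))
        (𝓝[>] 0) (𝓝 (pairing Ω w ρ ψ))

end Koopman

end

open Koopman

/-! Only the values of `f` on `closure Ω` matter, so `f` is replaced by a compactly supported `C¹`
field, which is bounded and globally Lipschitz with some constant `L`. Grönwall's inequality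
forwards and backwards in time makes `Φ^t` bi-Lipschitz on `closure Ω` with constants `e^{Lt}`. The
`C¹` boundary enters through one consequence, that `Ω` is the interior of its closure; with
uniqueness for the ODE it gives `Φ^t(Ω) ⊆ Ω`. Since the inverse of `Φ^t` is Lipschitz on the range,
the image under `Φ^t` of Lebesgue measure on `Ω` is at most `e^{dLt}` times that measure. Hence
composition with `Φ^t` does not depend on the representative and is bounded on every unweighted
`L^p(Ω)` (`map_flowMap_le`, `eLpNorm_comp_le`).

For the weight put `v = w⁻¹`. From `∇w = -w²∇v` one gets `-fᵀ∇w/w = w fᵀ∇v`, so the second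
hypothesis on `w` says `fᵀ∇v ≤ ωv`. Grönwall along the flow gives `v ∘ Φ^t ≤ e^{ωt} v`, that is `w ≤
e^{ωt} w ∘ Φ^t`, and therefore `|φ ∘ Φ^t| w ≤ e^{ωt} |φw| ∘ Φ^t`: boundedness on the weighted spaces
follows from the unweighted one. Weak-* continuity of a single operator comes from pushing `ρ`
forward by the flow, continuity of orbits from approximating `ρ` and `φ`.

The generator rests on two integrated identities. If `fᵀ∇φ = ψ` weakly, then `φ ∘ Φ^t - φ = ∫₀ᵗ ψ ∘
Φ^s ds` (`integral_mul_comp_sub_eq`). This is clear for smooth `φ`; in general `φ` is mollified, and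
the commutator of mollification with `fᵀ∇` tends to zero in `L¹` because its kernel has size
`ε^{-d}` and integral zero (Friedrichs, DiPerna–Lions). The same identity, applied to `v`, justifies
the Grönwall argument for a weight that is only Sobolev.

Conversely, for any integrable `φ` and any test function `η`, the derivative of `∫ η (φ ∘ Φ^t)` is
`-∫ div(ηf) (φ ∘ Φ^t)` (`integral_test_mul_comp_sub_eq`). Pairing with the predual element `ηw⁻²`
then turns weak-* differentiability of the orbit at `0` into the weak equation `fᵀ∇φ = ψ`. -/

noncomputable section

/-! ### The flow on the closure of `Ω`, and invariance of `Ω` itself. -/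

namespace Koopman

variable {d : ℕ}

/-- A bounded regular open set whose closure is forward invariant under the flow of a compactly
supported `C¹` vector field. -/
structure InvariantFlow (Ω : Set (Eucl d)) (f : Eucl d → Eucl d) (Φ : ℝ≥0 → Eucl d → Eucl d)
    (L : ℝ≥0) : Prop where
  isOpen : IsOpen Ω
  bounded : Bornology.IsBounded Ω
  regular : interior (closure Ω) ⊆ Ω
  contDiff : ContDiff ℝ 1 f
  compact : HasCompactSupport f
  lipschitz : LipschitzWith L f
  sol : IsSolutionMap f (closure Ω) Φ
  inv : FlowInvariant (closure Ω) Φ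

/-- From a boundary point one can move in a direction in which `ρ` increases. Arbitrarily close to
the point this reaches `ρ > 0`, and near such points there is nothing of `Ω`, so the boundary point
is not interior to the closure. -/
theorem HasC1Boundary.interior_closure_subset {Ω : Set (Eucl d)} (h : HasC1Boundary Ω)
    (hΩ : IsOpen Ω) : interior (closure Ω) ⊆ Ω := by
  intro z hz
  by_contra hzΩ
  have hfr : z ∈ frontier Ω := by
    rw [hΩ.frontier_eq]
    exact ⟨interior_subset hz, hzΩ⟩
  obtain ⟨U, hU, hzU, ρ, hρ, hd, hEq⟩ := h z hfr
  have hρz : 0 ≤ ρ z := by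
    by_contra hlt
    exact hzΩ (hEq.symm.subset ⟨hzU, not_le.1 hlt⟩ : z ∈ Ω ∩ U).1
  have hdiff : HasFDerivAt ρ (fderiv ℝ ρ z) z :=
    ((hρ.contDiffAt (hU.mem_nhds hzU)).differentiableAt one_ne_zero).hasFDerivAt
  obtain ⟨e, he⟩ : ∃ e, 0 < fderiv ℝ ρ z e := by
    obtain ⟨e, he⟩ := DFunLike.ne_iff.1 hd
    rcases lt_or_gt_of_ne he with h | h
    · exact ⟨-e, by simpa using h⟩
    · exact ⟨e, h⟩
  have hline : HasDerivAt (fun s : ℝ => ρ (z + s • e)) (fderiv ℝ ρ z e) 0 :=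
    hdiff.hasLineDerivAt e
  have hcont : Tendsto (fun s : ℝ => z + s • e) (𝓝[>] 0) (𝓝 z) := by
    have : Continuous fun s : ℝ => z + s • e := by fun_prop
    simpa using (this.tendsto 0).mono_left nhdsWithin_le_nhds
  have hpos : ∀ᶠ s in 𝓝[>] (0 : ℝ), 0 < ρ (z + s • e) := by
    have h1 := hasDerivWithinAt_iff_tendsto_slope.1 (hline.hasDerivWithinAt (s := Set.Ioi 0))
    have h2 : Set.Ioi (0 : ℝ) \ {0} = Set.Ioi 0 := by
      ext s
      exact ⟨fun h => h.1, fun h => ⟨h, ne_of_gt h⟩⟩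
    rw [h2] at h1
    filter_upwards [h1.eventually (lt_mem_nhds he), self_mem_nhdsWithin] with s hs hs0
    rw [slope_def_field] at hs
    have hs0' : (0 : ℝ) < s - 0 := by simpa using hs0
    have := (div_pos_iff_of_pos_right hs0').1 hs
    simp only [zero_smul, add_zero] at this
    linarith
  obtain ⟨s, hs, hsU, hsC⟩ := (hpos.and ((hcont.eventually (hU.mem_nhds hzU)).and
    (hcont.eventually (isOpen_interior.mem_nhds hz)))).exists
  have hcontρ : ContinuousAt ρ (z + s • e) :=
    (hρ.contDiffAt (hU.mem_nhds hsU)).continuousAt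
  obtain ⟨y, hy, hyU, hyΩ⟩ := mem_closure_iff_frequently.1 (interior_subset hsC) |>.and_eventually
    ((hcontρ.eventually (lt_mem_nhds hs)).and (hU.mem_nhds hsU)) |>.exists.imp
      fun y h => (⟨h.2.1, h.2.2, h.1⟩ : 0 < ρ y ∧ y ∈ U ∧ y ∈ Ω)
  exact absurd hy (not_lt.2 (hEq.subset ⟨hyΩ, hyU⟩).2.le)

namespace InvariantFlow

variable {Ω : Set (Eucl d)} {f : Eucl d → Eucl d} {Φ : ℝ≥0 → Eucl d → Eucl d} {L : ℝ≥0}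

theorem isCompact_closure (h : InvariantFlow Ω f Φ L) : IsCompact (closure Ω) :=
  h.bounded.isCompact_closure

theorem continuousOn_time (h : InvariantFlow Ω f Φ L) {z : Eucl d} (hz : z ∈ closure Ω) :
    ContinuousOn (fun s : ℝ => Φ s.toNNReal z) (Set.Ici 0) :=
  fun t ht => (h.sol.ode z hz t ht).continuousWithinAt

theorem continuous_time (h : InvariantFlow Ω f Φ L) {z : Eucl d} (hz : z ∈ closure Ω) :
    Continuous fun t : ℝ≥0 => Φ t z := by
  have := (h.continuousOn_time hz).comp_continuous NNReal.continuous_coe (fun t => t.2)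
  simpa [Function.comp_def] using this

theorem hasDerivWithinAt_Ici (h : InvariantFlow Ω f Φ L) {z : Eucl d} (hz : z ∈ closure Ω)
    {t : ℝ} (ht : 0 ≤ t) :
    HasDerivWithinAt (fun s : ℝ => Φ s.toNNReal z) (f (Φ t.toNNReal z)) (Set.Ici t) t :=
  (h.sol.ode z hz t ht).mono (Set.Ici_subset_Ici.2 ht)

theorem dist_le (h : InvariantFlow Ω f Φ L) {x y : Eucl d} (hx : x ∈ closure Ω)
    (hy : y ∈ closure Ω) (t : ℝ≥0) :
    dist (Φ t x) (Φ t y) ≤ dist x y * Real.exp (L * t) := by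
  have := dist_le_of_trajectories_ODE (v := fun _ => f) (K := L) (a := 0) (b := t)
    (δ := dist x y) (fun _ => h.lipschitz)
    ((h.continuousOn_time hx).mono Set.Icc_subset_Ici_self)
    (fun s hs => h.hasDerivWithinAt_Ici hx hs.1)
    ((h.continuousOn_time hy).mono Set.Icc_subset_Ici_self)
    (fun s hs => h.hasDerivWithinAt_Ici hy hs.1)
    (by simp [h.sol.initial x hx, h.sol.initial y hy]) t (Set.right_mem_Icc.2 t.2)
  simpa using this

theorem continuousOn_reverse (h : InvariantFlow Ω f Φ L) {z : Eucl d} (hz : z ∈ closure Ω)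
    (t : ℝ≥0) : ContinuousOn (fun s : ℝ => Φ ((t : ℝ) - s).toNNReal z) (Set.Icc 0 t) :=
  (h.continuousOn_time hz).comp (by fun_prop) (fun s hs => by simpa using hs.2)

theorem hasDerivWithinAt_reverse (h : InvariantFlow Ω f Φ L) {z : Eucl d} (hz : z ∈ closure Ω)
    (t : ℝ≥0) {s : ℝ} (hs : s ∈ Set.Ico (0 : ℝ) t) :
    HasDerivWithinAt (fun s : ℝ => Φ ((t : ℝ) - s).toNNReal z)
      (-f (Φ ((t : ℝ) - s).toNNReal z)) (Set.Ici s) s := by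
  have hpos : 0 < (t : ℝ) - s := sub_pos.2 hs.2
  have h1 : HasDerivAt (fun s : ℝ => Φ s.toNNReal z) (f (Φ ((t : ℝ) - s).toNNReal z))
      ((t : ℝ) - s) := (h.sol.ode z hz _ hpos.le).hasDerivAt (Ici_mem_nhds hpos)
  have h2 : HasDerivAt (fun s : ℝ => (t : ℝ) - s) (-1) s := by
    simpa using (hasDerivAt_id s).const_sub (t : ℝ)
  have := h1.scomp s h2
  simpa [Function.comp_def] using this.hasDerivWithinAt (s := Set.Ici s)

/-- Reversed trajectories solve `x' = -f(x)`, which has the same Lipschitz constant. This yields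
injectivity of the flow and the Lipschitz bound for its inverse. -/
theorem dist_le_reverse (h : InvariantFlow Ω f Φ L) {x y : Eucl d} (hx : x ∈ closure Ω)
    (hy : y ∈ closure Ω) (t : ℝ≥0) :
    dist x y ≤ dist (Φ t x) (Φ t y) * Real.exp (L * t) := by
  have hneg : LipschitzWith L fun z => -f z := h.lipschitz.neg
  have := dist_le_of_trajectories_ODE (v := fun _ z => -f z) (K := L) (a := 0) (b := t)
    (δ := dist (Φ t x) (Φ t y)) (fun _ => hneg)
    (h.continuousOn_reverse hx t) (fun s hs => h.hasDerivWithinAt_reverse hx t hs)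
    (h.continuousOn_reverse hy t) (fun s hs => h.hasDerivWithinAt_reverse hy t hs)
    (by simp) t (Set.right_mem_Icc.2 t.2)
  simpa [h.sol.initial x hx, h.sol.initial y hy] using this

/-- Both sides solve the ODE in `s` from the same initial value. Uniqueness is the trajectory
estimate with initial distance `0`. -/
theorem flow_add (h : InvariantFlow Ω f Φ L) {z : Eucl d} (hz : z ∈ closure Ω) (s t : ℝ≥0) :
    Φ (s + t) z = Φ s (Φ t z) := by
  have hz' := h.inv z hz t
  have hshift : ∀ r : ℝ, 0 ≤ r → HasDerivWithinAt (fun r : ℝ => Φ (r + t).toNNReal z)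
      (f (Φ (r + t).toNNReal z)) (Set.Ici r) r := by
    intro r hr
    have h1 := h.hasDerivWithinAt_Ici hz (add_nonneg hr t.2)
    have h2 : HasDerivWithinAt (fun r : ℝ => r + t) 1 (Set.Ici r) r :=
      ((hasDerivAt_id r).add_const (t : ℝ)).hasDerivWithinAt
    have := h1.scomp r h2 (fun r' hr' => by simpa using hr')
    simpa [Function.comp_def] using this
  have := dist_le_of_trajectories_ODE (v := fun _ => f) (K := L) (a := 0) (b := s)
    (δ := 0) (f := fun r : ℝ => Φ (r + t).toNNReal z) (g := fun r : ℝ => Φ r.toNNReal (Φ t z))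
    (fun _ => h.lipschitz)
    ((h.continuousOn_time hz).comp (by fun_prop) (fun r hr => add_nonneg hr.1 t.2))
    (fun r hr => hshift r hr.1)
    ((h.continuousOn_time hz').mono Set.Icc_subset_Ici_self)
    (fun r hr => h.hasDerivWithinAt_Ici hz' hr.1)
    (by simp [h.sol.initial _ hz']) s (Set.right_mem_Icc.2 s.2)
  have h3 : ((s : ℝ) + t).toNNReal = s + t := by
    rw [← NNReal.coe_add, Real.toNNReal_coe]
  simpa [h3] using this

theorem lipschitzOnWith_flow (h : InvariantFlow Ω f Φ L) (t : ℝ≥0) :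
    LipschitzOnWith (Real.exp (L * t)).toNNReal (Φ t) (closure Ω) :=
  LipschitzOnWith.of_dist_le_mul fun x hx y hy => by
    rw [Real.coe_toNNReal _ (Real.exp_pos _).le, mul_comm]
    exact h.dist_le hx hy t

theorem continuousOn_flow (h : InvariantFlow Ω f Φ L) :
    ContinuousOn (fun q : ℝ≥0 × Eucl d => Φ q.1 q.2) (Set.univ ×ˢ closure Ω) := by
  have key : ∀ T : ℝ≥0, ContinuousOn (fun q : ℝ≥0 × Eucl d => Φ q.1 q.2)
      (Set.Iio T ×ˢ closure Ω) := fun T => by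
    refine continuousOn_prod_of_continuousOn_lipschitzOnWith' _ (Real.exp (L * T)).toNNReal
      (fun t ht => ?_) (fun z hz => (h.continuous_time hz).continuousOn)
    refine (h.lipschitzOnWith_flow t).weaken (Real.toNNReal_le_toNNReal (Real.exp_le_exp.2 ?_))
    have : (t : ℝ) ≤ T := le_of_lt ht
    gcongr
  intro q hq
  have h1 := key (q.1 + 1) q ⟨by simp, hq.2⟩
  refine h1.mono_of_mem_nhdsWithin ?_
  have h2 : (Set.Iio (q.1 + 1) ×ˢ Set.univ : Set (ℝ≥0 × Eucl d)) ∈ 𝓝 q :=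
    (isOpen_Iio.prod isOpen_univ).mem_nhds ⟨by simp, trivial⟩
  filter_upwards [nhdsWithin_le_nhds h2, self_mem_nhdsWithin] with r hr hr'
  exact ⟨hr.1, hr'.2⟩

theorem exists_norm_le (h : InvariantFlow Ω f Φ L) : ∃ B : ℝ≥0, ∀ x, ‖f x‖ ≤ B := by
  obtain ⟨B, hB⟩ := h.contDiff.continuous.bounded_above_of_compact_support h.compact
  exact ⟨B.toNNReal, fun x => (hB x).trans (Real.le_coe_toNNReal B)⟩

/-- Every point is the initial value of a backward trajectory of arbitrary length. -/
theorem exists_backward (h : InvariantFlow Ω f Φ L) (z : Eucl d) (t : ℝ≥0) :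
    ∃ β : ℝ → Eucl d, β 0 = z ∧ ∀ s ∈ Set.Icc (0 : ℝ) t, HasDerivAt β (-f (β s)) s := by
  obtain ⟨B, hB⟩ := h.exists_norm_le
  -- The field is bounded by `B` everywhere, so a ball of radius `B (t + 1)` contains the trajectory
  -- on the whole interval. The margin of length `1` at each end makes the derivatives on `[0, t]`
  -- two-sided.
  have hpl : IsPicardLindelof (fun _ : ℝ => fun z => -f z) (tmin := -1) (tmax := t + 1)
      ⟨0, by constructor <;> linarith [t.2]⟩ z (B * (t + 1)) 0 B L := by
    refine IsPicardLindelof.of_time_independent (fun x _ => by simpa using hB x)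
      (h.lipschitz.neg.lipschitzOnWith) ?_
    have : max ((t : ℝ) + 1 - 0) (0 - -1) = t + 1 := by
      rw [max_eq_left] <;> simp
    simp only [this]
    push_cast
    simp
  obtain ⟨β, h0, hβ⟩ := hpl.exists_eq_forall_mem_Icc_hasDerivWithinAt₀
  refine ⟨β, h0, fun s hs => (hβ s ⟨by linarith [hs.1], by linarith [hs.2]⟩).hasDerivAt
    (Icc_mem_nhds (by linarith [hs.1]) (by linarith [hs.2]))⟩

/-- If `Φ t x` were not in `Ω`, it would not be interior to `closure Ω`, so there would be points
`z'` outside the closure arbitrarily near it. Running the ODE backwards from `z'` ends near `x`,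
hence in `Ω`; running forwards again returns to `z'`, against the invariance of `closure Ω`. -/
theorem mapsTo (h : InvariantFlow Ω f Φ L) (t : ℝ≥0) : Set.MapsTo (Φ t) Ω Ω := by
  intro x hxΩ
  have hx := subset_closure hxΩ
  by_contra hz
  obtain ⟨r, hr, hball⟩ := Metric.isOpen_iff.1 h.isOpen x hxΩ
  have hnot : Φ t x ∉ interior (closure Ω) := fun hi => hz (h.regular hi)
  -- Backward flow for time `t` expands distances by at most `e^{Lt}`, so this radius leads back
  -- into the ball of radius `r` about `x`.
  have hr' : 0 < r * Real.exp (-(L * t)) := by positivity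
  obtain ⟨z', hz'ball, hz'⟩ : ∃ z' ∈ Metric.ball (Φ t x) (r * Real.exp (-(L * t))),
      z' ∉ closure Ω := by
    by_contra! hall
    exact hnot (mem_interior_iff_mem_nhds.2
      (mem_of_superset (Metric.ball_mem_nhds _ hr') hall))
  -- The trajectory through `z'` has to come from the field on all of space, since `Φ` is controlled
  -- only on `closure Ω`.
  obtain ⟨β, hβ0, hβ⟩ := h.exists_backward z' t
  have hβc : ContinuousOn β (Set.Icc 0 t) := fun s hs => (hβ s hs).continuousAt.continuousWithinAt
  have hneg : LipschitzWith L fun z => -f z := h.lipschitz.neg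
  have hdist := dist_le_of_trajectories_ODE (v := fun _ z => -f z) (K := L) (a := 0) (b := t)
    (δ := dist z' (Φ t x)) (fun _ => hneg) hβc
    (fun s hs => (hβ s (Set.Ico_subset_Icc_self hs)).hasDerivWithinAt)
    (h.continuousOn_reverse hx t) (fun s hs => h.hasDerivWithinAt_reverse hx t hs)
    (by simp [hβ0]) t (Set.right_mem_Icc.2 t.2)
  have hyΩ : β t ∈ Ω := by
    apply hball
    rw [Metric.mem_ball]
    calc dist (β t) x ≤ dist z' (Φ t x) * Real.exp (L * t) := by
          simpa [h.sol.initial x hx] using hdist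
      _ < r * Real.exp (-(L * t)) * Real.exp (L * t) := by
          gcongr
          exact hz'ball
      _ = r := by rw [mul_assoc, ← Real.exp_add]; simp
  have hy := subset_closure hyΩ
  have hmem : ∀ s ∈ Set.Icc (0 : ℝ) t, (t : ℝ) - s ∈ Set.Icc (0 : ℝ) t :=
    fun s hs => ⟨by linarith [hs.2], by linarith [hs.1]⟩
  have hfwd : ∀ s ∈ Set.Icc (0 : ℝ) t,
      HasDerivAt (fun s : ℝ => β (t - s)) (f (β (t - s))) s := fun s hs => by
    have h2 : HasDerivAt (fun s : ℝ => (t : ℝ) - s) (-1) s := by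
      simpa using (hasDerivAt_id s).const_sub (t : ℝ)
    simpa [Function.comp_def] using (hβ _ (hmem s hs)).scomp s h2
  have huniq := dist_le_of_trajectories_ODE (v := fun _ => f) (K := L) (a := 0) (b := t)
    (δ := 0) (f := fun s : ℝ => β (t - s)) (g := fun s : ℝ => Φ s.toNNReal (β t))
    (fun _ => h.lipschitz)
    (fun s hs => (hfwd s hs).continuousAt.continuousWithinAt)
    (fun s hs => (hfwd s (Set.Ico_subset_Icc_self hs)).hasDerivWithinAt)
    ((h.continuousOn_time hy).mono Set.Icc_subset_Ici_self)
    (fun s hs => h.hasDerivWithinAt_Ici hy hs.1)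
    (by simp [h.sol.initial _ hy]) t (Set.right_mem_Icc.2 t.2)
  have heq : z' = Φ t (β t) := by simpa [hβ0] using huniq
  exact hz' (heq ▸ h.inv _ hy t)

end InvariantFlow

end Koopman

/-! ### Volume distortion by the flow and composition with the flow on `L^p(Ω)`. -/

namespace Koopman

variable {d : ℕ}

open scoped Classical in
/-- The flow, frozen outside `Ω` so that it is globally measurable. -/
def flowMap (Ω : Set (Eucl d)) (Φ : ℝ≥0 → Eucl d → Eucl d) (t : ℝ≥0) : Eucl d → Eucl d :=
  Ω.piecewise (Φ t) id

/-- Bound for the volume distortion of the inverse flow at time `t`. -/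
def distortion (d : ℕ) (L t : ℝ≥0) : ℝ≥0 := (Real.exp (L * t)).toNNReal ^ d

theorem distortion_mono (L : ℝ≥0) : Monotone (distortion d L) := fun s t hst => by
  have h : (s : ℝ) ≤ t := hst
  unfold distortion
  gcongr

/-- Volume is a multiple of the `d`-dimensional Hausdorff measure, by uniqueness of Haar measure,
and the latter scales as claimed under Lipschitz maps. -/
theorem volume_image_le {s : Set (Eucl d)} {g : Eucl d → Eucl d} {K : ℝ≥0}
    (hg : LipschitzOnWith K g s) : volume (g '' s) ≤ (K : ℝ≥0∞) ^ d * volume s := by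
  have hH : (Measure.hausdorffMeasure (d : ℝ) : Measure (Eucl d)).IsAddHaarMeasure := by
    simpa using isAddHaarMeasure_hausdorffMeasure (E := Eucl d)
  have h := hg.hausdorffMeasure_image_le (d := (d : ℝ)) (Nat.cast_nonneg d)
  have heq := Measure.isAddLeftInvariant_eq_smul (volume : Measure (Eucl d))
    (Measure.hausdorffMeasure (d : ℝ))
  rw [heq]
  simp only [Measure.smul_apply, ENNReal.smul_def, smul_eq_mul]
  calc _ ≤ _ := mul_le_mul_right h _
    _ = _ := by rw [ENNReal.rpow_natCast]; ring

namespace InvariantFlow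

variable {Ω : Set (Eucl d)} {f : Eucl d → Eucl d} {Φ : ℝ≥0 → Eucl d → Eucl d} {L : ℝ≥0}

theorem flowMap_of_mem {t : ℝ≥0} {x : Eucl d} (hx : x ∈ Ω) : flowMap Ω Φ t x = Φ t x := by
  simp [flowMap, hx]

theorem flowMap_mem (h : InvariantFlow Ω f Φ L) {t : ℝ≥0} {x : Eucl d} (hx : x ∈ Ω) :
    flowMap Ω Φ t x ∈ Ω := by
  rw [flowMap_of_mem hx]; exact h.mapsTo t hx

theorem measurable_flowMap (h : InvariantFlow Ω f Φ L) (t : ℝ≥0) : Measurable (flowMap Ω Φ t) := by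
  classical
  have := ContinuousOn.measurable_piecewise (s := Ω) (f := Φ t) (g := id)
    (((h.lipschitzOnWith_flow t).continuousOn).mono subset_closure)
    continuousOn_id h.isOpen.measurableSet
  unfold flowMap
  convert this

theorem measurable_uncurry_flowMap (h : InvariantFlow Ω f Φ L) :
    Measurable fun q : ℝ≥0 × Eucl d => flowMap Ω Φ q.1 q.2 := by
  classical
  have := ContinuousOn.measurable_piecewise (s := (Set.univ : Set ℝ≥0) ×ˢ Ω)
    (f := fun q : ℝ≥0 × Eucl d => Φ q.1 q.2) (g := fun q => q.2)
    (h.continuousOn_flow.mono (Set.prod_mono_right subset_closure))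
    continuous_snd.continuousOn (MeasurableSet.univ.prod h.isOpen.measurableSet)
  convert this with q
  by_cases hq : q.2 ∈ Ω <;> simp [flowMap, hq]

theorem continuous_flowMap_time (h : InvariantFlow Ω f Φ L) (x : Eucl d) :
    Continuous fun t => flowMap Ω Φ t x := by
  by_cases hx : x ∈ Ω
  · simpa [flowMap_of_mem hx] using h.continuous_time (subset_closure hx)
  · simp [flowMap, hx, continuous_const]

theorem flowMap_zero (h : InvariantFlow Ω f Φ L) (x : Eucl d) : flowMap Ω Φ 0 x = x := by
  by_cases hx : x ∈ Ω
  · rw [flowMap_of_mem hx, h.sol.initial x (subset_closure hx)]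
  · simp [flowMap, hx]

theorem flowMap_add (h : InvariantFlow Ω f Φ L) (s t : ℝ≥0) (x : Eucl d) :
    flowMap Ω Φ (s + t) x = flowMap Ω Φ s (flowMap Ω Φ t x) := by
  by_cases hx : x ∈ Ω
  · rw [flowMap_of_mem hx, flowMap_of_mem hx, flowMap_of_mem (h.mapsTo t hx),
      h.flow_add (subset_closure hx)]
  · simp [flowMap, hx]

theorem isFiniteMeasure (h : InvariantFlow Ω f Φ L) :
    IsFiniteMeasure (volume.restrict Ω : Measure (Eucl d)) :=
  ⟨by simpa using h.bounded.measure_lt_top⟩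

/-- The flow at time `t` has a globally Lipschitz left inverse on `Ω`, with controlled constant on
the range. -/
theorem exists_leftInverse (h : InvariantFlow Ω f Φ L) (t : ℝ≥0) :
    ∃ τ : Eucl d → Eucl d, Continuous τ ∧ (∀ x ∈ Ω, τ (flowMap Ω Φ t x) = x) ∧
      LipschitzOnWith (Real.exp (L * t)).toNNReal τ (flowMap Ω Φ t '' Ω) := by
  have hinj : Set.InjOn (flowMap Ω Φ t) Ω := by
    intro x hx y hy hxy
    rw [flowMap_of_mem hx, flowMap_of_mem hy] at hxy
    have := h.dist_le_reverse (subset_closure hx) (subset_closure hy) t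
    rw [hxy, dist_self, zero_mul] at this
    exact dist_le_zero.1 this
  have hlip : LipschitzOnWith (Real.exp (L * t)).toNNReal
      (Function.invFunOn (flowMap Ω Φ t) Ω) (flowMap Ω Φ t '' Ω) := by
    refine LipschitzOnWith.of_dist_le_mul ?_
    rintro _ ⟨x, hx, rfl⟩ _ ⟨y, hy, rfl⟩
    rw [hinj.leftInvOn_invFunOn hx, hinj.leftInvOn_invFunOn hy, flowMap_of_mem hx,
      flowMap_of_mem hy, Real.coe_toNNReal _ (Real.exp_pos _).le, mul_comm]
    exact h.dist_le_reverse (subset_closure hx) (subset_closure hy) t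
  -- The extension makes `τ` continuous everywhere but may enlarge the Lipschitz constant, so the
  -- sharp constant is retained only on the range.
  obtain ⟨τ, hτ, heq⟩ := hlip.extend_finite_dimension
  refine ⟨τ, hτ.continuous, fun x hx => ?_, fun y hy z hz => by
    rw [← heq hy, ← heq hz]; exact hlip hy hz⟩
  rw [← heq (Set.mem_image_of_mem _ hx), hinj.leftInvOn_invFunOn hx]

/-- The part of `Ω` that flows into `B` is the image, under the left inverse, of a subset of `B ∩
Ω`; the left inverse has Lipschitz constant `e^{Lt}` there. No Jacobian of the flow is needed. -/
theorem map_flowMap_le (h : InvariantFlow Ω f Φ L) (t : ℝ≥0) :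
    (volume.restrict Ω).map (flowMap Ω Φ t) ≤
      (distortion d L t : ℝ≥0∞) • volume.restrict Ω := by
  refine Measure.le_iff.2 fun B hB => ?_
  obtain ⟨τ, -, hτ, hlip⟩ := h.exists_leftInverse t
  rw [Measure.map_apply (h.measurable_flowMap t) hB, Measure.smul_apply,
    Measure.restrict_apply (h.measurable_flowMap t hB), Measure.restrict_apply hB]
  set A := flowMap Ω Φ t ⁻¹' B ∩ Ω
  have hA : A = τ '' (flowMap Ω Φ t '' A) := by
    rw [Set.image_image]
    exact (Set.image_congr (fun x hx => hτ x hx.2)).trans (Set.image_id' A) |>.symm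
  calc volume A = volume (τ '' (flowMap Ω Φ t '' A)) := by rw [← hA]
    _ ≤ ((Real.exp (L * t)).toNNReal : ℝ≥0∞) ^ d * volume (flowMap Ω Φ t '' A) :=
        volume_image_le (hlip.mono (Set.image_mono Set.inter_subset_right))
    _ ≤ _ := by
        rw [distortion, ENNReal.coe_pow, smul_eq_mul]
        gcongr
        rintro _ ⟨x, hx, rfl⟩
        exact ⟨hx.1, h.flowMap_mem hx.2⟩

theorem quasiMeasurePreserving (h : InvariantFlow Ω f Φ L) (t : ℝ≥0) :
    Measure.QuasiMeasurePreserving (flowMap Ω Φ t) (volume.restrict Ω) (volume.restrict Ω) :=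
  ⟨h.measurable_flowMap t, Measure.absolutelyContinuous_of_le_smul (h.map_flowMap_le t)⟩

/-- The norm of a composition is a norm for the image measure, which is dominated. For `p = ∞` the
exponent `p.toReal⁻¹` is `0`, so the factor is `1`, as it should be. -/
theorem eLpNorm_comp_le (h : InvariantFlow Ω f Φ L) (t : ℝ≥0) {u : Eucl d → ℝ} (p : ℝ≥0∞)
    (hu : AEStronglyMeasurable u (volume.restrict Ω)) :
    eLpNorm (fun x => u (flowMap Ω Φ t x)) p (volume.restrict Ω) ≤
      (distortion d L t : ℝ≥0∞) ^ p.toReal⁻¹ * eLpNorm u p (volume.restrict Ω) := by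
  have hu' := hu.mono_ac (h.quasiMeasurePreserving t).absolutelyContinuous
  have h1 := eLpNorm_map_measure (p := p) hu' (h.measurable_flowMap t).aemeasurable
  have h2 : (distortion d L t : ℝ≥0∞) ≠ 0 := by
    have : 0 < distortion d L t := by unfold distortion; positivity
    exact_mod_cast this.ne'
  have h3 := eLpNorm_smul_measure_of_ne_zero h2 u p (volume.restrict Ω)
  calc _ = eLpNorm u p ((volume.restrict Ω).map (flowMap Ω Φ t)) := h1.symm
    _ ≤ _ := eLpNorm_mono_measure u (h.map_flowMap_le t)
    _ = _ := by rw [h3]; simp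

theorem memLp_comp (h : InvariantFlow Ω f Φ L) (t : ℝ≥0) {u : Eucl d → ℝ} {p : ℝ≥0∞}
    (hu : MemLp u p (volume.restrict Ω)) :
    MemLp (fun x => u (flowMap Ω Φ t x)) p (volume.restrict Ω) :=
  ⟨hu.1.comp_quasiMeasurePreserving (h.quasiMeasurePreserving t),
    (h.eLpNorm_comp_le t p hu.1).trans_lt (ENNReal.mul_lt_top
      (ENNReal.rpow_lt_top_of_nonneg (by positivity) ENNReal.coe_ne_top) hu.2)⟩

theorem integrable_comp (h : InvariantFlow Ω f Φ L) (t : ℝ≥0) {u : Eucl d → ℝ}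
    (hu : Integrable u (volume.restrict Ω)) :
    Integrable (fun x => u (flowMap Ω Φ t x)) (volume.restrict Ω) :=
  memLp_one_iff_integrable.1 (h.memLp_comp t (memLp_one_iff_integrable.2 hu))

theorem integral_norm_comp_le (h : InvariantFlow Ω f Φ L) (t : ℝ≥0) {u : Eucl d → ℝ}
    (hu : Integrable u (volume.restrict Ω)) :
    ∫ x in Ω, ‖u (flowMap Ω Φ t x)‖ ≤ distortion d L t * ∫ x in Ω, ‖u x‖ := by
  have h1 := h.eLpNorm_comp_le t 1 hu.1
  rw [integral_norm_eq_lintegral_enorm (h.integrable_comp t hu).1,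
    integral_norm_eq_lintegral_enorm hu.1, ← eLpNorm_one_eq_lintegral_enorm,
    ← eLpNorm_one_eq_lintegral_enorm]
  have h2 := ENNReal.toReal_mono (ENNReal.mul_ne_top (by simp)
    (memLp_one_iff_integrable.2 hu).2.ne) h1
  simpa using h2

theorem abs_integral_mul_comp_le (h : InvariantFlow Ω f Φ L) {T t : ℝ≥0} (ht : t ≤ T)
    {b u : Eucl d → ℝ} {M : ℝ} (hb : ∀ x, |b x| ≤ M) (hu : Integrable u (volume.restrict Ω)) :
    |∫ x in Ω, b x * u (flowMap Ω Φ t x)| ≤ M * (distortion d L T * ∫ x in Ω, ‖u x‖) := by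
  have hM : 0 ≤ M := (abs_nonneg _).trans (hb 0)
  calc |∫ x in Ω, b x * u (flowMap Ω Φ t x)|
      ≤ ∫ x in Ω, M * ‖u (flowMap Ω Φ t x)‖ := by
        rw [← Real.norm_eq_abs]
        refine norm_integral_le_of_norm_le ((h.integrable_comp t hu).norm.const_mul M)
          (Eventually.of_forall fun x => ?_)
        rw [norm_mul]
        gcongr
        exact hb x
    _ = M * ∫ x in Ω, ‖u (flowMap Ω Φ t x)‖ := integral_const_mul _ _
    _ ≤ M * (distortion d L t * ∫ x in Ω, ‖u x‖) := by
        gcongr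
        exact h.integral_norm_comp_le t hu
    _ ≤ _ := by
        have : 0 ≤ ∫ x in Ω, ‖u x‖ := integral_nonneg fun _ => norm_nonneg _
        gcongr
        exact distortion_mono L ht

theorem integrable_mul_comp (h : InvariantFlow Ω f Φ L) (t : ℝ≥0)
    {b u : Eucl d → ℝ} {M : ℝ} (hbm : AEStronglyMeasurable b (volume.restrict Ω))
    (hb : ∀ x, |b x| ≤ M) (hu : Integrable u (volume.restrict Ω)) :
    Integrable (fun x => b x * u (flowMap Ω Φ t x)) (volume.restrict Ω) :=
  (h.integrable_comp t hu).bdd_mul hbm (Eventually.of_forall hb)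

/-- Weak continuity in time of the composition with the flow. -/
theorem continuous_integral_mul_comp (h : InvariantFlow Ω f Φ L)
    {b u : Eucl d → ℝ} {M : ℝ} (hbm : AEStronglyMeasurable b (volume.restrict Ω))
    (hb : ∀ x, |b x| ≤ M) (hu : Integrable u (volume.restrict Ω)) :
    Continuous fun t => ∫ x in Ω, b x * u (flowMap Ω Φ t x) := by
  have := h.isFiniteMeasure
  have hM : 0 ≤ M := (abs_nonneg _).trans (hb 0)
  refine continuous_of_locally_uniform_approx_of_continuousAt fun t₀ U hU => ?_
  obtain ⟨ε, hε, hεU⟩ := Metric.mem_uniformity_dist.1 hU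
  set D := M * (distortion d L (t₀ + 1) : ℝ) + 1
  have hD : 0 < D := by positivity
  -- For continuous `v` of compact support, continuity in time is dominated convergence. The error
  -- made by replacing `u` is uniform for `t < t₀ + 1` because the distortion is monotone in time.
  obtain ⟨v, hv, hvε, hvc, hvi⟩ := hu.exists_hasCompactSupport_integral_sub_le
    (ε := ε / (2 * D)) (by positivity)
  obtain ⟨N, hN⟩ := hvc.bounded_above_of_compact_support hv
  refine ⟨Set.Iio (t₀ + 1), Iio_mem_nhds (by simp),
    fun t => ∫ x in Ω, b x * v (flowMap Ω Φ t x), ?_, fun t ht => hεU ?_⟩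
  · refine (continuous_of_dominated (F := fun t x => b x * v (flowMap Ω Φ t x))
      (bound := fun _ => M * N) (fun t => ?_) (fun t => ?_) (integrable_const _) ?_).continuousAt
    · exact (h.integrable_mul_comp t hbm hb hvi).1
    · refine Eventually.of_forall fun x => ?_
      rw [norm_mul]
      exact mul_le_mul (hb x) (hN _) (norm_nonneg _) hM
    · exact Eventually.of_forall fun x =>
        continuous_const.mul (hvc.comp (h.continuous_flowMap_time x))
  · rw [Real.dist_eq, ← integral_sub (h.integrable_mul_comp t hbm hb hu)
      (h.integrable_mul_comp t hbm hb hvi)]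
    have h1 := h.abs_integral_mul_comp_le (T := t₀ + 1) (le_of_lt ht) hb (hu.sub hvi)
    simp only [Pi.sub_apply, mul_sub] at h1
    refine h1.trans_lt ?_
    calc M * ((distortion d L (t₀ + 1) : ℝ) * ∫ x in Ω, ‖u x - v x‖)
        ≤ M * ((distortion d L (t₀ + 1) : ℝ) * (ε / (2 * D))) := by gcongr
      _ = (D - 1) * (ε / (2 * D)) := by ring
      _ ≤ D * (ε / (2 * D)) := by gcongr; linarith
      _ = ε / 2 := by field_simp
      _ < ε := half_lt_self hε

/-- Transport of a `C¹` function along the flow, integrated against a bounded function. -/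
theorem integral_mul_comp_sub_of_contDiff (h : InvariantFlow Ω f Φ L)
    {b φ : Eucl d → ℝ} {M : ℝ} (hbm : AEStronglyMeasurable b (volume.restrict Ω))
    (hb : ∀ x, |b x| ≤ M) (hφ : ContDiff ℝ 1 φ) (t : ℝ≥0) :
    ∫ x in Ω, b x * (φ (flowMap Ω Φ t x) - φ x) =
      ∫ s in (0 : ℝ)..t, ∫ x in Ω, b x *
        fderiv ℝ φ (flowMap Ω Φ s.toNNReal x) (f (flowMap Ω Φ s.toNNReal x)) := by
  have := h.isFiniteMeasure
  have hM : 0 ≤ M := (abs_nonneg _).trans (hb 0)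
  set g : Eucl d → ℝ := fun y => fderiv ℝ φ y (f y)
  have hg : Continuous g := (hφ.continuous_fderiv one_ne_zero).clm_apply h.contDiff.continuous
  have hgs : HasCompactSupport g := by
    refine h.compact.mono fun y hy => ?_
    contrapose! hy
    simp only [Function.mem_support, not_not] at hy ⊢
    simp [g, hy]
  obtain ⟨N, hN⟩ := hg.bounded_above_of_compact_support hgs
  have hmeas : Measurable fun q : ℝ × Eucl d => g (flowMap Ω Φ q.1.toNNReal q.2) :=
    hg.measurable.comp (h.measurable_uncurry_flowMap.comp
      ((measurable_real_toNNReal.comp measurable_fst).prodMk measurable_snd))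
  have : IsFiniteMeasure (volume.restrict (Set.uIoc (0 : ℝ) t)) := by
    rw [Set.uIoc_of_le t.coe_nonneg]; infer_instance
  have hint : Integrable (Function.uncurry fun (s : ℝ) x => b x * g (flowMap Ω Φ s.toNNReal x))
      ((volume.restrict (Set.uIoc (0 : ℝ) t)).prod (volume.restrict Ω)) := by
    refine Integrable.of_bound (C := M * N) ?_ (Eventually.of_forall fun q => ?_)
    · exact (hbm.comp_snd).mul hmeas.aestronglyMeasurable
    · rw [Function.uncurry, norm_mul]
      exact mul_le_mul (hb _) (hN _) (norm_nonneg _) hM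
  -- After Fubini the claim is the fundamental theorem of calculus along each single trajectory.
  rw [intervalIntegral_integral_swap hint]
  refine setIntegral_congr_fun h.isOpen.measurableSet fun x hx => ?_
  have hxC := subset_closure hx
  rw [intervalIntegral.integral_const_mul]
  congr 1
  simp only [flowMap_of_mem hx]
  have hcont := h.continuousOn_time hxC
  have hFTC := intervalIntegral.integral_eq_sub_of_hasDeriv_right_of_le (a := (0 : ℝ)) (b := t)
    (f := fun s => φ (Φ s.toNNReal x)) (f' := fun s => g (Φ s.toNNReal x)) t.2
    (hφ.continuous.comp_continuousOn (hcont.mono Set.Icc_subset_Ici_self))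
    (fun s hs => ?_) ?_
  · rw [hFTC]
    simp [h.sol.initial x hxC]
  · have h1 := ((hφ.differentiable one_ne_zero (Φ s.toNNReal x)).hasFDerivAt).comp_hasDerivWithinAt s
      ((h.hasDerivWithinAt_Ici hxC hs.1.le).mono Set.Ioi_subset_Ici_self)
    simpa [Function.comp_def] using h1
  · refine ContinuousOn.intervalIntegrable ?_
    rw [Set.uIcc_of_le t.coe_nonneg]
    exact hg.comp_continuousOn (hcont.mono Set.Icc_subset_Ici_self)

end InvariantFlow

end Koopman

namespace Koopman

variable {d : ℕ}

/-! ### Kernels concentrating on the diagonal -/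

/-- A kernel on `ℝ^d`, of size `M ε^{-d}`, supported within distance `ε` of the diagonal and with
all marginals equal to `c`. -/
structure IsLocalKernel (M c ε : ℝ) (K : Eucl d → Eucl d → ℝ) : Prop where
  measurable : Measurable (Function.uncurry K)
  bound : ∀ x y, |K x y| ≤ M * ε⁻¹ ^ d
  support : ∀ x y, ε ≤ dist x y → K x y = 0
  integral : ∀ x, ∫ y, K x y = c

namespace IsLocalKernel

variable {M c ε : ℝ} {K : Eucl d → Eucl d → ℝ}

/-- The height `M ε^{-d}` balances the volume `ε^d |B₁|` of the support, so the bound does not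
depend on `ε`. -/
theorem lintegral_indicator_le (hε : 0 < ε) (hM : 0 ≤ M) (x : Eucl d) {k : Eucl d → ℝ}
    (hk : ∀ y, |k y| ≤ M * ε⁻¹ ^ d) (hs : ∀ y, ε ≤ dist y x → k y = 0) :
    ∫⁻ y, ‖k y‖ₑ ≤ ENNReal.ofReal M * volume (Metric.ball (0 : Eucl d) 1) := by
  calc ∫⁻ y, ‖k y‖ₑ
      ≤ ∫⁻ y, (Metric.ball x ε).indicator (fun _ => ENNReal.ofReal (M * ε⁻¹ ^ d)) y := by
        refine lintegral_mono fun y => ?_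
        by_cases hy : y ∈ Metric.ball x ε
        · rw [Set.indicator_of_mem hy, Real.enorm_eq_ofReal_abs]
          exact ENNReal.ofReal_le_ofReal (hk y)
        · rw [hs y (by simpa using hy)]; simp
    _ = ENNReal.ofReal (M * ε⁻¹ ^ d) * (ENNReal.ofReal (ε ^ d) *
          volume (Metric.ball (0 : Eucl d) 1)) := by
        rw [lintegral_indicator_const Metric.isOpen_ball.measurableSet,
          Measure.addHaar_ball_of_pos _ _ hε]
        simp
    _ = _ := by
        rw [← mul_assoc, ← ENNReal.ofReal_mul (by positivity), mul_assoc, ← mul_pow,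
          inv_mul_cancel₀ hε.ne', one_pow, mul_one]

theorem lintegral_right_le (hK : IsLocalKernel M c ε K) (hε : 0 < ε) (hM : 0 ≤ M) (x : Eucl d) :
    ∫⁻ y, ‖K x y‖ₑ ≤ ENNReal.ofReal M * volume (Metric.ball (0 : Eucl d) 1) :=
  lintegral_indicator_le hε hM x (hK.bound x) fun y hy => hK.support x y (by rwa [dist_comm])

theorem lintegral_left_le (hK : IsLocalKernel M c ε K) (hε : 0 < ε) (hM : 0 ≤ M) (y : Eucl d) :
    ∫⁻ x, ‖K x y‖ₑ ≤ ENNReal.ofReal M * volume (Metric.ball (0 : Eucl d) 1) :=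
  lintegral_indicator_le hε hM y (fun x => hK.bound x y) fun x hx => hK.support x y hx

theorem measurable_right (hK : IsLocalKernel M c ε K) (x : Eucl d) : Measurable (K x) :=
  hK.measurable.comp measurable_prodMk_left

theorem integrable_right (hK : IsLocalKernel M c ε K) (hε : 0 < ε) (hM : 0 ≤ M) (x : Eucl d) :
    Integrable (K x) :=
  ⟨(hK.measurable_right x).aestronglyMeasurable, (hK.lintegral_right_le hε hM x).trans_lt
    (ENNReal.mul_lt_top ENNReal.ofReal_lt_top measure_ball_lt_top)⟩

theorem integrable_mul (hK : IsLocalKernel M c ε K) {u : Eucl d → ℝ} (hu : Integrable u)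
    (x : Eucl d) : Integrable fun y => K x y * u y :=
  hu.bdd_mul (hK.measurable_right x).aestronglyMeasurable (Eventually.of_forall (hK.bound x))

theorem aestronglyMeasurable_integral (hK : IsLocalKernel M c ε K) {u : Eucl d → ℝ}
    (hu : Integrable u) : AEStronglyMeasurable (fun x => ∫ y, K x y * u y) volume := by
  refine AEStronglyMeasurable.integral_prod_right' (f := fun q : Eucl d × Eucl d => K q.1 q.2 * u q.2)
    ?_
  exact (hK.measurable.aestronglyMeasurable).mul hu.1.comp_snd

/-- Because `K x` has integral `c`, the error equals `∫ K(x,y) (u(y) - u(x)) dy`. Comparing `u` with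
`θ`, which oscillates by at most `δ` at distance less than `ε`, bounds it by `δ` and the two errors
`u - θ`. -/
theorem enorm_integral_sub_le (hK : IsLocalKernel M c ε K) (hε : 0 < ε) (hM : 0 ≤ M)
    {u θ : Eucl d → ℝ} (hu : Integrable u) (hθ : Continuous θ) {δ : ℝ}
    (hδ : ∀ x y, dist x y < ε → dist (θ x) (θ y) ≤ δ) (x : Eucl d) :
    ‖(∫ y, K x y * u y) - c * u x‖ₑ ≤ (∫⁻ y, ‖K x y‖ₑ * ‖u y - θ y‖ₑ) +
      ENNReal.ofReal M * volume (Metric.ball (0 : Eucl d) 1) *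
        (ENNReal.ofReal δ + ‖u x - θ x‖ₑ) := by
  have h1 : (∫ y, K x y * u y) - c * u x = ∫ y, K x y * (u y - u x) := by
    rw [← hK.integral x, ← integral_mul_const, ← integral_sub (hK.integrable_mul hu x)
      ((hK.integrable_right hε hM x).mul_const _)]
    simp only [mul_sub]
  have hm : AEMeasurable fun y => ‖K x y‖ₑ * ‖u y - θ y‖ₑ :=
    ((hK.measurable_right x).enorm.aemeasurable).mul
      (hu.1.sub hθ.aestronglyMeasurable).enorm
  rw [h1]
  calc _ ≤ ∫⁻ y, ‖K x y * (u y - u x)‖ₑ := enorm_integral_le_lintegral_enorm _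
    _ ≤ ∫⁻ y, (‖K x y‖ₑ * ‖u y - θ y‖ₑ + ‖K x y‖ₑ * (ENNReal.ofReal δ + ‖u x - θ x‖ₑ)) := by
        refine lintegral_mono fun y => ?_
        by_cases hy : ε ≤ dist x y
        · simp [hK.support x y hy]
        · rw [enorm_mul, ← mul_add]
          gcongr
          have h2 : u y - u x = (u y - θ y) + ((θ y - θ x) - (u x - θ x)) := by ring
          have h3 : ‖θ y - θ x‖ₑ ≤ ENNReal.ofReal δ := by
            rw [Real.enorm_eq_ofReal_abs, ← Real.dist_eq]
            exact ENNReal.ofReal_le_ofReal (hδ y x (by rw [dist_comm]; exact not_le.1 hy))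
          rw [h2]
          exact (enorm_add_le _ _).trans (by
            gcongr
            exact (enorm_sub_le).trans (by gcongr))
    _ = (∫⁻ y, ‖K x y‖ₑ * ‖u y - θ y‖ₑ) + (∫⁻ y, ‖K x y‖ₑ) *
          (ENNReal.ofReal δ + ‖u x - θ x‖ₑ) := by
        rw [lintegral_add_left' hm, lintegral_mul_const _ (hK.measurable_right x).enorm]
    _ ≤ _ := by
        gcongr
        exact hK.lintegral_right_le hε hM x

/-- Tonelli's theorem, with the bound on the integral of the kernel in its first variable. -/
theorem lintegral_lintegral_le (hK : IsLocalKernel M c ε K) (hε : 0 < ε) (hM : 0 ≤ M)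
    {w : Eucl d → ℝ} (hw : AEStronglyMeasurable w volume) :
    ∫⁻ x, ∫⁻ y, ‖K x y‖ₑ * ‖w y‖ₑ ≤
      ENNReal.ofReal M * volume (Metric.ball (0 : Eucl d) 1) * ∫⁻ y, ‖w y‖ₑ := by
  rw [lintegral_lintegral_swap]
  · rw [← lintegral_const_mul'' _ hw.enorm]
    refine lintegral_mono fun y => ?_
    have hm : Measurable fun x => K x y := hK.measurable.comp measurable_prodMk_right
    rw [lintegral_mul_const _ hm.enorm]
    gcongr
    exact hK.lintegral_left_le hε hM y
  · exact (hK.measurable.enorm.aemeasurable).mul hw.comp_snd.enorm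

/-- Local kernels with marginal `c` approximate `c` times the identity in `L¹`, uniformly. -/
theorem exists_integral_le {Ω : Set (Eucl d)} (hΩ : volume Ω ≠ ∞) {u : Eucl d → ℝ}
    (hu : Integrable u) (M c : ℝ) (hM : 0 ≤ M) {δ : ℝ} (hδ : 0 < δ) :
    ∃ ε₀ > 0, ∀ ε, 0 < ε → ε < ε₀ → ∀ K : Eucl d → Eucl d → ℝ, IsLocalKernel M c ε K →
      Integrable (fun x => (∫ y, K x y * u y) - c * u x) (volume.restrict Ω) ∧
      ∫ x in Ω, ‖(∫ y, K x y * u y) - c * u x‖ ≤ δ := by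
  set C : ℝ≥0∞ := ENNReal.ofReal M * volume (Metric.ball (0 : Eucl d) 1) with hC
  have hCtop : C ≠ ∞ := ENNReal.mul_ne_top ENNReal.ofReal_ne_top measure_ball_lt_top.ne
  set C' := C.toReal
  set V := (volume Ω).toReal
  have hC' : 0 ≤ C' := ENNReal.toReal_nonneg
  have hV : 0 ≤ V := ENNReal.toReal_nonneg
  -- The `L¹` distance from `u` to `θ` enters twice and costs `δ/4` each time; the oscillation of
  -- `θ`, integrated over `Ω`, costs `δ/2`. The summands `1` guard against vanishing constants.
  have hδ₁ : 0 < δ / (4 * (C' + 1)) := by positivity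
  have hδ₂ : 0 < δ / (2 * (C' + 1) * (V + 1)) := by positivity
  obtain ⟨θ, hθs, hθu, hθc, hθi⟩ := hu.exists_hasCompactSupport_integral_sub_le hδ₁
  obtain ⟨ε₀, hε₀, huc⟩ := Metric.uniformContinuous_iff.1
    (hθs.uniformContinuous_of_continuous hθc) _ hδ₂
  refine ⟨ε₀, hε₀, fun ε hε hεε₀ K hK => ?_⟩
  have hw : ∫⁻ y, ‖u y - θ y‖ₑ ≤ ENNReal.ofReal (δ / (4 * (C' + 1))) := by
    have h1 := ofReal_integral_norm_eq_lintegral_enorm (hu.sub hθi)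
    simp only [Pi.sub_apply] at h1
    rw [← h1]
    exact ENNReal.ofReal_le_ofReal hθu
  have hmeas : AEStronglyMeasurable (fun x => (∫ y, K x y * u y) - c * u x) volume :=
    (hK.aestronglyMeasurable_integral hu).sub (hu.1.const_mul c)
  have hm2 : AEMeasurable (fun x => ‖u x - θ x‖ₑ) (volume.restrict Ω) :=
    (hu.1.sub hθc.aestronglyMeasurable).enorm.restrict
  have key : ∫⁻ x in Ω, ‖(∫ y, K x y * u y) - c * u x‖ₑ ≤ ENNReal.ofReal δ := by
    calc _ ≤ ∫⁻ x in Ω, ((∫⁻ y, ‖K x y‖ₑ * ‖u y - θ y‖ₑ) +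
          C * (ENNReal.ofReal (δ / (2 * (C' + 1) * (V + 1))) + ‖u x - θ x‖ₑ)) :=
          lintegral_mono fun x => hK.enorm_integral_sub_le hε hM hu hθc
            (fun x y hxy => (huc (hxy.trans hεε₀)).le) x
      _ = (∫⁻ x in Ω, ∫⁻ y, ‖K x y‖ₑ * ‖u y - θ y‖ₑ) +
          C * (ENNReal.ofReal (δ / (2 * (C' + 1) * (V + 1))) * volume Ω +
            ∫⁻ x in Ω, ‖u x - θ x‖ₑ) := by
          have hm3 : AEMeasurable (fun x => C * (ENNReal.ofReal (δ / (2 * (C' + 1) * (V + 1))) +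
              ‖u x - θ x‖ₑ)) (volume.restrict Ω) :=
            (aemeasurable_const.add hm2).const_mul C
          rw [lintegral_add_right' _ hm3,
            lintegral_const_mul' _ _ hCtop, lintegral_add_left measurable_const,
            lintegral_const, Measure.restrict_apply_univ]
      _ ≤ C * ENNReal.ofReal (δ / (4 * (C' + 1))) +
          C * (ENNReal.ofReal (δ / (2 * (C' + 1) * (V + 1))) * volume Ω +
            ENNReal.ofReal (δ / (4 * (C' + 1)))) := by
          gcongr
          · exact (setLIntegral_le_lintegral _ _).trans
              ((hK.lintegral_lintegral_le hε hM (hu.1.sub hθc.aestronglyMeasurable)).trans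
                (by gcongr; exact hw))
          · exact (setLIntegral_le_lintegral _ _).trans hw
      _ = ENNReal.ofReal (C' * (δ / (4 * (C' + 1))) +
          C' * (δ / (2 * (C' + 1) * (V + 1)) * V + δ / (4 * (C' + 1)))) := by
          rw [ENNReal.ofReal_add (by positivity) (by positivity), ENNReal.ofReal_mul hC',
            ENNReal.ofReal_mul hC', ENNReal.ofReal_add (by positivity) (by positivity),
            ENNReal.ofReal_mul hδ₂.le, ENNReal.ofReal_toReal hCtop, ENNReal.ofReal_toReal hΩ]
      _ ≤ ENNReal.ofReal δ := by
          refine ENNReal.ofReal_le_ofReal ?_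
          have e1 : C' * (δ / (4 * (C' + 1))) ≤ δ / 4 := by
            rw [mul_div_assoc', div_le_div_iff₀ (by positivity) (by norm_num)]
            nlinarith
          have e2 : C' * (δ / (2 * (C' + 1) * (V + 1)) * V) ≤ δ / 2 := by
            have : C' * (δ / (2 * (C' + 1) * (V + 1)) * V) =
                (C' / (C' + 1)) * (V / (V + 1)) * (δ / 2) := by field_simp
            rw [this]
            have a1 : C' / (C' + 1) ≤ 1 := (div_le_one (by positivity)).2 (by linarith)
            have a2 : V / (V + 1) ≤ 1 := (div_le_one (by positivity)).2 (by linarith)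
            have a3 : C' / (C' + 1) * (V / (V + 1)) ≤ 1 :=
              mul_le_one₀ a1 (by positivity) a2
            nlinarith
          linarith
  have hint : Integrable (fun x => (∫ y, K x y * u y) - c * u x) (volume.restrict Ω) :=
    ⟨hmeas.restrict, key.trans_lt ENNReal.ofReal_lt_top⟩
  refine ⟨hint, ?_⟩
  rw [integral_norm_eq_lintegral_enorm hint.1]
  exact ENNReal.toReal_le_of_le_ofReal hδ.le key

end IsLocalKernel

/-! ### Divergence -/

theorem fderiv_eq_sum {E : Type*} [NormedAddCommGroup E] [NormedSpace ℝ E] (A : Eucl d →L[ℝ] E)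
    (v : Eucl d) : A v = ∑ i, v i • A (EuclideanSpace.single i 1) := by
  conv_lhs => rw [← (EuclideanSpace.basisFun (Fin d) ℝ).sum_repr v]
  simp [map_sum]

theorem divergence_smul {ζ : Eucl d → ℝ} {F : Eucl d → Eucl d} {x : Eucl d}
    (hζ : DifferentiableAt ℝ ζ x) (hF : DifferentiableAt ℝ F x) :
    divergence (fun y => ζ y • F y) x = fderiv ℝ ζ x (F x) + ζ x * divergence F x := by
  unfold divergence
  rw [fderiv_fun_smul hζ hF, fderiv_eq_sum (fderiv ℝ ζ x) (F x), Finset.mul_sum,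
    ← Finset.sum_add_distrib]
  refine Finset.sum_congr rfl fun i _ => ?_
  simp
  ring

theorem fderiv_coord {F : Eucl d → Eucl d} {x : Eucl d} (hF : DifferentiableAt ℝ F x) (i : Fin d)
    (v : Eucl d) : fderiv ℝ (fun y => F y i) x v = fderiv ℝ F x v i := by
  have h := (EuclideanSpace.proj (𝕜 := ℝ) i).hasFDerivAt.comp x hF.hasFDerivAt
  have h2 : HasFDerivAt (fun y => F y i) ((EuclideanSpace.proj (𝕜 := ℝ) i).comp (fderiv ℝ F x)) x :=
    h
  rw [h2.fderiv]
  rfl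

theorem contDiff_coord {F : Eucl d → Eucl d} {n : WithTop ℕ∞} (hF : ContDiff ℝ n F) (i : Fin d) :
    ContDiff ℝ n fun y => F y i :=
  (EuclideanSpace.proj (𝕜 := ℝ) i).contDiff.comp hF

theorem integral_fderiv_eq_zero {g : Eucl d → ℝ} (hg : ContDiff ℝ 1 g) (hgs : HasCompactSupport g)
    (v : Eucl d) : ∫ x, fderiv ℝ g x v = 0 := by
  have hi : Integrable fun x => fderiv ℝ g x v :=
    ((hg.continuous_fderiv one_ne_zero).clm_apply continuous_const).integrable_of_hasCompactSupport
      (hgs.fderiv_apply ℝ v)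
  have h := integral_mul_fderiv_eq_neg_fderiv_mul_of_integrable (μ := (volume : Measure (Eucl d)))
    (f := fun _ : Eucl d => (1 : ℝ)) (g := g) (v := v) (by simp)
    (by simpa using hi) (by simpa using hg.continuous.integrable_of_hasCompactSupport hgs)
    (fun x _ => by fun_prop) (fun x _ => hg.differentiable one_ne_zero x)
  simpa using h

theorem continuous_divergence {F : Eucl d → Eucl d} (hF : ContDiff ℝ 1 F) :
    Continuous (divergence F) := by
  unfold divergence
  refine continuous_finsetSum _ fun i _ => ?_
  exact (EuclideanSpace.proj (𝕜 := ℝ) i).continuous.comp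
    ((hF.continuous_fderiv one_ne_zero).clm_apply continuous_const)

theorem hasCompactSupport_divergence {F : Eucl d → Eucl d} (hF : HasCompactSupport F) :
    HasCompactSupport (divergence F) := by
  refine (hF.fderiv ℝ).mono fun x hx => ?_
  contrapose! hx
  simp only [Function.mem_support, not_not] at hx ⊢
  simp [divergence, hx]

theorem integral_divergence_eq_zero {F : Eucl d → Eucl d} (hF : ContDiff ℝ 1 F)
    (hFs : HasCompactSupport F) : ∫ x, divergence F x = 0 := by
  have hsupp : ∀ i, HasCompactSupport fun y => F y i := fun i => hFs.mono fun y hy => by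
    contrapose! hy
    simp only [Function.mem_support, not_not] at hy ⊢
    simp [hy]
  have heq : divergence F = fun x =>
      ∑ i : Fin d, fderiv ℝ (fun y => F y i) x (EuclideanSpace.single i 1) := by
    funext x
    exact Finset.sum_congr rfl fun i _ =>
      (fderiv_coord (hF.differentiable one_ne_zero x) i _).symm
  rw [heq, integral_finsetSum]
  · exact Finset.sum_eq_zero fun i _ =>
      integral_fderiv_eq_zero (contDiff_coord hF i) (hsupp i) _
  · exact fun i _ => (((contDiff_coord hF i).continuous_fderiv one_ne_zero).clm_apply
      continuous_const).integrable_of_hasCompactSupport ((hsupp i).fderiv_apply ℝ _)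

end Koopman

namespace Koopman

variable {d : ℕ}

/-! ### Mollification -/

/-- A fixed smooth bump of integral one, supported in the ball of radius `1/2`. -/
def mollBase (d : ℕ) : Eucl d → ℝ :=
  (⟨1 / 4, 1 / 2, by norm_num, by norm_num⟩ : ContDiffBump (0 : Eucl d)).normed volume

/-- The standard mollifier at scale `ε`. -/
def mollifier (ε : ℝ) (x : Eucl d) : ℝ := ε⁻¹ ^ d * mollBase d (ε⁻¹ • x)

/-- Convolution with the mollifier at scale `ε`. -/
def mollify (ε : ℝ) (u : Eucl d → ℝ) (x : Eucl d) : ℝ := ∫ y, mollifier ε (x - y) * u y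

theorem contDiff_mollBase {n : ℕ∞} : ContDiff ℝ n (mollBase d) := ContDiffBump.contDiff_normed _

theorem contDiff_mollifier {n : ℕ∞} (ε : ℝ) : ContDiff ℝ n (mollifier (d := d) ε) :=
  contDiff_const.mul (contDiff_mollBase.comp (contDiff_const_smul _))

theorem mollBase_eq_zero {x : Eucl d} (hx : 1 / 2 < ‖x‖) : mollBase d x = 0 := by
  rw [← Function.notMem_support, mollBase, ContDiffBump.support_normed_eq]
  simpa using hx.le

theorem hasCompactSupport_mollBase : HasCompactSupport (mollBase d) :=
  ContDiffBump.hasCompactSupport_normed _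

theorem fderiv_mollBase_eq_zero {x : Eucl d} (hx : 1 / 2 < ‖x‖) : fderiv ℝ (mollBase d) x = 0 := by
  rw [← Function.notMem_support]
  refine fun h => ?_
  have h1 := support_fderiv_subset ℝ h
  rw [mollBase, ContDiffBump.tsupport_normed_eq] at h1
  simp at h1
  linarith

/-- At distance at least `ε` the rescaled point lies strictly outside the closed support of the
bump, so the mollifier and its derivative both vanish there. -/
theorem one_le_norm_inv_smul {ε : ℝ} (hε : 0 < ε) {x : Eucl d} (hx : ε ≤ ‖x‖) :
    1 / 2 < ‖ε⁻¹ • x‖ := by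
  rw [norm_smul, norm_inv, Real.norm_of_nonneg hε.le, ← div_eq_inv_mul, lt_div_iff₀ hε]
  linarith

theorem mollifier_eq_zero {ε : ℝ} (hε : 0 < ε) {x : Eucl d} (hx : ε ≤ ‖x‖) :
    mollifier ε x = 0 := by
  rw [mollifier, mollBase_eq_zero (one_le_norm_inv_smul hε hx), mul_zero]

theorem hasCompactSupport_mollifier {ε : ℝ} (hε : 0 < ε) :
    HasCompactSupport (mollifier (d := d) ε) :=
  HasCompactSupport.intro (isCompact_closedBall (0 : Eucl d) ε) fun x hx =>
    mollifier_eq_zero hε (by simpa using (not_le.1 (by simpa using hx : ¬ ‖x‖ ≤ ε)).le)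

theorem hasFDerivAt_mollifier (ε : ℝ) (x : Eucl d) :
    HasFDerivAt (mollifier ε) (ε⁻¹ ^ d • (ε⁻¹ • fderiv ℝ (mollBase d) (ε⁻¹ • x))) x := by
  have h1 : HasFDerivAt (mollBase d) (fderiv ℝ (mollBase d) (ε⁻¹ • x)) (ε⁻¹ • x) :=
    ((contDiff_mollBase (n := 1)).differentiable one_ne_zero _).hasFDerivAt
  have h2 := (h1.comp x ((hasFDerivAt_id x).const_smul ε⁻¹)).const_mul (ε⁻¹ ^ d)
  refine h2.congr_fderiv ?_
  ext v
  simp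

theorem fderiv_mollifier (ε : ℝ) (x v : Eucl d) :
    fderiv ℝ (mollifier ε) x v = ε⁻¹ ^ d * (ε⁻¹ * fderiv ℝ (mollBase d) (ε⁻¹ • x) v) := by
  rw [(hasFDerivAt_mollifier ε x).fderiv]; simp

theorem integral_mollifier {ε : ℝ} (hε : 0 < ε) : ∫ x : Eucl d, mollifier ε x = 1 := by
  unfold mollifier
  rw [integral_const_mul, Measure.integral_comp_inv_smul, mollBase, ContDiffBump.integral_normed]
  simp [abs_of_pos hε, hε.ne']

theorem exists_mollBase_bound (d : ℕ) : ∃ M : ℝ, 0 ≤ M ∧ (∀ x, |mollBase d x| ≤ M) ∧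
    ∀ x, ‖fderiv ℝ (mollBase d) x‖ ≤ M := by
  obtain ⟨M₁, h₁⟩ := (contDiff_mollBase (d := d) (n := 1)).continuous.bounded_above_of_compact_support
    hasCompactSupport_mollBase
  obtain ⟨M₂, h₂⟩ := ((contDiff_mollBase (d := d) (n := 1)).continuous_fderiv
    one_ne_zero).bounded_above_of_compact_support (hasCompactSupport_mollBase.fderiv ℝ)
  exact ⟨max M₁ M₂, (norm_nonneg _).trans ((h₁ 0).trans (le_max_left _ _)),
    fun x => (h₁ x).trans (le_max_left _ _), fun x => (h₂ x).trans (le_max_right _ _)⟩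

theorem abs_mollifier_le {ε M : ℝ} (hε : 0 < ε) (hM : ∀ x, |mollBase d x| ≤ M) (x : Eucl d) :
    |mollifier ε x| ≤ M * ε⁻¹ ^ d := by
  rw [mollifier, abs_mul, abs_of_nonneg (by positivity), mul_comm]
  gcongr
  exact hM _

theorem isLocalKernel_mollifier {ε M : ℝ} (hε : 0 < ε) (hM : ∀ x, |mollBase d x| ≤ M) :
    IsLocalKernel M 1 ε fun x y : Eucl d => mollifier ε (x - y) where
  measurable := (contDiff_mollifier (n := 0) ε).continuous.measurable.comp
    (measurable_fst.sub measurable_snd)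
  bound x y := abs_mollifier_le hε hM _
  support x y hxy := mollifier_eq_zero hε (by rwa [← dist_eq_norm])
  integral x := by rw [integral_sub_left_eq_self (mollifier ε) volume x, integral_mollifier hε]

theorem mollify_eq_convolution (ε : ℝ) (u : Eucl d → ℝ) :
    mollify ε u = convolution u (mollifier ε) (ContinuousLinearMap.lsmul ℝ ℝ) volume := by
  funext x
  simp [mollify, convolution_def, mul_comm]

theorem contDiff_mollify {n : ℕ∞} {ε : ℝ} (hε : 0 < ε) {u : Eucl d → ℝ} (hu : Integrable u) :
    ContDiff ℝ n (mollify ε u) := by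
  rw [mollify_eq_convolution]
  exact (hasCompactSupport_mollifier hε).contDiff_convolution_right _ hu.locallyIntegrable
    (contDiff_mollifier ε)

theorem fderiv_mollify {ε : ℝ} (hε : 0 < ε) {u : Eucl d → ℝ} (hu : Integrable u) (x v : Eucl d) :
    fderiv ℝ (mollify ε u) x v = ∫ y, fderiv ℝ (mollifier ε) (x - y) v * u y := by
  have hc := contDiff_mollifier (d := d) (n := 1) ε
  have hs := hasCompactSupport_mollifier (d := d) hε
  rw [mollify_eq_convolution, (hs.hasFDerivAt_convolution_right (ContinuousLinearMap.lsmul ℝ ℝ)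
      hu.locallyIntegrable hc x).fderiv,
    convolution_precompR_apply _ hu.locallyIntegrable (hs.fderiv ℝ)
      (hc.continuous_fderiv one_ne_zero)]
  simp [convolution_def, mul_comm]

/-- The kernel of the commutator of the derivative along `f` with mollification. -/
def commutatorKernel (f : Eucl d → Eucl d) (ε : ℝ) (x y : Eucl d) : ℝ :=
  fderiv ℝ (mollifier ε) (x - y) (f x - f y) + mollifier ε (x - y) * divergence f y

theorem hasFDerivAt_mollifier_sub (ε : ℝ) (x y : Eucl d) :
    HasFDerivAt (fun y => mollifier ε (x - y)) (-fderiv ℝ (mollifier ε) (x - y)) y := by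
  have h1 : HasFDerivAt (mollifier ε) (fderiv ℝ (mollifier ε) (x - y)) (x - y) :=
    ((contDiff_mollifier (n := 1) ε).differentiable one_ne_zero _).hasFDerivAt
  refine (h1.comp y ((hasFDerivAt_id y).const_sub x)).congr_fderiv ?_
  ext v
  simp

/-- In `y` the kernel is the divergence of a compactly supported field, hence has integral zero.
This is why the commutator disappears in the limit. -/
theorem commutatorKernel_eq_divergence {f : Eucl d → Eucl d} (hf : ContDiff ℝ 1 f) (ε : ℝ)
    (x y : Eucl d) :
    commutatorKernel f ε x y = divergence (fun y => mollifier ε (x - y) • (f y - f x)) y := by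
  have hfd := hf.differentiable one_ne_zero y
  rw [divergence_smul (hasFDerivAt_mollifier_sub ε x y).differentiableAt (hfd.sub_const _),
    (hasFDerivAt_mollifier_sub ε x y).fderiv, commutatorKernel]
  have : divergence (fun y => f y - f x) y = divergence f y := by
    unfold divergence; rw [fderiv_sub_const]
  rw [this]
  simp [map_sub]
  ring

theorem hasCompactSupport_mollifier_sub {ε : ℝ} (hε : 0 < ε) (x : Eucl d) :
    HasCompactSupport fun y => mollifier ε (x - y) :=
  HasCompactSupport.intro (isCompact_closedBall x ε) fun y hy =>
    mollifier_eq_zero hε (by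
      rw [← dist_eq_norm, dist_comm]; exact (not_le.1 (by simpa using hy)).le)

/-- The gradient of the mollifier has size `ε^{-d-1}`, but it is applied to `f x - f y`, which is at
most `Lε` on the support; the extra factor `ε⁻¹` cancels. -/
theorem isLocalKernel_commutatorKernel {f : Eucl d → Eucl d} (hf : ContDiff ℝ 1 f) {L : ℝ≥0}
    (hL : LipschitzWith L f) {D M ε : ℝ} (hε : 0 < ε) (hD : ∀ x, |divergence f x| ≤ D)
    (hM : ∀ x, |mollBase d x| ≤ M) (hM' : ∀ x, ‖fderiv ℝ (mollBase d) x‖ ≤ M) :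
    IsLocalKernel (M * L + M * D) 0 ε (commutatorKernel f ε) where
  measurable := by
    have h1 : Continuous fun q : Eucl d × Eucl d =>
        fderiv ℝ (mollifier ε) (q.1 - q.2) (f q.1 - f q.2) +
          mollifier ε (q.1 - q.2) * divergence f q.2 := by
      have c1 := (contDiff_mollifier (d := d) (n := 1) ε).continuous_fderiv one_ne_zero
      have c2 := (contDiff_mollifier (d := d) (n := 1) ε).continuous
      have c3 := continuous_divergence hf
      have c4 := hf.continuous
      exact ((c1.comp (continuous_fst.sub continuous_snd)).clm_apply
        ((c4.comp continuous_fst).sub (c4.comp continuous_snd))).add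
        ((c2.comp (continuous_fst.sub continuous_snd)).mul (c3.comp continuous_snd))
    exact h1.measurable
  bound x y := by
    have hM0 : 0 ≤ M := (abs_nonneg _).trans (hM 0)
    have hD0 : 0 ≤ D := (abs_nonneg _).trans (hD 0)
    rcases le_or_gt ε ‖x - y‖ with hxy | hxy
    · rw [commutatorKernel, fderiv_mollifier, mollifier_eq_zero hε hxy,
        fderiv_mollBase_eq_zero (one_le_norm_inv_smul hε hxy)]
      simp
      positivity
    · have h1 : |fderiv ℝ (mollifier ε) (x - y) (f x - f y)| ≤ M * L * ε⁻¹ ^ d := by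
        rw [fderiv_mollifier, abs_mul, abs_mul, abs_of_nonneg (by positivity : 0 ≤ ε⁻¹ ^ d),
          abs_of_nonneg (by positivity : 0 ≤ ε⁻¹)]
        have h2 : |fderiv ℝ (mollBase d) (ε⁻¹ • (x - y)) (f x - f y)| ≤ M * (L * ε) := by
          refine ((fderiv ℝ (mollBase d) (ε⁻¹ • (x - y))).le_opNorm (f x - f y)).trans ?_
          gcongr
          · exact hM' _
          · refine (hL.norm_sub_le x y).trans ?_
            gcongr
        calc ε⁻¹ ^ d * (ε⁻¹ * |fderiv ℝ (mollBase d) (ε⁻¹ • (x - y)) (f x - f y)|)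
            ≤ ε⁻¹ ^ d * (ε⁻¹ * (M * (L * ε))) := by gcongr
          _ = M * L * ε⁻¹ ^ d := by field_simp
      have h3 : |mollifier ε (x - y) * divergence f y| ≤ M * D * ε⁻¹ ^ d := by
        rw [abs_mul]
        calc _ ≤ (M * ε⁻¹ ^ d) * D :=
              mul_le_mul (abs_mollifier_le hε hM _) (hD y) (abs_nonneg _) (by positivity)
          _ = _ := by ring
      calc |commutatorKernel f ε x y| ≤ _ := abs_add_le _ _
        _ ≤ M * L * ε⁻¹ ^ d + M * D * ε⁻¹ ^ d := add_le_add h1 h3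
        _ = _ := by ring
  support x y hxy := by
    rw [dist_eq_norm] at hxy
    rw [commutatorKernel, fderiv_mollifier, mollifier_eq_zero hε hxy,
      fderiv_mollBase_eq_zero (one_le_norm_inv_smul hε hxy)]
    simp
  integral x := by
    simp only [commutatorKernel_eq_divergence hf]
    refine integral_divergence_eq_zero ?_ (hasCompactSupport_mollifier_sub hε x).smul_right
    exact ((contDiff_mollifier (n := 1) ε).comp (contDiff_const.sub contDiff_id)).smul
      (hf.sub contDiff_const)

theorem isTestFunction_mollifier_sub {Ω : Set (Eucl d)} {ε : ℝ} (hε : 0 < ε) {x : Eucl d}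
    (hx : Metric.closedBall x ε ⊆ Ω) : IsTestFunction Ω fun y => mollifier ε (x - y) where
  smooth := (contDiff_mollifier ε).comp (contDiff_const.sub contDiff_id)
  compact := hasCompactSupport_mollifier_sub hε x
  support_subset := by
    refine (closure_minimal (fun y hy => ?_) Metric.isClosed_closedBall).trans hx
    contrapose! hy
    simp only [Function.mem_support, not_not]
    exact mollifier_eq_zero hε (by
      rw [← dist_eq_norm, dist_comm]; exact (not_le.1 (by simpa using hy)).le)

/-- The commutator identity: the derivative along `f` of the mollification is the mollification of
the weak derivative along `f`, up to an integral operator with the commutator kernel. -/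
theorem HasWeakDerivAlong.fderiv_mollify {Ω : Set (Eucl d)} (hΩ : IsOpen Ω)
    {f : Eucl d → Eucl d} (hf : ContDiff ℝ 1 f) {φ ψ : Eucl d → ℝ}
    (h : HasWeakDerivAlong Ω f φ ψ) (hφ : IntegrableOn φ Ω)
    {M D : ℝ} {L : ℝ≥0} (hL : LipschitzWith L f) (hD : ∀ x, |divergence f x| ≤ D)
    (hM : ∀ x, |mollBase d x| ≤ M) (hM' : ∀ x, ‖fderiv ℝ (mollBase d) x‖ ≤ M)
    {ε : ℝ} (hε : 0 < ε) {x : Eucl d} (hx : Metric.closedBall x ε ⊆ Ω) :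
    fderiv ℝ (mollify ε (Ω.indicator φ)) x (f x) =
      mollify ε (Ω.indicator ψ) x + ∫ y, commutatorKernel f ε x y * Ω.indicator φ y := by
  have hφi : Integrable (Ω.indicator φ) := (integrable_indicator_iff hΩ.measurableSet).2 hφ
  -- The weak equation is tested with `mollifier ε (x - ·)`. It involves `f y`, whereas the
  -- derivative of the mollification at `x` involves `f x`; the difference is the commutator.
  have hζ := isTestFunction_mollifier_sub hε hx
  have hw := h.integral_eq _ hζ
  have hR := (isLocalKernel_commutatorKernel hf hL hε hD hM hM').integrable_mul hφi x
  have e1 : mollify ε (Ω.indicator ψ) x = ∫ y in Ω, ψ y * mollifier ε (x - y) := by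
    rw [mollify, ← integral_indicator hΩ.measurableSet]
    refine integral_congr_ae (Eventually.of_forall fun y => ?_)
    by_cases hy : y ∈ Ω <;> simp [hy, mul_comm]
  have e2 : ∫ y in Ω, φ y * divergence (fun y => mollifier ε (x - y) • f y) y =
      ∫ y, (commutatorKernel f ε x y * Ω.indicator φ y -
        fderiv ℝ (mollifier ε) (x - y) (f x) * Ω.indicator φ y) := by
    rw [← integral_indicator hΩ.measurableSet]
    refine integral_congr_ae (Eventually.of_forall fun y => ?_)
    by_cases hy : y ∈ Ω
    · simp only [Set.indicator_of_mem hy]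
      rw [divergence_smul (hasFDerivAt_mollifier_sub ε x y).differentiableAt
        (hf.differentiable one_ne_zero y), (hasFDerivAt_mollifier_sub ε x y).fderiv,
        commutatorKernel]
      simp only [map_sub, neg_apply]
      ring
    · simp [hy]
  have hint : Integrable fun y => fderiv ℝ (mollifier ε) (x - y) (f x) * Ω.indicator φ y := by
    obtain ⟨B, hB⟩ := (((contDiff_mollifier (d := d) (n := 1) ε).continuous_fderiv
      one_ne_zero).clm_apply (continuous_const (y := f x))).bounded_above_of_compact_support
      ((hasCompactSupport_mollifier hε).fderiv_apply ℝ (f x))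
    refine hφi.bdd_mul (c := B) ?_ (Eventually.of_forall fun y => hB (x - y))
    exact ((((contDiff_mollifier (d := d) (n := 1) ε).continuous_fderiv
      one_ne_zero).clm_apply continuous_const).comp
        (continuous_const.sub continuous_id)).aestronglyMeasurable
  rw [e2, integral_sub hR hint, ← e1] at hw
  rw [Koopman.fderiv_mollify hε hφi]
  linarith

end Koopman

namespace Koopman

variable {d : ℕ}

namespace InvariantFlow

variable {Ω : Set (Eucl d)} {f : Eucl d → Eucl d} {Φ : ℝ≥0 → Eucl d → Eucl d} {L : ℝ≥0}

/-! ### Transport of weak derivatives along the flow -/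

theorem continuous_integral_mul_comp_real (h : InvariantFlow Ω f Φ L)
    {b u : Eucl d → ℝ} {M : ℝ} (hbm : AEStronglyMeasurable b (volume.restrict Ω))
    (hb : ∀ x, |b x| ≤ M) (hu : Integrable u (volume.restrict Ω)) :
    Continuous fun s : ℝ => ∫ x in Ω, b x * u (flowMap Ω Φ s.toNNReal x) :=
  (h.continuous_integral_mul_comp hbm hb hu).comp continuous_real_toNNReal

theorem abs_intervalIntegral_le (h : InvariantFlow Ω f Φ L) {b u : Eucl d → ℝ} {M : ℝ}
    (hb : ∀ x, |b x| ≤ M) (hu : Integrable u (volume.restrict Ω)) (t : ℝ≥0) :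
    |∫ s in (0 : ℝ)..t, ∫ x in Ω, b x * u (flowMap Ω Φ s.toNNReal x)| ≤
      M * (distortion d L t * ∫ x in Ω, ‖u x‖) * t := by
  have := intervalIntegral.norm_integral_le_of_norm_le_const (a := (0 : ℝ)) (b := t)
    (f := fun s => ∫ x in Ω, b x * u (flowMap Ω Φ s.toNNReal x))
    (C := M * (distortion d L t * ∫ x in Ω, ‖u x‖)) (fun s hs => by
      rw [Set.uIoc_of_le t.coe_nonneg] at hs
      exact h.abs_integral_mul_comp_le (T := t) (Real.toNNReal_le_iff_le_coe.2 hs.2) hb hu)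
  simpa using this

theorem integral_mul_comp_add (h : InvariantFlow Ω f Φ L) (t : ℝ≥0)
    {b u v : Eucl d → ℝ} {M : ℝ} (hbm : AEStronglyMeasurable b (volume.restrict Ω))
    (hb : ∀ x, |b x| ≤ M) (hu : Integrable u (volume.restrict Ω))
    (hv : Integrable v (volume.restrict Ω)) :
    ∫ x in Ω, b x * (u + v) (flowMap Ω Φ t x) =
      (∫ x in Ω, b x * u (flowMap Ω Φ t x)) + ∫ x in Ω, b x * v (flowMap Ω Φ t x) := by
  rw [← integral_add (h.integrable_mul_comp t hbm hb hu) (h.integrable_mul_comp t hbm hb hv)]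
  simp only [Pi.add_apply, mul_add]

theorem integral_mul_comp_congr (h : InvariantFlow Ω f Φ L) (t : ℝ≥0) (b : Eucl d → ℝ)
    {u v : Eucl d → ℝ} (huv : ∀ x ∈ Ω, u x = v x) :
    ∫ x in Ω, b x * u (flowMap Ω Φ t x) = ∫ x in Ω, b x * v (flowMap Ω Φ t x) :=
  setIntegral_congr_fun h.isOpen.measurableSet fun x hx => by
    simp only [huv _ (h.flowMap_mem hx)]

theorem exists_divergence_bound (h : InvariantFlow Ω f Φ L) :
    ∃ D : ℝ, 0 ≤ D ∧ ∀ x, |divergence f x| ≤ D := by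
  obtain ⟨D, hD⟩ := (continuous_divergence h.contDiff).bounded_above_of_compact_support
    (hasCompactSupport_divergence h.compact)
  exact ⟨D, (norm_nonneg _).trans (hD 0), hD⟩

theorem integral_mul_comp_sub_of_contDiff' (h : InvariantFlow Ω f Φ L)
    {b φ : Eucl d → ℝ} {M : ℝ} (hbm : AEStronglyMeasurable b (volume.restrict Ω))
    (hb : ∀ x, |b x| ≤ M) (hφ : ContDiff ℝ 1 φ) (hφi : Integrable φ (volume.restrict Ω))
    (t : ℝ≥0) :
    (∫ x in Ω, b x * φ (flowMap Ω Φ t x)) - (∫ x in Ω, b x * φ x) =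
      ∫ s in (0 : ℝ)..t, ∫ x in Ω, b x *
        fderiv ℝ φ (flowMap Ω Φ s.toNNReal x) (f (flowMap Ω Φ s.toNNReal x)) := by
  rw [← h.integral_mul_comp_sub_of_contDiff hbm hb hφ, ← integral_sub
    (h.integrable_mul_comp t hbm hb hφi) (hφi.bdd_mul hbm (Eventually.of_forall hb))]
  simp only [mul_sub]

/-- If `fᵀ∇φ = ψ` weakly on `Ω`, then `φ ∘ Φ^t - φ = ∫_0^t ψ ∘ Φ^s ds`, tested against bounded
functions with compact support in `Ω`. -/
theorem integral_mul_comp_sub_eq (h : InvariantFlow Ω f Φ L) {φ ψ : Eucl d → ℝ}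
    (hφ : IntegrableOn φ Ω) (hψ : IntegrableOn ψ Ω) (hw : HasWeakDerivAlong Ω f φ ψ)
    {b : Eucl d → ℝ} {M : ℝ} (hbm : AEStronglyMeasurable b (volume.restrict Ω))
    (hb : ∀ x, |b x| ≤ M) {K : Set (Eucl d)} (hK : IsCompact K) (hKΩ : K ⊆ Ω)
    (hbK : ∀ x, x ∉ K → b x = 0) (t : ℝ≥0) :
    (∫ x in Ω, b x * φ (flowMap Ω Φ t x)) - (∫ x in Ω, b x * φ x) =
      ∫ s in (0 : ℝ)..t, ∫ x in Ω, b x * ψ (flowMap Ω Φ s.toNNReal x) := by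
  have hM : 0 ≤ M := (abs_nonneg _).trans (hb 0)
  obtain ⟨D, hD0, hD⟩ := h.exists_divergence_bound
  obtain ⟨m, hm0, hm, hm'⟩ := exists_mollBase_bound d
  have hφi : Integrable (Ω.indicator φ) := (integrable_indicator_iff h.isOpen.measurableSet).2 hφ
  have hψi : Integrable (Ω.indicator ψ) := (integrable_indicator_iff h.isOpen.measurableSet).2 hψ
  have hvol : volume Ω ≠ ∞ := h.bounded.measure_lt_top.ne
  -- the compact set swept by `K`
  have hK' : IsCompact ((fun q : ℝ≥0 × Eucl d => Φ q.1 q.2) '' (Set.Icc 0 t ×ˢ K)) :=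
    (isCompact_Icc.prod hK).image_of_continuousOn
      (h.continuousOn_flow.mono (Set.prod_mono (Set.subset_univ _) (hKΩ.trans subset_closure)))
  obtain ⟨ε₁, hε₁, hthick⟩ := hK'.exists_cthickening_subset_open h.isOpen (by
    rintro _ ⟨q, hq, rfl⟩
    exact h.mapsTo q.1 (hKΩ hq.2))
  -- The error in `φ` appears at the times `t` and `0`; the error in `ψ` and the commutator are each
  -- integrated over `[0, t]`.
  set C : ℝ := M * distortion d L t * (2 + 2 * t) with hCdef
  have hC : 0 ≤ C := by positivity
  refine eq_of_forall_dist_le fun ρ hρ => ?_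
  set δ := ρ / (C + 1)
  have hδ : 0 < δ := by positivity
  obtain ⟨ε₂, hε₂, H₂⟩ := IsLocalKernel.exists_integral_le hvol hφi m 1 hm0 hδ
  obtain ⟨ε₃, hε₃, H₃⟩ := IsLocalKernel.exists_integral_le hvol hψi m 1 hm0 hδ
  -- The same approximation lemma with marginal `0` says that the commutator is small in `L¹`.
  obtain ⟨ε₄, hε₄, H₄⟩ := IsLocalKernel.exists_integral_le hvol hφi (m * L + m * D) 0
    (by positivity) hδ
  obtain ⟨ε, hε, hεlt⟩ : ∃ ε, 0 < ε ∧ ε < min (min ε₁ ε₂) (min ε₃ ε₄) :=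
    exists_between (by simp [hε₁, hε₂, hε₃, hε₄])
  simp only [lt_min_iff] at hεlt
  obtain ⟨i₂, n₂⟩ := H₂ ε hε hεlt.1.2 _ (isLocalKernel_mollifier hε hm)
  obtain ⟨i₃, n₃⟩ := H₃ ε hε hεlt.2.1 _ (isLocalKernel_mollifier hε hm)
  obtain ⟨i₄, n₄⟩ := H₄ ε hε hεlt.2.2 _
    (isLocalKernel_commutatorKernel h.contDiff h.lipschitz hε hD hm hm')
  set w₂ : Eucl d → ℝ := fun x => (∫ y, mollifier ε (x - y) * Ω.indicator φ y) -
    1 * Ω.indicator φ x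
  set w₃ : Eucl d → ℝ := fun x => (∫ y, mollifier ε (x - y) * Ω.indicator ψ y) -
    1 * Ω.indicator ψ x
  set w₄ : Eucl d → ℝ := fun x => (∫ y, commutatorKernel f ε x y * Ω.indicator φ y) -
    0 * Ω.indicator φ x
  have hφr : Integrable (Ω.indicator φ) (volume.restrict Ω) := hφi.restrict
  have hψr : Integrable (Ω.indicator ψ) (volume.restrict Ω) := hψi.restrict
  have e₂ : mollify ε (Ω.indicator φ) = Ω.indicator φ + w₂ := by
    funext x; simp [w₂, mollify]
  have e₃ : mollify ε (Ω.indicator ψ) = Ω.indicator ψ + w₃ := by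
    funext x; simp [w₃, mollify]
  have hsmooth : ContDiff ℝ 1 (mollify ε (Ω.indicator φ)) := contDiff_mollify (n := 1) hε hφi
  have hT := h.integral_mul_comp_sub_of_contDiff' hbm hb hsmooth (e₂ ▸ hφr.add i₂) t
  have hcongr : ∀ u : Eucl d → ℝ, ∀ x ∈ Ω, u x = Ω.indicator u x := fun u x hx => by simp [hx]
  -- left-hand side
  have hL : (∫ x in Ω, b x * mollify ε (Ω.indicator φ) (flowMap Ω Φ t x)) -
      (∫ x in Ω, b x * mollify ε (Ω.indicator φ) x) =
      ((∫ x in Ω, b x * φ (flowMap Ω Φ t x)) - (∫ x in Ω, b x * φ x)) +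
        ((∫ x in Ω, b x * w₂ (flowMap Ω Φ t x)) -
          ∫ x in Ω, b x * w₂ (flowMap Ω Φ 0 x)) := by
    have a1 := h.integral_mul_comp_add t hbm hb hφr i₂
    have a2 := h.integral_mul_comp_add 0 hbm hb hφr i₂
    rw [← e₂, ← h.integral_mul_comp_congr t b (hcongr φ)] at a1
    rw [← e₂, ← h.integral_mul_comp_congr 0 b (hcongr φ)] at a2
    simp only [h.flowMap_zero] at a2 ⊢
    rw [a1, a2]
    ring
  -- right-hand side
  have hR : ∫ s in (0 : ℝ)..t, ∫ x in Ω, b x *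
        fderiv ℝ (mollify ε (Ω.indicator φ)) (flowMap Ω Φ s.toNNReal x)
          (f (flowMap Ω Φ s.toNNReal x)) =
      (∫ s in (0 : ℝ)..t, ∫ x in Ω, b x * ψ (flowMap Ω Φ s.toNNReal x)) +
      ((∫ s in (0 : ℝ)..t, ∫ x in Ω, b x * w₃ (flowMap Ω Φ s.toNNReal x)) +
        ∫ s in (0 : ℝ)..t, ∫ x in Ω, b x * w₄ (flowMap Ω Φ s.toNNReal x)) := by
    have c₁ := (h.continuous_integral_mul_comp_real hbm hb hψ).intervalIntegrable
      (μ := volume) 0 t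
    have c₃ := (h.continuous_integral_mul_comp_real hbm hb i₃).intervalIntegrable
      (μ := volume) 0 t
    have c₄ := (h.continuous_integral_mul_comp_real hbm hb i₄).intervalIntegrable
      (μ := volume) 0 t
    rw [← intervalIntegral.integral_add c₃ c₄, ← intervalIntegral.integral_add c₁ (c₃.add c₄)]
    refine intervalIntegral.integral_congr fun s hs => ?_
    rw [Set.uIcc_of_le t.coe_nonneg] at hs
    have a3 := h.integral_mul_comp_add s.toNNReal hbm hb hψr (i₃.add i₄)
    have a4 := h.integral_mul_comp_add s.toNNReal hbm hb i₃ i₄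
    rw [← h.integral_mul_comp_congr s.toNNReal b (hcongr ψ), a4] at a3
    rw [← a3]
    refine setIntegral_congr_fun h.isOpen.measurableSet fun x hx => ?_
    -- Only points of `K` contribute. Their trajectories up to time `t` keep an `ε`-ball inside `Ω`,
    -- as the commutator identity requires.
    by_cases hxK : x ∈ K
    · have hball : Metric.closedBall (flowMap Ω Φ s.toNNReal x) ε ⊆ Ω := by
        refine (Metric.closedBall_subset_cthickening ?_ ε).trans
          ((Metric.cthickening_mono hεlt.1.1.le _).trans hthick)
        rw [flowMap_of_mem hx]
        exact ⟨(s.toNNReal, x), ⟨⟨bot_le, Real.toNNReal_le_iff_le_coe.2 hs.2⟩, hxK⟩, rfl⟩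
      rw [hw.fderiv_mollify h.isOpen h.contDiff hφ h.lipschitz hD hm hm' hε hball, e₃]
      simp [w₄, add_assoc]
    · simp [hbK x hxK]
  rw [hL, hR] at hT
  have b1 := h.abs_integral_mul_comp_le (le_refl t) hb i₂
  have b2 := h.abs_integral_mul_comp_le (zero_le : 0 ≤ t) hb i₂
  have b3 := h.abs_intervalIntegral_le hb i₃ t
  have b4 := h.abs_intervalIntegral_le hb i₄ t
  have k : ∀ r : ℝ, r ≤ δ → M * (distortion d L t * r) ≤ M * (distortion d L t * δ) :=
    fun r hr => by gcongr
  have k2 := mul_le_mul_of_nonneg_right (k _ n₃) t.coe_nonneg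
  have k3 := mul_le_mul_of_nonneg_right (k _ n₄) t.coe_nonneg
  have k1 := k _ n₂
  rw [Real.dist_eq]
  have hfin : C * δ ≤ ρ := by
    rw [mul_div_assoc', div_le_iff₀ (by positivity)]
    nlinarith
  have hexp : C * δ = 2 * (M * (distortion d L t * δ)) + 2 * (M * (distortion d L t * δ) * t) := by
    rw [hCdef]; ring
  rw [abs_le] at b1 b2 b3 b4 ⊢
  constructor <;> linarith [b1.1, b1.2, b2.1, b2.2, b3.1, b3.2, b4.1, b4.2]

end InvariantFlow

end Koopman

namespace Koopman

variable {d : ℕ}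

/-! ### Test functions times a vector field -/

theorem IsTestFunction.contDiff_one {Ω : Set (Eucl d)} {η : Eucl d → ℝ}
    (hη : IsTestFunction Ω η) : ContDiff ℝ 1 η := hη.smooth.of_le (by exact_mod_cast le_top)

theorem IsTestFunction.contDiff_smul {Ω : Set (Eucl d)} {η : Eucl d → ℝ}
    (hη : IsTestFunction Ω η) {f : Eucl d → Eucl d} (hf : ContDiff ℝ 1 f) :
    ContDiff ℝ 1 fun y => η y • f y := hη.contDiff_one.smul hf

theorem divergence_eq_sum {F : Eucl d → Eucl d} (hF : ContDiff ℝ 1 F) (x : Eucl d) :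
    divergence F x = ∑ i : Fin d, fderiv ℝ (fun y => F y i) x (EuclideanSpace.single i 1) :=
  Finset.sum_congr rfl fun i _ => (fderiv_coord (hF.differentiable one_ne_zero x) i _).symm

theorem divergence_eq_zero {F : Eucl d → Eucl d} {x : Eucl d} (hx : x ∉ tsupport F) :
    divergence F x = 0 := by
  have : fderiv ℝ F x = 0 := by
    by_contra h
    exact hx (support_fderiv_subset ℝ h)
  simp [divergence, this]

theorem divergence_smul_eq_zero {η : Eucl d → ℝ}
    (f : Eucl d → Eucl d) {x : Eucl d} (hx : x ∉ tsupport η) :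
    divergence (fun y => η y • f y) x = 0 :=
  divergence_eq_zero fun h => hx (closure_mono (Function.support_smul_subset_left η f) h)

theorem IsTestFunction.exists_divergence_bound {Ω : Set (Eucl d)} {η : Eucl d → ℝ}
    (hη : IsTestFunction Ω η) {f : Eucl d → Eucl d} (hf : ContDiff ℝ 1 f) :
    ∃ M, ∀ x, |divergence (fun y => η y • f y) x| ≤ M :=
  (continuous_divergence (hη.contDiff_smul hf)).bounded_above_of_compact_support
    (hasCompactSupport_divergence hη.compact.smul_right)

theorem IsTestFunction.exists_bound {Ω : Set (Eucl d)} {η : Eucl d → ℝ}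
    (hη : IsTestFunction Ω η) : ∃ M, ∀ x, |η x| ≤ M :=
  hη.contDiff_one.continuous.bounded_above_of_compact_support hη.compact

/-- Integration by parts along a vector field, for Lipschitz functions. -/
theorem LipschitzWith.integral_mul_fderiv_eq {u : Eucl d → ℝ} {C : ℝ≥0} (hu : LipschitzWith C u)
    {F : Eucl d → Eucl d} (hF : ContDiff ℝ 1 F) (hFs : HasCompactSupport F) :
    ∫ x, fderiv ℝ u x (F x) = -∫ x, divergence F x * u x := by
  have hFis : ∀ i, HasCompactSupport fun y => F y i := fun i => hFs.mono fun y hy => by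
    contrapose! hy
    simp only [Function.mem_support, not_not] at hy ⊢
    simp [hy]
  have hFi : ∀ i, ContDiff ℝ 1 fun y => F y i := fun i => contDiff_coord hF i
  have hlip : ∀ i, ∃ D, LipschitzWith D fun y => F y i := fun i =>
    (hFi i).lipschitzWith_of_hasCompactSupport (hFis i) one_ne_zero
  have h1 : ∫ x, fderiv ℝ u x (F x) =
      ∫ x, ∑ i, lineDeriv ℝ u x (EuclideanSpace.single i 1) * F x i := by
    refine integral_congr_ae ?_
    -- By Rademacher's theorem the derivative splits almost everywhere into line derivatives, for
    -- which integration by parts of Lipschitz functions is available coordinatewise.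
    filter_upwards [hu.ae_differentiableAt (μ := volume)] with x hx
    rw [fderiv_eq_sum]
    refine Finset.sum_congr rfl fun i _ => ?_
    rw [hx.lineDeriv_eq_fderiv, smul_eq_mul, mul_comm]
  have hint1 : ∀ i, Integrable fun x => lineDeriv ℝ u x (EuclideanSpace.single i 1) * F x i :=
    fun i => ((hFi i).continuous.integrable_of_hasCompactSupport (hFis i)).bdd_mul
      (c := C * ‖(EuclideanSpace.single i 1 : Eucl d)‖)
      (aestronglyMeasurable_lineDeriv hu.continuous _)
      (Eventually.of_forall fun x => norm_lineDeriv_le_of_lipschitz ℝ hu)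
  have hint2 : ∀ i, Integrable fun x =>
      fderiv ℝ (fun y => F y i) x (EuclideanSpace.single i 1) * u x := fun i =>
    ((((hFi i).continuous_fderiv one_ne_zero).clm_apply
      continuous_const).mul hu.continuous).integrable_of_hasCompactSupport
      (((hFis i).fderiv_apply ℝ _).mul_right)
  rw [h1, integral_finsetSum _ fun i _ => hint1 i]
  simp only [divergence_eq_sum hF, Finset.sum_mul]
  rw [integral_finsetSum _ fun i _ => hint2 i, ← Finset.sum_neg_distrib]
  refine Finset.sum_congr rfl fun i _ => ?_
  obtain ⟨D, hD⟩ := hlip i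
  rw [hu.integral_lineDeriv_mul_eq hD (hFis i), ← integral_neg]
  refine integral_congr_ae (Eventually.of_forall fun x => ?_)
  have hd : DifferentiableAt ℝ (fun y => F y i) x := (hFi i).differentiable one_ne_zero x
  simp [hd.lineDeriv_eq_fderiv]

namespace InvariantFlow

variable {Ω : Set (Eucl d)} {f : Eucl d → Eucl d} {Φ : ℝ≥0 → Eucl d → Eucl d} {L : ℝ≥0}

/-- The function `φ ∘ Φ^s` is merely Lipschitz, so it is extended to a Lipschitz `u` on the whole
space and `u` is integrated by parts. Wherever `u` is differentiable, `fᵀ∇u = (fᵀ∇φ) ∘ Φ^s`: both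
are the right derivative at `r = 0` of `φ(Φ^{s+r} x)`, read through `Φ^s ∘ Φ^r` and `Φ^r ∘ Φ^s`. The
flow is never differentiated in space. -/
theorem integral_mul_fderiv_comp_eq (h : InvariantFlow Ω f Φ L) {φ : Eucl d → ℝ}
    (hφ : ContDiff ℝ 1 φ) {C : ℝ≥0} (hC : LipschitzWith C φ) {η : Eucl d → ℝ}
    (hη : IsTestFunction Ω η) (s : ℝ≥0) :
    ∫ x in Ω, η x * fderiv ℝ φ (flowMap Ω Φ s x) (f (flowMap Ω Φ s x)) =
      -∫ x in Ω, divergence (fun y => η y • f y) x * φ (flowMap Ω Φ s x) := by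
  obtain ⟨u, hu, huEq⟩ := (hC.comp_lipschitzOnWith (h.lipschitzOnWith_flow s)).extend_real
  have hη0 : ∀ x, x ∉ Ω → η x = 0 := fun x hx =>
    image_eq_zero_of_notMem_tsupport fun hx' => hx (hη.support_subset hx')
  have hd0 : ∀ x, x ∉ Ω → divergence (fun y => η y • f y) x = 0 := fun x hx =>
    divergence_smul_eq_zero f fun hx' => hx (hη.support_subset hx')
  have key : ∀ x ∈ Ω, DifferentiableAt ℝ u x →
      fderiv ℝ u x (f x) = fderiv ℝ φ (Φ s x) (f (Φ s x)) := by
    intro x hx hux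
    have hxC := subset_closure hx
    have d0 := h.sol.ode x hxC 0 le_rfl
    have hΦ0 : Φ (Real.toNNReal 0) x = x := by simp [h.sol.initial x hxC]
    rw [hΦ0] at d0
    have d1 : HasDerivWithinAt (fun r : ℝ => u (Φ r.toNNReal x)) (fderiv ℝ u x (f x))
        (Set.Ici 0) 0 := by
      have h1 : HasFDerivAt u (fderiv ℝ u x) (Φ (Real.toNNReal 0) x) := by
        rw [hΦ0]; exact hux.hasFDerivAt
      simpa [Function.comp_def] using h1.comp_hasDerivWithinAt 0 d0
    have d2 : HasDerivWithinAt (fun r : ℝ => φ (Φ r.toNNReal (Φ s x)))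
        (fderiv ℝ φ (Φ s x) (f (Φ s x))) (Set.Ici 0) 0 := by
      have hs := h.inv x hxC s
      have e0 := h.sol.ode _ hs 0 le_rfl
      have hΦs : Φ (Real.toNNReal 0) (Φ s x) = Φ s x := by simp [h.sol.initial _ hs]
      rw [hΦs] at e0
      have h1 : HasFDerivAt φ (fderiv ℝ φ (Φ s x)) (Φ (Real.toNNReal 0) (Φ s x)) := by
        rw [hΦs]; exact (hφ.differentiable one_ne_zero _).hasFDerivAt
      simpa [Function.comp_def] using h1.comp_hasDerivWithinAt 0 e0
    have heq : (fun r : ℝ => u (Φ r.toNNReal x)) = fun r : ℝ => φ (Φ r.toNNReal (Φ s x)) := by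
      funext r
      rw [← huEq (h.inv x hxC _), Function.comp_apply, ← h.flow_add hxC, ← h.flow_add hxC,
        add_comm]
    rw [heq] at d1
    exact (uniqueDiffWithinAt_Ici (0 : ℝ)).eq_deriv _ d1 d2
  have e1 : ∫ x in Ω, η x * fderiv ℝ φ (flowMap Ω Φ s x) (f (flowMap Ω Φ s x)) =
      ∫ x, fderiv ℝ u x (η x • f x) := by
    rw [← setIntegral_eq_integral_of_forall_compl_eq_zero (s := Ω)
      (f := fun x => fderiv ℝ u x (η x • f x)) (fun x hx => by simp [hη0 x hx])]
    refine setIntegral_congr_ae h.isOpen.measurableSet ?_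
    filter_upwards [hu.ae_differentiableAt (μ := volume)] with x hux hx
    rw [map_smul, key x hx hux, flowMap_of_mem hx, smul_eq_mul]
  have e2 : ∫ x in Ω, divergence (fun y => η y • f y) x * φ (flowMap Ω Φ s x) =
      ∫ x, divergence (fun y => η y • f y) x * u x := by
    rw [← setIntegral_eq_integral_of_forall_compl_eq_zero (s := Ω)
      (f := fun x => divergence (fun y => η y • f y) x * u x)
      (fun x hx => by simp [hd0 x hx])]
    refine setIntegral_congr_fun h.isOpen.measurableSet fun x hx => ?_
    simp only [flowMap_of_mem hx]
    rw [← huEq (subset_closure hx), Function.comp_apply]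
  rw [e1, e2]
  exact LipschitzWith.integral_mul_fderiv_eq hu (hη.contDiff_smul h.contDiff)
    hη.compact.smul_right

/-- For integrable `φ` the pairing of `φ ∘ Φ^t` with a test function `η` has derivative
`-∫ (φ ∘ Φ^t) div(η f)`, in integrated form. -/
theorem integral_test_mul_comp_sub_eq (h : InvariantFlow Ω f Φ L) {φ : Eucl d → ℝ}
    (hφ : IntegrableOn φ Ω) {η : Eucl d → ℝ} (hη : IsTestFunction Ω η) (t : ℝ≥0) :
    (∫ x in Ω, η x * φ (flowMap Ω Φ t x)) - (∫ x in Ω, η x * φ x) =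
      -∫ s in (0 : ℝ)..t, ∫ x in Ω, divergence (fun y => η y • f y) x *
        φ (flowMap Ω Φ s.toNNReal x) := by
  obtain ⟨M, hM⟩ := hη.exists_bound
  obtain ⟨N, hN⟩ := hη.exists_divergence_bound h.contDiff
  have hM0 : 0 ≤ M := (abs_nonneg _).trans (hM 0)
  have hN0 : 0 ≤ N := (abs_nonneg _).trans (hN 0)
  have hηm : AEStronglyMeasurable η (volume.restrict Ω) :=
    hη.contDiff_one.continuous.aestronglyMeasurable
  have hdm : AEStronglyMeasurable (divergence fun y => η y • f y) (volume.restrict Ω) :=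
    (continuous_divergence (hη.contDiff_smul h.contDiff)).aestronglyMeasurable
  obtain ⟨m, hm0, hm, hm'⟩ := exists_mollBase_bound d
  have hφi : Integrable (Ω.indicator φ) := (integrable_indicator_iff h.isOpen.measurableSet).2 hφ
  have hvol : volume Ω ≠ ∞ := h.bounded.measure_lt_top.ne
  -- The mollification error appears at the times `t` and `0` against `η`, and integrated in time
  -- against `div(ηf)`.
  set C : ℝ := 2 * M * distortion d L t + N * distortion d L t * t with hCdef
  have hC : 0 ≤ C := by positivity
  refine eq_of_forall_dist_le fun ρ hρ => ?_
  set δ := ρ / (C + 1)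
  have hδ : 0 < δ := by positivity
  obtain ⟨ε₂, hε₂, H₂⟩ := IsLocalKernel.exists_integral_le hvol hφi m 1 hm0 hδ
  obtain ⟨ε, hε, hεlt⟩ : ∃ ε, 0 < ε ∧ ε < ε₂ := exists_between hε₂
  obtain ⟨i₂, n₂⟩ := H₂ ε hε hεlt _ (isLocalKernel_mollifier hε hm)
  set w₂ : Eucl d → ℝ := fun x => (∫ y, mollifier ε (x - y) * Ω.indicator φ y) -
    1 * Ω.indicator φ x
  have hφr : Integrable (Ω.indicator φ) (volume.restrict Ω) := hφi.restrict
  have e₂ : mollify ε (Ω.indicator φ) = Ω.indicator φ + w₂ := by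
    funext x; simp [w₂, mollify]
  have hsmooth : ContDiff ℝ 1 (mollify ε (Ω.indicator φ)) := contDiff_mollify (n := 1) hε hφi
  have hsupp : HasCompactSupport (mollify ε (Ω.indicator φ)) := by
    rw [mollify_eq_convolution]
    have hind : HasCompactSupport (Ω.indicator φ) :=
      HasCompactSupport.intro h.isCompact_closure fun x hx =>
        Set.indicator_of_notMem (fun hx' => hx (subset_closure hx')) φ
    exact HasCompactSupport.convolution (ContinuousLinearMap.lsmul ℝ ℝ) hind
      (hasCompactSupport_mollifier hε)
  obtain ⟨A, hA⟩ := hsmooth.lipschitzWith_of_hasCompactSupport hsupp one_ne_zero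
  have hT := h.integral_mul_comp_sub_of_contDiff' hηm hM hsmooth (e₂ ▸ hφr.add i₂) t
  -- With the derivative moved onto `ηf`, only `L¹` convergence of the mollifications is needed, and
  -- no commutator arises.
  simp only [h.integral_mul_fderiv_comp_eq hsmooth hA hη] at hT
  rw [intervalIntegral.integral_neg] at hT
  have hcongr : ∀ u : Eucl d → ℝ, ∀ x ∈ Ω, u x = Ω.indicator u x := fun u x hx => by simp [hx]
  have hL : (∫ x in Ω, η x * mollify ε (Ω.indicator φ) (flowMap Ω Φ t x)) -
      (∫ x in Ω, η x * mollify ε (Ω.indicator φ) x) =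
      ((∫ x in Ω, η x * φ (flowMap Ω Φ t x)) - (∫ x in Ω, η x * φ x)) +
        ((∫ x in Ω, η x * w₂ (flowMap Ω Φ t x)) -
          ∫ x in Ω, η x * w₂ (flowMap Ω Φ 0 x)) := by
    have a1 := h.integral_mul_comp_add t hηm hM hφr i₂
    have a2 := h.integral_mul_comp_add 0 hηm hM hφr i₂
    rw [← e₂, ← h.integral_mul_comp_congr t η (hcongr φ)] at a1
    rw [← e₂, ← h.integral_mul_comp_congr 0 η (hcongr φ)] at a2
    simp only [h.flowMap_zero] at a2 ⊢
    rw [a1, a2]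
    ring
  have hR : ∫ s in (0 : ℝ)..t, ∫ x in Ω, divergence (fun y => η y • f y) x *
        mollify ε (Ω.indicator φ) (flowMap Ω Φ s.toNNReal x) =
      (∫ s in (0 : ℝ)..t, ∫ x in Ω, divergence (fun y => η y • f y) x *
        φ (flowMap Ω Φ s.toNNReal x)) +
      ∫ s in (0 : ℝ)..t, ∫ x in Ω, divergence (fun y => η y • f y) x *
        w₂ (flowMap Ω Φ s.toNNReal x) := by
    have c₁ := (h.continuous_integral_mul_comp_real hdm hN hφ).intervalIntegrable
      (μ := volume) 0 t
    have c₂ := (h.continuous_integral_mul_comp_real hdm hN i₂).intervalIntegrable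
      (μ := volume) 0 t
    rw [← intervalIntegral.integral_add c₁ c₂]
    refine intervalIntegral.integral_congr fun s hs => ?_
    have a3 := h.integral_mul_comp_add s.toNNReal hdm hN hφr i₂
    rw [← h.integral_mul_comp_congr s.toNNReal _ (hcongr φ), ← e₂] at a3
    exact a3
  rw [hL, hR] at hT
  have b1 := h.abs_integral_mul_comp_le (le_refl t) hM i₂
  have b2 := h.abs_integral_mul_comp_le (zero_le : 0 ≤ t) hM i₂
  have b3 := h.abs_intervalIntegral_le hN i₂ t
  have k1 : M * (distortion d L t * ∫ x in Ω, ‖w₂ x‖) ≤ M * (distortion d L t * δ) := by gcongr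
  have k3 : N * (distortion d L t * ∫ x in Ω, ‖w₂ x‖) * t ≤ N * (distortion d L t * δ) * t := by
    gcongr
  rw [Real.dist_eq]
  have hfin : C * δ ≤ ρ := by
    rw [mul_div_assoc', div_le_iff₀ (by positivity)]
    nlinarith
  have hexp : C * δ = 2 * (M * (distortion d L t * δ)) + N * (distortion d L t * δ) * t := by
    rw [hCdef]; ring
  rw [abs_le] at b1 b2 b3 ⊢
  constructor <;> linarith [b1.1, b1.2, b2.1, b2.2, b3.1, b3.2]

end InvariantFlow

end Koopman

namespace Koopman

variable {d : ℕ}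

/-! ### Weak gradients and weak derivatives along a vector field -/

/-- The pointwise kernel estimate with `θ = u` leaves only the modulus of continuity. -/
theorem exists_abs_mollify_sub_le {u : Eucl d → ℝ} (hu : Continuous u) (hus : HasCompactSupport u)
    {δ : ℝ} (hδ : 0 < δ) :
    ∃ ε₀ > 0, ∀ ε, 0 < ε → ε < ε₀ → ∀ x, |mollify ε u x - u x| ≤ δ := by
  obtain ⟨m, hm0, hm, -⟩ := exists_mollBase_bound d
  set C : ℝ≥0∞ := ENNReal.ofReal m * volume (Metric.ball (0 : Eucl d) 1) with hC
  have hCtop : C ≠ ∞ := ENNReal.mul_ne_top ENNReal.ofReal_ne_top measure_ball_lt_top.ne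
  have hC' : 0 ≤ C.toReal := ENNReal.toReal_nonneg
  have hδ' : 0 < δ / (C.toReal + 1) := by positivity
  obtain ⟨ε₀, hε₀, huc⟩ := Metric.uniformContinuous_iff.1
    (hus.uniformContinuous_of_continuous hu) _ hδ'
  refine ⟨ε₀, hε₀, fun ε hε hεε₀ x => ?_⟩
  have h := (isLocalKernel_mollifier hε hm).enorm_integral_sub_le hε hm0
    (hu.integrable_of_hasCompactSupport hus) hu
    (fun x y hxy => (huc (hxy.trans hεε₀)).le) x
  simp only [sub_self, enorm_zero, mul_zero, lintegral_zero, zero_add, add_zero, one_mul] at h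
  rw [← hC] at h
  have h2 : ‖mollify ε u x - u x‖ₑ ≤ ENNReal.ofReal δ := by
    refine h.trans ?_
    have hmul : C * ENNReal.ofReal (δ / (C.toReal + 1)) =
        ENNReal.ofReal (C.toReal * (δ / (C.toReal + 1))) := by
      rw [ENNReal.ofReal_mul hC', ENNReal.ofReal_toReal hCtop]
    rw [hmul]
    refine ENNReal.ofReal_le_ofReal ?_
    rw [mul_div_assoc', div_le_iff₀ (by positivity)]
    nlinarith
  rw [Real.enorm_eq_ofReal_abs] at h2
  exact (ENNReal.ofReal_le_ofReal_iff hδ.le).1 h2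

/-- Up to sign, the difference of the two sides is the integral of a derivative in `y` of `mollifier
ε (x - y) * ζ y`, which vanishes. -/
theorem fderiv_mollify_of_contDiff {ε : ℝ} (hε : 0 < ε) {ζ : Eucl d → ℝ} (hζ : ContDiff ℝ 1 ζ)
    (hζs : HasCompactSupport ζ) (x v : Eucl d) :
    fderiv ℝ (mollify ε ζ) x v = mollify ε (fun y => fderiv ℝ ζ y v) x := by
  rw [fderiv_mollify hε (hζ.continuous.integrable_of_hasCompactSupport hζs), mollify, ← sub_eq_zero]
  have hc := contDiff_mollifier (d := d) (n := 1) ε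
  have i1 : Integrable fun y => fderiv ℝ (mollifier ε) (x - y) v * ζ y :=
    ((((hc.continuous_fderiv one_ne_zero).clm_apply continuous_const).comp
      (continuous_const.sub continuous_id)).mul hζ.continuous).integrable_of_hasCompactSupport
      hζs.mul_left
  have i2 : Integrable fun y => mollifier ε (x - y) * fderiv ℝ ζ y v :=
    ((hc.continuous.comp (continuous_const.sub continuous_id)).mul
      ((hζ.continuous_fderiv one_ne_zero).clm_apply
        continuous_const)).integrable_of_hasCompactSupport (hζs.fderiv_apply ℝ v).mul_left
  have h0 := integral_fderiv_eq_zero (g := fun y => mollifier ε (x - y) * ζ y)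
    ((hc.comp (contDiff_const.sub contDiff_id)).mul hζ) hζs.mul_left v
  rw [← integral_sub i1 i2, ← neg_eq_zero, ← integral_neg, ← h0]
  refine integral_congr_ae (Eventually.of_forall fun y => ?_)
  simp only
  rw [((hasFDerivAt_mollifier_sub ε x y).fun_mul
    (hζ.differentiable one_ne_zero y).hasFDerivAt).fderiv]
  simp
  ring

theorem mollify_eq_zero {ε : ℝ} (hε : 0 < ε) {u : Eucl d → ℝ} {x : Eucl d}
    (hx : x ∉ Metric.cthickening ε (tsupport u)) : mollify ε u x = 0 := by
  rw [mollify]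
  refine integral_eq_zero_of_ae (Eventually.of_forall fun y => ?_)
  by_cases hy : y ∈ tsupport u
  · have : mollifier ε (x - y) = 0 := by
      refine mollifier_eq_zero hε ?_
      rw [← dist_eq_norm]
      by_contra! hlt
      exact hx (Metric.mem_cthickening_of_dist_le x y ε _ hy hlt.le)
    simp [this]
  · simp [image_eq_zero_of_notMem_tsupport hy]

theorem isTestFunction_mollify {Ω : Set (Eucl d)} {ε : ℝ} (hε : 0 < ε) {ζ : Eucl d → ℝ}
    (hζ : Continuous ζ) (hζs : HasCompactSupport ζ)
    (hsub : Metric.cthickening ε (tsupport ζ) ⊆ Ω) : IsTestFunction Ω (mollify ε ζ) where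
  smooth := contDiff_mollify (n := ⊤) hε (hζ.integrable_of_hasCompactSupport hζs)
  compact := HasCompactSupport.intro hζs.isCompact.cthickening fun x hx => mollify_eq_zero hε hx
  support_subset := by
    refine (closure_minimal (fun y hy => ?_) Metric.isClosed_cthickening).trans hsub
    by_contra h
    exact hy (mollify_eq_zero hε h)

theorem integrableOn_mul_of_hasCompactSupport {Ω : Set (Eucl d)} {u ζ : Eucl d → ℝ}
    (hu : LocallyIntegrableOn u Ω) (hζ : Continuous ζ) (hζs : HasCompactSupport ζ)
    (hsub : tsupport ζ ⊆ Ω) : IntegrableOn (fun x => u x * ζ x) Ω := by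
  have h1 := (hu.integrableOn_compact_subset hsub hζs.isCompact).mul_continuousOn
    hζ.continuousOn hζs.isCompact
  have h2 : IntegrableOn (fun x => u x * ζ x) Set.univ :=
    (integrableOn_iff_integrable_of_support_subset (fun x hx =>
      subset_tsupport ζ (fun h => hx (by simp [h])))).1 h1 |>.integrableOn
  exact h2.mono_set (Set.subset_univ _)

theorem LocallyIntegrableOn.coord {Ω : Set (Eucl d)} {g : Eucl d → Eucl d}
    (hg : LocallyIntegrableOn g Ω) (i : Fin d) : LocallyIntegrableOn (fun x => g x i) Ω :=
  fun x hx => by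
    obtain ⟨s, hs, hsi⟩ := hg x hx
    exact ⟨s, hs, (EuclideanSpace.proj (𝕜 := ℝ) i).integrable_comp hsi⟩

/-- A weak gradient may be tested with `C¹` functions of compact support. -/
theorem HasWeakGradient.integral_eq_of_contDiff {Ω : Set (Eucl d)} (hΩ : IsOpen Ω)
    {u : Eucl d → ℝ} {g : Eucl d → Eucl d} (h : HasWeakGradient Ω u g) {ζ : Eucl d → ℝ}
    (hζ : ContDiff ℝ 1 ζ) (hζs : HasCompactSupport ζ) (hsub : tsupport ζ ⊆ Ω) (i : Fin d) :
    ∫ x in Ω, u x * fderiv ℝ ζ x (EuclideanSpace.single i 1) = -∫ x in Ω, g x i * ζ x := by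
  set e : Eucl d := EuclideanSpace.single i 1
  have hgi := LocallyIntegrableOn.coord h.locInt_grad i
  have hζ' : Continuous fun x => fderiv ℝ ζ x e :=
    (hζ.continuous_fderiv one_ne_zero).clm_apply continuous_const
  -- Mollifications of `ζ` and their derivatives converge uniformly with supports in the fixed
  -- compact `K ⊆ Ω`, on which `u` and `g` are integrable.
  obtain ⟨ε₁, hε₁, hthick⟩ := hζs.isCompact.exists_cthickening_subset_open hΩ hsub
  set K := Metric.cthickening ε₁ (tsupport ζ)
  have hK : IsCompact K := hζs.isCompact.cthickening
  have huK := h.locInt.integrableOn_compact_subset hthick hK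
  have hgK := hgi.integrableOn_compact_subset hthick hK
  set C := (∫ x in K, ‖u x‖) + ∫ x in K, ‖g x i‖
  have hC : 0 ≤ C := add_nonneg (integral_nonneg fun _ => norm_nonneg _)
    (integral_nonneg fun _ => norm_nonneg _)
  refine eq_of_forall_dist_le fun ρ hρ => ?_
  have hδ : 0 < ρ / (C + 1) := by positivity
  obtain ⟨ε₂, hε₂, H₂⟩ := exists_abs_mollify_sub_le hζ.continuous hζs hδ
  obtain ⟨ε₃, hε₃, H₃⟩ := exists_abs_mollify_sub_le hζ' (hζs.fderiv_apply ℝ e) hδ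
  obtain ⟨ε, hε, hεlt⟩ : ∃ ε, 0 < ε ∧ ε < min ε₁ (min ε₂ ε₃) :=
    exists_between (by simp [hε₁, hε₂, hε₃])
  simp only [lt_min_iff] at hεlt
  have hsubε : Metric.cthickening ε (tsupport ζ) ⊆ K := Metric.cthickening_mono hεlt.1.le _
  have htest := isTestFunction_mollify hε hζ.continuous hζs (hsubε.trans hthick)
  have hw := h.integral_eq _ htest i
  have htsK : tsupport ζ ⊆ K := Metric.self_subset_cthickening _
  have z1 : ∀ x, x ∉ K → mollify ε ζ x - ζ x = 0 := fun x hx => by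
    rw [mollify_eq_zero hε fun h => hx (hsubε h),
      image_eq_zero_of_notMem_tsupport fun h => hx (htsK h), sub_zero]
  have z2 : ∀ x, x ∉ K → fderiv ℝ (mollify ε ζ) x e - fderiv ℝ ζ x e = 0 := fun x hx => by
    rw [fderiv_mollify_of_contDiff hε hζ hζs, mollify_eq_zero hε fun h => hx (hsubε
        (Metric.cthickening_subset_of_subset ε (tsupport_fderiv_apply_subset ℝ e) h)),
      image_eq_zero_of_notMem_tsupport fun h => hx (htsK (tsupport_fderiv_apply_subset ℝ e h)),
      sub_zero]
  have htest' : Continuous fun x => fderiv ℝ (mollify ε ζ) x e :=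
    (htest.contDiff_one.continuous_fderiv one_ne_zero).clm_apply continuous_const
  have j1 := integrableOn_mul_of_hasCompactSupport h.locInt htest' (htest.compact.fderiv_apply ℝ e)
    ((tsupport_fderiv_apply_subset ℝ e).trans htest.support_subset)
  have j2 := integrableOn_mul_of_hasCompactSupport h.locInt hζ' (hζs.fderiv_apply ℝ e)
    ((tsupport_fderiv_apply_subset ℝ e).trans hsub)
  have j3 := integrableOn_mul_of_hasCompactSupport hgi htest.contDiff_one.continuous htest.compact
    htest.support_subset
  have j4 := integrableOn_mul_of_hasCompactSupport hgi hζ.continuous hζs hsub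
  have bound : ∀ (a b b' : Eucl d → ℝ), IntegrableOn a K → (∀ x, x ∉ K → b' x - b x = 0) →
      (∀ x, |b' x - b x| ≤ ρ / (C + 1)) → IntegrableOn (fun x => a x * b' x) Ω →
      IntegrableOn (fun x => a x * b x) Ω →
      |(∫ x in Ω, a x * b' x) - ∫ x in Ω, a x * b x| ≤ (∫ x in K, ‖a x‖) * (ρ / (C + 1)) := by
    intro a b b' ha hz hb i1 i2
    rw [← integral_sub i1 i2, setIntegral_eq_of_subset_of_forall_sdiff_eq_zero hΩ.measurableSet hthick
      (fun x hx => by rw [← mul_sub, hz x hx.2, mul_zero]), ← integral_mul_const, ← Real.norm_eq_abs]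
    refine norm_integral_le_of_norm_le (ha.norm.mul_const _) (Eventually.of_forall fun x => ?_)
    rw [← mul_sub, norm_mul]
    gcongr
    exact hb x
  have b1 := bound u _ _ huK z2 (fun x => by
    rw [fderiv_mollify_of_contDiff hε hζ hζs]; exact H₃ ε hε hεlt.2.2 x) j1 j2
  have b2 := bound (fun x => g x i) _ _ hgK z1 (H₂ ε hε hεlt.2.1) j3 j4
  have hfin : C * (ρ / (C + 1)) ≤ ρ := by
    rw [mul_div_assoc', div_le_iff₀ (by positivity)]
    nlinarith
  have hexp : C * (ρ / (C + 1)) = (∫ x in K, ‖u x‖) * (ρ / (C + 1)) +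
    (∫ x in K, ‖g x i‖) * (ρ / (C + 1)) := add_mul _ _ _
  rw [Real.dist_eq]
  rw [abs_le] at b1 b2 ⊢
  constructor <;> linarith [b1.1, b1.2, b2.1, b2.2]

theorem inner_eq_sum (a b : Eucl d) : inner ℝ a b = ∑ i, a i * b i := by
  simp [PiLp.inner_apply, mul_comm]

/-- If `u` has weak gradient `g`, then `fᵀ∇u = fᵀ g` weakly. -/
theorem HasWeakGradient.hasWeakDerivAlong {Ω : Set (Eucl d)} (hΩ : IsOpen Ω)
    {u : Eucl d → ℝ} {g : Eucl d → Eucl d} (h : HasWeakGradient Ω u g)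
    {f : Eucl d → Eucl d} (hf : ContDiff ℝ 1 f) :
    HasWeakDerivAlong Ω f u fun x => inner ℝ (f x) (g x) where
  locInt := h.locInt
  locInt_deriv := by
    simp only [inner_eq_sum]
    intro x hx
    have : ∀ i ∈ Finset.univ, IntegrableAtFilter (fun x => f x i * g x i) (𝓝[Ω] x) volume :=
      fun i _ => (LocallyIntegrableOn.coord h.locInt_grad i).continuousOn_mul
        (contDiff_coord hf i).continuous.continuousOn hΩ.isLocallyClosed x hx
    choose! s hs hsi using this
    refine ⟨⋂ i, s i, ?_, ?_⟩
    · rw [iInter_mem]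
      exact fun i => hs i (Finset.mem_univ i)
    · exact integrable_finsetSum _ fun i hi =>
        (hsi i hi).mono_set (Set.iInter_subset _ i)
  integral_eq η hη := by
    have hF : ContDiff ℝ 1 fun y => η y • f y := hη.contDiff_smul hf
    have hFi : ∀ i, ContDiff ℝ 1 fun y => (η y • f y) i := fun i => contDiff_coord hF i
    have hts : ∀ i, tsupport (fun y => (η y • f y) i) ⊆ tsupport η := fun i =>
      closure_mono fun y hy => by
        contrapose! hy
        simp only [Function.mem_support, not_not] at hy ⊢
        simp [hy]
    have hcs : ∀ i, HasCompactSupport fun y => (η y • f y) i := fun i =>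
      hη.compact.of_isClosed_subset (isClosed_tsupport _) (hts i)
    have hsub : ∀ i, tsupport (fun y => (η y • f y) i) ⊆ Ω := fun i =>
      (hts i).trans hη.support_subset
    simp only [divergence_eq_sum hF, inner_eq_sum, Finset.mul_sum, Finset.sum_mul]
    rw [integral_finsetSum, integral_finsetSum, ← Finset.sum_neg_distrib]
    · refine Finset.sum_congr rfl fun i _ => ?_
      rw [h.integral_eq_of_contDiff hΩ (hFi i) (hcs i) (hsub i)]
      congr 1
      refine integral_congr_ae (Eventually.of_forall fun x => ?_)
      simp only [PiLp.smul_apply, smul_eq_mul]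
      ring
    · intro i _
      have := integrableOn_mul_of_hasCompactSupport (LocallyIntegrableOn.coord h.locInt_grad i)
        (hFi i).continuous (hcs i) (hsub i)
      refine this.congr (Eventually.of_forall fun x => ?_)
      simp only [PiLp.smul_apply, smul_eq_mul]
      ring
    · intro i _
      exact integrableOn_mul_of_hasCompactSupport h.locInt
        (((hFi i).continuous_fderiv one_ne_zero).clm_apply continuous_const)
        ((hcs i).fderiv_apply ℝ _) ((tsupport_fderiv_apply_subset ℝ _).trans (hsub i))

theorem ae_eq_of_forall_integral_test_eq {Ω : Set (Eucl d)} (hΩ : IsOpen Ω)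
    {ψ₁ ψ₂ : Eucl d → ℝ} (h₁ : LocallyIntegrableOn ψ₁ Ω) (h₂ : LocallyIntegrableOn ψ₂ Ω)
    (h : ∀ η, IsTestFunction Ω η → ∫ x in Ω, ψ₁ x * η x = ∫ x in Ω, ψ₂ x * η x) :
    ψ₁ =ᵐ[volume.restrict Ω] ψ₂ := by
  have key := hΩ.ae_eq_zero_of_integral_contDiff_smul_eq_zero (h₁.sub h₂) fun η hη hηs hsub => by
    have ht : IsTestFunction Ω η := ⟨hη, hηs, hsub⟩
    rw [← setIntegral_eq_integral_of_forall_compl_eq_zero (s := Ω) fun x hx => by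
      rw [image_eq_zero_of_notMem_tsupport fun hx' => hx (hsub hx'), zero_smul]]
    have i1 := integrableOn_mul_of_hasCompactSupport h₁ ht.contDiff_one.continuous hηs hsub
    have i2 := integrableOn_mul_of_hasCompactSupport h₂ ht.contDiff_one.continuous hηs hsub
    rw [← sub_eq_zero.2 (h η ht), ← integral_sub i1 i2]
    refine integral_congr_ae (Eventually.of_forall fun x => ?_)
    simp only [Pi.sub_apply, smul_eq_mul]
    ring
  filter_upwards [ae_restrict_of_ae key, ae_restrict_mem hΩ.measurableSet] with x hx hxΩ
  exact sub_eq_zero.1 (hx hxΩ)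

theorem HasWeakDerivAlong.ae_unique {Ω : Set (Eucl d)} (hΩ : IsOpen Ω) {f : Eucl d → Eucl d}
    {φ ψ₁ ψ₂ : Eucl d → ℝ} (h₁ : HasWeakDerivAlong Ω f φ ψ₁) (h₂ : HasWeakDerivAlong Ω f φ ψ₂) :
    ψ₁ =ᵐ[volume.restrict Ω] ψ₂ :=
  ae_eq_of_forall_integral_test_eq hΩ h₁.locInt_deriv h₂.locInt_deriv fun η hη =>
    neg_injective ((h₁.integral_eq η hη).symm.trans (h₂.integral_eq η hη))

theorem HasWeakGradient.ae_unique {Ω : Set (Eucl d)} (hΩ : IsOpen Ω) {u : Eucl d → ℝ}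
    {g₁ g₂ : Eucl d → Eucl d} (h₁ : HasWeakGradient Ω u g₁) (h₂ : HasWeakGradient Ω u g₂) :
    g₁ =ᵐ[volume.restrict Ω] g₂ := by
  have key : ∀ i, ∀ᵐ x ∂volume.restrict Ω, g₁ x i = g₂ x i := fun i =>
    ae_eq_of_forall_integral_test_eq hΩ (LocallyIntegrableOn.coord h₁.locInt_grad i)
      (LocallyIntegrableOn.coord h₂.locInt_grad i) fun η hη =>
      neg_injective ((h₁.integral_eq η hη i).symm.trans (h₂.integral_eq η hη i))
  filter_upwards [ae_all_iff.2 key] with x hx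
  ext i
  exact hx i

/-- Since `Ω` is open, `div(ηf)` on `Ω` depends only on `f` there. This allows passing to the
compactly supported field and back. -/
theorem HasWeakDerivAlong.congr_field {Ω : Set (Eucl d)} (hΩ : IsOpen Ω) {f g : Eucl d → Eucl d}
    (hfg : ∀ x ∈ Ω, f x = g x) {φ ψ : Eucl d → ℝ} (h : HasWeakDerivAlong Ω f φ ψ) :
    HasWeakDerivAlong Ω g φ ψ where
  locInt := h.locInt
  locInt_deriv := h.locInt_deriv
  integral_eq η hη := by
    rw [← h.integral_eq η hη]
    refine setIntegral_congr_fun hΩ.measurableSet fun x hx => ?_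
    have : (fun y => η y • g y) =ᶠ[𝓝 x] fun y => η y • f y := by
      filter_upwards [hΩ.mem_nhds hx] with y hy
      rw [hfg y hy]
    unfold divergence
    rw [this.fderiv_eq]

end Koopman

/-! ### Exponential growth of weak subsolutions along the flow. -/

namespace Koopman

variable {d : ℕ}

/-- Grönwall's inequality in integrated form. -/
theorem le_mul_exp_of_integral_le {H P : ℝ → ℝ} {ω t : ℝ} (hP : Continuous P) (ht : 0 ≤ t)
    (hH : ∀ s, 0 ≤ s → H s - H 0 = ∫ r in (0 : ℝ)..s, P r) (hle : ∀ s, 0 ≤ s → P s ≤ ω * H s) :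
    H t ≤ H 0 * Real.exp (ω * t) := by
  -- `G` agrees with `H` for `s ≥ 0` and is differentiable on all of `ℝ`, while nothing is assumed
  -- of `H` at negative times.
  set G : ℝ → ℝ := fun s => H 0 + ∫ r in (0 : ℝ)..s, P r
  have hG : ∀ s, HasDerivAt G (P s) s := fun s =>
    (intervalIntegral.integral_hasDerivAt_right (hP.intervalIntegrable _ _)
      hP.aestronglyMeasurable.stronglyMeasurableAtFilter hP.continuousAt).const_add _
  have hGH : ∀ s, 0 ≤ s → G s = H s := fun s hs => by
    simp only [G, ← hH s hs]; ring
  have := le_gronwallBound_of_liminf_deriv_right_le (f := G) (f' := P) (δ := H 0) (K := ω)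
    (ε := 0) (a := 0) (b := t) (fun s _ => (hG s).continuousAt.continuousWithinAt)
    (fun s _ r hr => by
      have := (hG s).hasDerivWithinAt.liminf_right_slope_le hr
      simpa [slope, smul_eq_mul] using this)
    (by simp [G])
    (fun s hs => by rw [hGH s hs.1, add_zero]; exact hle s hs.1) t ⟨ht, le_rfl⟩
  rwa [hGH t ht, gronwallBound_ε0, sub_zero] at this

namespace InvariantFlow

variable {Ω : Set (Eucl d)} {f : Eucl d → Eucl d} {Φ : ℝ≥0 → Eucl d → Eucl d} {L : ℝ≥0}

/-- Since `v` is defined only almost everywhere, Grönwall is applied not on single trajectories but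
to `s ↦ ∫_A v ∘ Φ^s`, whose derivative is `∫_A ψ ∘ Φ^s`. The compact `K` between `A` and `Ω` makes
the transport identity applicable. -/
theorem setIntegral_comp_le (h : InvariantFlow Ω f Φ L) {v ψ : Eucl d → ℝ}
    (hv : IntegrableOn v Ω) (hψ : IntegrableOn ψ Ω) (hw : HasWeakDerivAlong Ω f v ψ) {ω : ℝ}
    (hle : ∀ᵐ x ∂volume.restrict Ω, ψ x ≤ ω * v x)
    {A K : Set (Eucl d)} (hA : MeasurableSet A) (hAK : A ⊆ K) (hK : IsCompact K) (hKΩ : K ⊆ Ω)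
    (t : ℝ≥0) :
    ∫ x in A, v (flowMap Ω Φ t x) ≤ Real.exp (ω * t) * ∫ x in A, v x := by
  set b : Eucl d → ℝ := A.indicator fun _ => 1
  have hbm : AEStronglyMeasurable b (volume.restrict Ω) :=
    (stronglyMeasurable_const.indicator hA).aestronglyMeasurable
  have hb : ∀ x, |b x| ≤ 1 := fun x => by
    by_cases hx : x ∈ A <;> simp [b, hx]
  have hb0 : ∀ x, 0 ≤ b x := fun x => by
    by_cases hx : x ∈ A <;> simp [b, hx]
  have hbK : ∀ x, x ∉ K → b x = 0 := fun x hx => Set.indicator_of_notMem (fun h => hx (hAK h)) _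
  have hset : ∀ u : Eucl d → ℝ, ∫ x in Ω, b x * u x = ∫ x in A, u x := fun u => by
    have : (fun x => b x * u x) = A.indicator u := by
      funext x; by_cases hx : x ∈ A <;> simp [b, hx]
    rw [this, setIntegral_indicator hA, Set.inter_eq_right.2 (hAK.trans hKΩ)]
  have key := le_mul_exp_of_integral_le (ω := ω) (t := t)
    (H := fun s : ℝ => ∫ x in Ω, b x * v (flowMap Ω Φ s.toNNReal x))
    (P := fun s : ℝ => ∫ x in Ω, b x * ψ (flowMap Ω Φ s.toNNReal x))
    (h.continuous_integral_mul_comp_real hbm hb hψ) t.coe_nonneg ?_ ?_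
  · rw [← hset, ← hset, mul_comm (Real.exp _)]
    simpa [h.flowMap_zero] using key
  · intro s hs
    have := h.integral_mul_comp_sub_eq hv hψ hw hbm hb hK hKΩ hbK s.toNNReal
    rw [Real.coe_toNNReal s hs] at this
    simpa [h.flowMap_zero] using this
  · intro s hs
    rw [← integral_const_mul]
    refine integral_mono_ae (h.integrable_mul_comp _ hbm hb hψ)
      ((h.integrable_mul_comp _ hbm hb hv).const_mul ω) ?_
    filter_upwards [(h.quasiMeasurePreserving s.toNNReal).ae hle] with x hx
    have := mul_le_mul_of_nonneg_left hx (hb0 x)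
    linarith

/-- Exponential growth bound along the flow, from a weak differential inequality. -/
theorem comp_flowMap_le (h : InvariantFlow Ω f Φ L) {v ψ : Eucl d → ℝ}
    (hv : IntegrableOn v Ω) (hψ : IntegrableOn ψ Ω) (hw : HasWeakDerivAlong Ω f v ψ) {ω : ℝ}
    (hle : ∀ᵐ x ∂volume.restrict Ω, ψ x ≤ ω * v x) (t : ℝ≥0) :
    ∀ᵐ x ∂volume.restrict Ω, v (flowMap Ω Φ t x) ≤ Real.exp (ω * t) * v x := by
  -- On each compact piece the integrated inequality holds over all measurable subsets, hence the
  -- pointwise one almost everywhere; countably many pieces exhaust `Ω`.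
  obtain ⟨F, hFc, hFΩ, hFU, -⟩ := h.isOpen.exists_iUnion_isClosed
  have hvt := h.integrable_comp t hv
  have key : ∀ n, ∀ᵐ x ∂volume.restrict (F n), v (flowMap Ω Φ t x) ≤ Real.exp (ω * t) * v x := by
    intro n
    have hres : (volume.restrict Ω).restrict (F n) = volume.restrict (F n) := by
      rw [Measure.restrict_restrict (hFc n).measurableSet, Set.inter_eq_left.2 (hFΩ n)]
    have hKn : IsCompact (F n) :=
      Metric.isCompact_of_isClosed_isBounded (hFc n) (h.bounded.subset (hFΩ n))
    have hvn : IntegrableOn v (F n) := hv.mono_set (hFΩ n)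
    refine ae_le_of_forall_setIntegral_le (hres ▸ hvt.restrict) (hvn.const_mul _) fun s hs _ => ?_
    rw [Measure.restrict_restrict hs, integral_const_mul]
    exact h.setIntegral_comp_le hv hψ hw hle (hs.inter (hFc n).measurableSet)
      Set.inter_subset_right hKn (hFΩ n) t
  rw [← hFU, ae_restrict_iUnion_iff]
  simpa [hFU] using key

end InvariantFlow

/-! ### Weights growing at most exponentially along the flow -/

/-- The reciprocal of `w` is bounded and grows at most exponentially along the flow. -/
structure FlowWeight (Ω : Set (Eucl d)) (Φ : ℝ≥0 → Eucl d → Eucl d) (w : Eucl d → ℝ) (ω : ℝ) :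
    Prop where
  nonneg : 0 ≤ ω
  pos : ∀ᵐ x ∂volume.restrict Ω, 0 < w x
  inv_memLp : MemLp (fun x => (w x)⁻¹) ∞ (volume.restrict Ω)
  growth : ∀ t : ℝ≥0, ∀ᵐ x ∂volume.restrict Ω,
    (w (flowMap Ω Φ t x))⁻¹ ≤ Real.exp (ω * t) * (w x)⁻¹

namespace FlowWeight

variable {Ω : Set (Eucl d)} {f : Eucl d → Eucl d} {Φ : ℝ≥0 → Eucl d → Eucl d} {L : ℝ≥0}
  {w : Eucl d → ℝ} {ω : ℝ} {p q : ℝ≥0∞}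

theorem aestronglyMeasurable (W : FlowWeight Ω Φ w ω) :
    AEStronglyMeasurable w (volume.restrict Ω) := by
  have := W.inv_memLp.1.aemeasurable.inv
  exact (this.congr (Eventually.of_forall fun x => by simp)).aestronglyMeasurable

/-- Elements of a weighted space belong to the unweighted one. -/
theorem memLp (W : FlowWeight Ω Φ w ω) {u : Eucl d → ℝ}
    (hu : MemLp (fun x => u x * w x) p (volume.restrict Ω)) : MemLp u p (volume.restrict Ω) := by
  refine (memLp_congr_ae ?_).1 (hu.mul W.inv_memLp)
  filter_upwards [W.pos] with x hx
  simp only [Pi.mul_apply]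
  field_simp

theorem integrableOn (W : FlowWeight Ω Φ w ω) (h : InvariantFlow Ω f Φ L) [hp : Fact (1 ≤ p)]
    {u : Eucl d → ℝ} (hu : MemLp (fun x => u x * w x) p (volume.restrict Ω)) :
    IntegrableOn u Ω := by
  have := h.isFiniteMeasure
  exact (W.memLp hu).integrable hp.out

/-- The growth bound reads `w ≤ e^{ωt} w ∘ Φ^t`, so the weight can be moved inside the composition,
and the unweighted estimate applies to `u w`. -/
theorem eLpNorm_comp_mul_le (W : FlowWeight Ω Φ w ω) (h : InvariantFlow Ω f Φ L) (t : ℝ≥0)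
    {u : Eucl d → ℝ} (hu : AEStronglyMeasurable (fun x => u x * w x) (volume.restrict Ω)) :
    eLpNorm (fun x => u (flowMap Ω Φ t x) * w x) p (volume.restrict Ω) ≤
      ENNReal.ofReal (Real.exp (ω * t)) * ((distortion d L t : ℝ≥0∞) ^ p.toReal⁻¹ *
        eLpNorm (fun x => u x * w x) p (volume.restrict Ω)) := by
  refine (eLpNorm_le_mul_eLpNorm_of_ae_le_mul (c := Real.exp (ω * t))
    (g := fun x => u (flowMap Ω Φ t x) * w (flowMap Ω Φ t x)) ?_ p).trans
    (mul_le_mul_right (h.eLpNorm_comp_le t p hu) _)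
  filter_upwards [W.pos, (h.quasiMeasurePreserving t).ae W.pos, W.growth t] with x h1 h2 h3
  rw [norm_mul, norm_mul, Real.norm_of_nonneg h1.le, Real.norm_of_nonneg h2.le]
  have : w x ≤ Real.exp (ω * t) * w (flowMap Ω Φ t x) := by
    rw [← div_eq_mul_inv, inv_eq_one_div, div_le_div_iff₀ h2 h1] at h3
    linarith
  calc ‖u (flowMap Ω Φ t x)‖ * w x
      ≤ ‖u (flowMap Ω Φ t x)‖ * (Real.exp (ω * t) * w (flowMap Ω Φ t x)) := by gcongr
    _ = _ := by ring

theorem memLp_comp_mul (W : FlowWeight Ω Φ w ω) (h : InvariantFlow Ω f Φ L) (t : ℝ≥0)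
    {u : Eucl d → ℝ} (hu : MemLp (fun x => u x * w x) p (volume.restrict Ω)) :
    MemLp (fun x => u (flowMap Ω Φ t x) * w x) p (volume.restrict Ω) :=
  ⟨((W.memLp hu).1.comp_quasiMeasurePreserving (h.quasiMeasurePreserving t)).mul
      W.aestronglyMeasurable,
    (W.eLpNorm_comp_mul_le h t hu.1).trans_lt (ENNReal.mul_lt_top ENNReal.ofReal_lt_top
      (ENNReal.mul_lt_top (ENNReal.rpow_lt_top_of_nonneg (by positivity) ENNReal.coe_ne_top) hu.2))⟩

end FlowWeight

/-! ### The Koopman operators on the weighted spaces. -/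

/-- Bound for the operator norm of the composition with the flow at time `t`. -/
def opBound (d : ℕ) (L : ℝ≥0) (ω : ℝ) (p : ℝ≥0∞) (t : ℝ≥0) : ℝ :=
  Real.exp (ω * t) * (distortion d L t : ℝ) ^ p.toReal⁻¹

theorem opBound_nonneg (L : ℝ≥0) (ω : ℝ) (p : ℝ≥0∞) (t : ℝ≥0) : 0 ≤ opBound d L ω p t := by
  unfold opBound; positivity

theorem opBound_mono (L : ℝ≥0) {ω : ℝ} (hω : 0 ≤ ω) (p : ℝ≥0∞) : Monotone (opBound d L ω p) := by
  intro s t hst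
  have h1 : (s : ℝ) ≤ t := hst
  have h2 : (distortion d L s : ℝ) ≤ distortion d L t := distortion_mono L hst
  unfold opBound
  gcongr

variable {Ω : Set (Eucl d)} {f : Eucl d → Eucl d} {Φ : ℝ≥0 → Eucl d → Eucl d} {L : ℝ≥0}
  {w : Eucl d → ℝ} {ω : ℝ} {p q : ℝ≥0∞}

/-- Composition with the flow, as a linear map of the weighted space. -/
def koopmanLinear (h : InvariantFlow Ω f Φ L) (W : FlowWeight Ω Φ w ω) (p : ℝ≥0∞) (t : ℝ≥0) :
    weightedLp Ω w p →ₗ[ℝ] weightedLp Ω w p where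
  toFun φ := ⟨φ.1.compQuasiMeasurePreserving (flowMap Ω Φ t) (h.quasiMeasurePreserving t), by
    refine (memLp_congr_ae ?_).2 (W.memLp_comp_mul h t φ.2)
    filter_upwards [AEEqFun.coeFn_compQuasiMeasurePreserving φ.1 (h.quasiMeasurePreserving t)]
      with x hx
    rw [hx, Function.comp_apply]⟩
  map_add' φ ψ := by
    refine Subtype.ext (AEEqFun.ext ?_)
    have hq := h.quasiMeasurePreserving t
    refine (AEEqFun.coeFn_compQuasiMeasurePreserving _ hq).trans ?_
    refine EventuallyEq.trans ?_ (AEEqFun.coeFn_add _ _).symm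
    filter_upwards [hq.ae (AEEqFun.coeFn_add φ.1 ψ.1),
      AEEqFun.coeFn_compQuasiMeasurePreserving φ.1 hq,
      AEEqFun.coeFn_compQuasiMeasurePreserving ψ.1 hq] with x h1 h2 h3
    simp only [Pi.add_apply, h2, h3, Function.comp_apply]
    exact h1
  map_smul' c φ := by
    refine Subtype.ext (AEEqFun.ext ?_)
    have hq := h.quasiMeasurePreserving t
    refine (AEEqFun.coeFn_compQuasiMeasurePreserving _ hq).trans ?_
    refine EventuallyEq.trans ?_ (AEEqFun.coeFn_smul _ _).symm
    filter_upwards [hq.ae (AEEqFun.coeFn_smul c φ.1),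
      AEEqFun.coeFn_compQuasiMeasurePreserving φ.1 hq] with x h1 h2
    simp only [Pi.smul_apply, h2, Function.comp_apply]
    exact h1

theorem koopmanLinear_coe (h : InvariantFlow Ω f Φ L) (W : FlowWeight Ω Φ w ω) (t : ℝ≥0)
    (φ : weightedLp Ω w p) : (koopmanLinear h W p t φ).1 =ᵐ[volume.restrict Ω]
      fun x => φ.1 (flowMap Ω Φ t x) :=
  AEEqFun.coeFn_compQuasiMeasurePreserving _ (h.quasiMeasurePreserving t)

theorem normFun_koopmanLinear_le (h : InvariantFlow Ω f Φ L) (W : FlowWeight Ω Φ w ω) (t : ℝ≥0)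
    (φ : weightedLp Ω w p) :
    weightedLp.normFun (koopmanLinear h W p t φ) ≤
      opBound d L ω p t * weightedLp.normFun φ := by
  have hφ : MemLp (fun x => φ.1 x * w x) p (volume.restrict Ω) := φ.2
  have h1 : (fun x => (koopmanLinear h W p t φ).1 x * w x) =ᵐ[volume.restrict Ω]
      fun x => φ.1 (flowMap Ω Φ t x) * w x := by
    filter_upwards [koopmanLinear_coe h W t φ] with x hx
    rw [hx]
  have h2 := W.eLpNorm_comp_mul_le h t (p := p) hφ.1
  have hfin : (distortion d L t : ℝ≥0∞) ^ p.toReal⁻¹ ≠ ∞ :=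
    (ENNReal.rpow_lt_top_of_nonneg (by positivity) ENNReal.coe_ne_top).ne
  have h3 := ENNReal.toReal_mono (ENNReal.mul_ne_top ENNReal.ofReal_ne_top
    (ENNReal.mul_ne_top hfin hφ.2.ne)) h2
  rw [weightedLp.normFun, eLpNorm_congr_ae h1]
  refine h3.trans_eq ?_
  rw [ENNReal.toReal_mul, ENNReal.toReal_mul, ENNReal.toReal_ofReal (Real.exp_pos _).le,
    ← ENNReal.toReal_rpow, ENNReal.coe_toReal, ← mul_assoc]
  rfl

/-- Composition with the flow, as a bounded operator of the weighted space. -/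
def koopman (h : InvariantFlow Ω f Φ L) (W : FlowWeight Ω Φ w ω) (p : ℝ≥0∞) [Fact (1 ≤ p)]
    (t : ℝ≥0) : weightedLp Ω w p →L[ℝ] weightedLp Ω w p :=
  (koopmanLinear h W p t).mkContinuous (opBound d L ω p t) fun φ =>
    normFun_koopmanLinear_le h W t φ

theorem koopman_coe (h : InvariantFlow Ω f Φ L) (W : FlowWeight Ω Φ w ω) [Fact (1 ≤ p)] (t : ℝ≥0)
    (φ : weightedLp Ω w p) : (koopman h W p t φ).1 =ᵐ[volume.restrict Ω]
      fun x => φ.1 (flowMap Ω Φ t x) :=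
  koopmanLinear_coe h W t φ

theorem normFun_koopman_le (h : InvariantFlow Ω f Φ L) (W : FlowWeight Ω Φ w ω) [Fact (1 ≤ p)]
    {t T : ℝ≥0} (htT : t ≤ T) (φ : weightedLp Ω w p) :
    weightedLp.normFun (koopman h W p t φ) ≤ opBound d L ω p T * weightedLp.normFun φ :=
  (normFun_koopmanLinear_le h W t φ).trans
    (mul_le_mul_of_nonneg_right (opBound_mono L W.nonneg p htT) ENNReal.toReal_nonneg)

end Koopman

namespace Koopman

variable {d : ℕ} {Ω : Set (Eucl d)} {f : Eucl d → Eucl d} {Φ : ℝ≥0 → Eucl d → Eucl d} {L : ℝ≥0}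
  {w : Eucl d → ℝ} {ω : ℝ} {p q : ℝ≥0∞}

/-! ### The pairing -/

theorem weightedLp.normFun_nonneg (φ : weightedLp Ω w p) : 0 ≤ weightedLp.normFun φ :=
  ENNReal.toReal_nonneg

theorem weightedLp.memLp (φ : weightedLp Ω w p) :
    MemLp (fun x => φ.1 x * w x) p (volume.restrict Ω) := φ.2

/-- The factor `w²` is shared out evenly: Hölder's inequality applies to `ρw` and `φw`. -/
theorem integrable_pairing [q.HolderTriple p 1] (ρ : weightedLp Ω w q) (φ : weightedLp Ω w p) :
    Integrable (fun x => ρ.1 x * φ.1 x * w x ^ 2) (volume.restrict Ω) := by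
  refine ((weightedLp.memLp ρ).integrable_mul (weightedLp.memLp φ)).congr (Eventually.of_forall fun x => ?_)
  simp only [Pi.mul_apply]
  ring

theorem abs_pairing_le [q.HolderTriple p 1] (ρ : weightedLp Ω w q) (φ : weightedLp Ω w p) :
    |pairing Ω w ρ φ| ≤ weightedLp.normFun ρ * weightedLp.normFun φ := by
  have h1 := eLpNorm_smul_le_mul_eLpNorm (p := q) (q := p) (r := 1) (weightedLp.memLp φ).1 (weightedLp.memLp ρ).1
  have h2 : pairing Ω w ρ φ = ∫ x in Ω, ((fun x => ρ.1 x * w x) • fun x => φ.1 x * w x) x := by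
    refine integral_congr_ae (Eventually.of_forall fun x => ?_)
    simp only [Pi.smul_apply', smul_eq_mul]
    ring
  have h3 := ENNReal.toReal_mono (ENNReal.mul_ne_top (weightedLp.memLp ρ).2.ne (weightedLp.memLp φ).2.ne) h1
  rw [ENNReal.toReal_mul] at h3
  refine le_trans ?_ h3
  rw [h2, ← Real.norm_eq_abs]
  refine (norm_integral_le_lintegral_norm _).trans_eq ?_
  rw [eLpNorm_one_eq_lintegral_enorm]
  simp only [ofReal_norm]

theorem pairing_add_left [q.HolderTriple p 1] (ρ σ : weightedLp Ω w q) (φ : weightedLp Ω w p) :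
    pairing Ω w (ρ + σ : weightedLp Ω w q) φ = pairing Ω w ρ φ + pairing Ω w σ φ := by
  unfold pairing
  rw [← integral_add (integrable_pairing ρ φ) (integrable_pairing σ φ)]
  refine integral_congr_ae ?_
  filter_upwards [AEEqFun.coeFn_add ρ.1 σ.1] with x hx
  simp only [Submodule.coe_add, hx, Pi.add_apply]
  ring

theorem pairing_sub_left [q.HolderTriple p 1] (ρ σ : weightedLp Ω w q) (φ : weightedLp Ω w p) :
    pairing Ω w (ρ - σ : weightedLp Ω w q) φ = pairing Ω w ρ φ - pairing Ω w σ φ := by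
  have := pairing_add_left (ρ - σ) σ φ
  rw [sub_add_cancel] at this
  linarith

theorem pairing_sub_right [q.HolderTriple p 1] (ρ : weightedLp Ω w q) (φ ψ : weightedLp Ω w p) :
    pairing Ω w ρ (φ - ψ : weightedLp Ω w p) = pairing Ω w ρ φ - pairing Ω w ρ ψ := by
  unfold pairing
  rw [← integral_sub (integrable_pairing ρ φ) (integrable_pairing ρ ψ)]
  refine integral_congr_ae ?_
  filter_upwards [AEEqFun.coeFn_sub φ.1 ψ.1] with x hx
  simp only [Submodule.coe_sub, hx, Pi.sub_apply]
  ring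

theorem pairing_smul_right (c : ℝ) (ρ : weightedLp Ω w q) (φ : weightedLp Ω w p) :
    pairing Ω w ρ (c • φ : weightedLp Ω w p) = c * pairing Ω w ρ φ := by
  unfold pairing
  rw [← integral_const_mul]
  refine integral_congr_ae ?_
  filter_upwards [AEEqFun.coeFn_smul c φ.1] with x hx
  simp only [Submodule.coe_smul, hx, Pi.smul_apply, smul_eq_mul]
  ring

/-- The element of the weighted space given by a function. -/
def weightedLp.mk (u : Eucl d → ℝ) (hu : AEStronglyMeasurable u (volume.restrict Ω))
    (huw : MemLp (fun x => u x * w x) p (volume.restrict Ω)) : weightedLp Ω w p :=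
  ⟨AEEqFun.mk u hu, (memLp_congr_ae (by
    filter_upwards [AEEqFun.coeFn_mk u hu] with x hx
    rw [hx])).2 huw⟩

theorem weightedLp.coe_mk (u : Eucl d → ℝ) (hu : AEStronglyMeasurable u (volume.restrict Ω))
    (huw : MemLp (fun x => u x * w x) p (volume.restrict Ω)) :
    (weightedLp.mk u hu huw).1 =ᵐ[volume.restrict Ω] u := AEEqFun.coeFn_mk u hu

/-! ### Approximation by bounded functions of compact support -/

theorem exists_measure_abs_gt_le {α : Type*} [MeasurableSpace α] (μ : Measure α)
    [IsFiniteMeasure μ] {R : α → ℝ} (hR : Measurable R) {δ : ℝ≥0∞} (hδ : 0 < δ) :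
    ∃ n : ℕ, μ {x | (n : ℝ) < |R x|} ≤ δ := by
  have h := tendsto_measure_iInter_atTop (μ := μ) (s := fun n : ℕ => {x | (n : ℝ) < |R x|})
    (fun n => (measurableSet_lt measurable_const hR.abs).nullMeasurableSet)
    (fun m n hmn x hx => show (m : ℝ) < |R x| from
      lt_of_le_of_lt (Nat.cast_le.2 hmn) (show (n : ℝ) < |R x| from hx))
    ⟨0, measure_ne_top _ _⟩
  have hempty : ⋂ n : ℕ, {x | (n : ℝ) < |R x|} = ∅ := by
    ext x
    obtain ⟨n, hn⟩ := exists_nat_ge |R x|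
    simp only [Set.mem_iInter, Set.mem_ofPred_eq, Set.mem_empty_iff_false, iff_false, not_forall,
      not_lt]
    exact ⟨n, hn⟩
  rw [hempty, measure_empty] at h
  obtain ⟨n, hn⟩ := (h.eventually (ge_mem_nhds hδ)).exists
  exact ⟨n, hn⟩

/-- Elements `ρ` of the predual for which `ρ w²` is bounded with compact support are dense. -/
theorem exists_bounded_approx (h : InvariantFlow Ω f Φ L) (W : FlowWeight Ω Φ w ω)
    (hq1 : 1 ≤ q) (hq : q ≠ ∞) (ρ : weightedLp Ω w q) {δ : ℝ} (hδ : 0 < δ) :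
    ∃ (ρ' : weightedLp Ω w q) (b : Eucl d → ℝ) (M : ℝ) (K : Set (Eucl d)), IsCompact K ∧ K ⊆ Ω ∧
      (∀ x, x ∉ K → b x = 0) ∧ AEStronglyMeasurable b (volume.restrict Ω) ∧ (∀ x, |b x| ≤ M) ∧
      (∀ᵐ x ∂volume.restrict Ω, ρ'.1 x * w x ^ 2 = b x) ∧ weightedLp.normFun (ρ - ρ') ≤ δ := by
  have := h.isFiniteMeasure
  -- Absolute continuity of the `L^q` norm, which requires `q ≠ ∞`: it suffices to discard a set of
  -- measure at most `δ'`.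
  obtain ⟨δ', hδ', hsmall⟩ := (weightedLp.memLp ρ).eLpNorm_indicator_le hq1 hq hδ
  have hRm : AEStronglyMeasurable (fun x => ρ.1 x * w x ^ 2) (volume.restrict Ω) :=
    ρ.1.aestronglyMeasurable.mul (W.aestronglyMeasurable.pow 2)
  set R := hRm.mk _
  have hR : Measurable R := hRm.measurable_mk
  obtain ⟨n, hn⟩ := exists_measure_abs_gt_le (volume.restrict Ω) hR
    (δ := ENNReal.ofReal (δ' / 2)) (by simpa using hδ')
  obtain ⟨K, hKΩ, hK, hKm⟩ := h.isOpen.measurableSet.exists_isCompact_sdiff_lt (μ := volume)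
    h.bounded.measure_lt_top.ne (ε := ENNReal.ofReal (δ' / 2)) (by simpa using hδ')
  set E : Set (Eucl d) := K ∩ {x | |R x| ≤ n}
  have hE : MeasurableSet E := hK.measurableSet.inter (measurableSet_le hR.abs measurable_const)
  have hEc : volume.restrict Ω Eᶜ ≤ ENNReal.ofReal δ' := by
    have hsub : Eᶜ ⊆ Kᶜ ∪ {x | (n : ℝ) < |R x|} := fun x hx => by
      by_cases hxK : x ∈ K
      · exact Or.inr (show (n : ℝ) < |R x| from not_le.1 fun hle => hx ⟨hxK, hle⟩)
      · exact Or.inl hxK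
    have hKc : volume.restrict Ω Kᶜ = volume (Ω \ K) := by
      rw [Measure.restrict_apply hK.measurableSet.compl, Set.inter_comm, Set.sdiff_eq]
    calc _ ≤ _ := (measure_mono hsub).trans (measure_union_le _ _)
      _ ≤ ENNReal.ofReal (δ' / 2) + ENNReal.ofReal (δ' / 2) := by
          gcongr
          rw [hKc]; exact hKm.le
      _ = _ := by rw [← ENNReal.ofReal_add (by positivity) (by positivity), add_halves]
  have hmem : MemLp (fun x => E.indicator ρ.1 x * w x) q (volume.restrict Ω) := by
    refine (memLp_congr_ae (Eventually.of_forall fun x => ?_)).1 ((weightedLp.memLp ρ).indicator hE)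
    by_cases hx : x ∈ E <;> simp [hx]
  have hmeas : AEStronglyMeasurable (E.indicator ρ.1) (volume.restrict Ω) :=
    ρ.1.aestronglyMeasurable.indicator hE
  refine ⟨weightedLp.mk _ hmeas hmem, E.indicator R, n, K, hK, hKΩ,
    fun x hx => Set.indicator_of_notMem (fun hE' => hx hE'.1) _,
    (hRm.stronglyMeasurable_mk.indicator hE).aestronglyMeasurable, fun x => ?_, ?_, ?_⟩
  · by_cases hx : x ∈ E
    · rw [Set.indicator_of_mem hx]; exact hx.2
    · simp [hx]
  · filter_upwards [weightedLp.coe_mk _ hmeas hmem, hRm.ae_eq_mk] with x h1 h2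
    rw [h1]
    by_cases hx : x ∈ E
    · simp only [Set.indicator_of_mem hx]; exact h2
    · simp [hx]
  · have heq : (fun x => (ρ - weightedLp.mk _ hmeas hmem).1 x * w x) =ᵐ[volume.restrict Ω]
        Eᶜ.indicator fun x => ρ.1 x * w x := by
      filter_upwards [weightedLp.coe_mk _ hmeas hmem,
        AEEqFun.coeFn_sub ρ.1 (weightedLp.mk _ hmeas hmem).1] with x h1 h2
      rw [Submodule.coe_sub, h2, Pi.sub_apply, h1]
      by_cases hx : x ∈ E <;> simp [hx]
    rw [weightedLp.normFun, eLpNorm_congr_ae heq]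
    exact ENNReal.toReal_le_of_le_ofReal hδ.le (hsmall _ hE.compl hEc)

theorem pairing_koopman_eq (h : InvariantFlow Ω f Φ L) (W : FlowWeight Ω Φ w ω) [Fact (1 ≤ p)]
    {ρ : weightedLp Ω w q} {b : Eucl d → ℝ}
    (hb : ∀ᵐ x ∂volume.restrict Ω, ρ.1 x * w x ^ 2 = b x) (t : ℝ≥0) (φ : weightedLp Ω w p) :
    pairing Ω w ρ (koopman h W p t φ) = ∫ x in Ω, b x * φ.1 (flowMap Ω Φ t x) := by
  refine integral_congr_ae ?_
  filter_upwards [hb, koopman_coe h W t φ] with x h1 h2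
  rw [h2, ← h1]
  ring

theorem pairing_eq {ρ : weightedLp Ω w q} {b : Eucl d → ℝ}
    (hb : ∀ᵐ x ∂volume.restrict Ω, ρ.1 x * w x ^ 2 = b x) (φ : weightedLp Ω w p) :
    pairing Ω w ρ φ = ∫ x in Ω, b x * φ.1 x := by
  refine integral_congr_ae ?_
  filter_upwards [hb] with x h1
  rw [← h1]
  ring

theorem abs_pairing_koopman_le (h : InvariantFlow Ω f Φ L) (W : FlowWeight Ω Φ w ω)
    [Fact (1 ≤ p)] [q.HolderTriple p 1] {t T : ℝ≥0} (htT : t ≤ T) (ρ : weightedLp Ω w q)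
    (φ : weightedLp Ω w p) :
    |pairing Ω w ρ (koopman h W p t φ)| ≤
      weightedLp.normFun ρ * (opBound d L ω p T * weightedLp.normFun φ) :=
  (abs_pairing_le _ _).trans
    (mul_le_mul_of_nonneg_left (normFun_koopman_le h W htT φ) (weightedLp.normFun_nonneg ρ))

/-- The operators are bounded locally uniformly in time, so `ρ` may be replaced by an approximation
with `ρw²` bounded, for which the unweighted continuity statement applies. -/
theorem continuous_pairing_koopman (h : InvariantFlow Ω f Φ L) (W : FlowWeight Ω Φ w ω)
    [Fact (1 ≤ p)] [q.HolderTriple p 1] (hq1 : 1 ≤ q) (hq : q ≠ ∞) (ρ : weightedLp Ω w q)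
    (φ : weightedLp Ω w p) : Continuous fun t => pairing Ω w ρ (koopman h W p t φ) := by
  refine continuous_of_locally_uniform_approx_of_continuousAt fun t₀ U hU => ?_
  obtain ⟨ε, hε, hεU⟩ := Metric.mem_uniformity_dist.1 hU
  set C := opBound d L ω p (t₀ + 1) * weightedLp.normFun φ
  have hC : 0 ≤ C := mul_nonneg (opBound_nonneg _ _ _ _) (weightedLp.normFun_nonneg φ)
  obtain ⟨ρ', b, M, K, -, -, -, hbm, hbM, hb, hn⟩ :=
    exists_bounded_approx h W hq1 hq ρ (δ := ε / (2 * (C + 1))) (by positivity)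
  have hφ : IntegrableOn φ.1 Ω := W.integrableOn h (weightedLp.memLp φ)
  refine ⟨Set.Iio (t₀ + 1), Iio_mem_nhds (by simp),
    fun t => pairing Ω w ρ' (koopman h W p t φ), ?_, fun t ht => hεU ?_⟩
  · simp only [pairing_koopman_eq h W hb]
    exact (h.continuous_integral_mul_comp hbm hbM hφ).continuousAt
  · rw [Real.dist_eq, ← pairing_sub_left]
    calc _ ≤ weightedLp.normFun (ρ - ρ') * C := abs_pairing_koopman_le h W (le_of_lt ht) _ _
      _ ≤ ε / (2 * (C + 1)) * C := by gcongr
      _ < ε := by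
          rw [div_mul_eq_mul_div, div_lt_iff₀ (by positivity)]
          nlinarith

theorem koopman_zero (h : InvariantFlow Ω f Φ L) (W : FlowWeight Ω Φ w ω) [Fact (1 ≤ p)] :
    koopman h W p 0 = ContinuousLinearMap.id ℝ (weightedLp Ω w p) := by
  refine ContinuousLinearMap.ext fun φ => Subtype.ext (AEEqFun.ext ?_)
  filter_upwards [koopman_coe h W 0 φ] with x hx
  rw [hx, h.flowMap_zero]
  rfl

theorem koopman_add (h : InvariantFlow Ω f Φ L) (W : FlowWeight Ω Φ w ω) [Fact (1 ≤ p)]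
    (s t : ℝ≥0) : koopman h W p (s + t) = (koopman h W p s).comp (koopman h W p t) := by
  refine ContinuousLinearMap.ext fun φ => Subtype.ext (AEEqFun.ext ?_)
  rw [ContinuousLinearMap.comp_apply]
  filter_upwards [koopman_coe h W (s + t) φ, koopman_coe h W s (koopman h W p t φ),
    (h.quasiMeasurePreserving s).ae (koopman_coe h W t φ)] with x h1 h2 h3
  rw [h1, h2, h3, add_comm s t, h.flowMap_add]

/-! ### Weak-* continuity -/

/-- For `J ≤ D` one has `|gJ|^q ≤ D^{q-1} |g|^q J`. -/
theorem memLp_mul_toReal_of_memLp_withDensity {α : Type*} [MeasurableSpace α] {μ : Measure α}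
    {J : α → ℝ≥0∞} (hJ : Measurable J) {D : ℝ≥0∞} (hD : D ≠ ∞) (hJD : ∀ᵐ x ∂μ, J x ≤ D)
    (hq1 : 1 ≤ q) (hq : q ≠ ∞) {g : α → ℝ} (hgm : Measurable g)
    (hg : MemLp g q (μ.withDensity J)) : MemLp (fun x => g x * (J x).toReal) q μ := by
  have hq0 : q ≠ 0 := (zero_lt_one.trans_le hq1).ne'
  have hr : 1 ≤ q.toReal := by
    rw [← ENNReal.toReal_one]; exact ENNReal.toReal_mono hq hq1
  refine ⟨(hgm.mul hJ.ennreal_toReal).aestronglyMeasurable, ?_⟩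
  have h1 := (eLpNorm_lt_top_iff_lintegral_rpow_enorm_lt_top hq0 hq).1 hg.2
  rw [lintegral_withDensity_eq_lintegral_mul _ hJ (hgm.enorm.pow_const _)] at h1
  rw [eLpNorm_lt_top_iff_lintegral_rpow_enorm_lt_top hq0 hq]
  have hDr : D ^ (q.toReal - 1) ≠ ∞ := ENNReal.rpow_ne_top_of_nonneg (by linarith) hD
  refine lt_of_le_of_lt ?_ (ENNReal.mul_lt_top hDr.lt_top h1)
  rw [← lintegral_const_mul' _ _ hDr]
  refine lintegral_mono_ae ?_
  filter_upwards [hJD] with x hx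
  have hx' : J x ≠ ∞ := (hx.trans_lt hD.lt_top).ne
  have e1 : ‖(J x).toReal‖ₑ = J x := by
    rw [Real.enorm_eq_ofReal_abs, abs_of_nonneg ENNReal.toReal_nonneg, ENNReal.ofReal_toReal hx']
  have e2 : J x ^ q.toReal ≤ D ^ (q.toReal - 1) * J x := by
    calc J x ^ q.toReal = J x ^ (q.toReal - 1 + 1) := by ring_nf
      _ = J x ^ (q.toReal - 1) * J x := by
          rw [ENNReal.rpow_add_of_nonneg _ _ (by linarith) zero_le_one, ENNReal.rpow_one]
      _ ≤ _ := by gcongr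
  rw [enorm_mul, e1, ENNReal.mul_rpow_of_nonneg _ _ (by linarith), Pi.mul_apply]
  calc ‖g x‖ₑ ^ q.toReal * J x ^ q.toReal
      ≤ ‖g x‖ₑ ^ q.toReal * (D ^ (q.toReal - 1) * J x) := by gcongr
    _ = _ := by ring

/-- The preadjoint is transport of `ρ` by the flow `θ`. Writing the pairing as `∫ P (φw) ∘ θ` with
`P = ρw · w / (w ∘ θ)`, and changing variables with a left inverse `τ` and the density `J` of the
image measure, gives `σ = (P ∘ τ) J / w`. It lies in the predual because `|P| ≤ e^{ωt} |ρw|` and `J`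
is bounded. -/
theorem exists_predual_koopman (h : InvariantFlow Ω f Φ L) (W : FlowWeight Ω Φ w ω)
    [Fact (1 ≤ p)] (hq1 : 1 ≤ q) (hq : q ≠ ∞) (t : ℝ≥0) (ρ : weightedLp Ω w q) :
    ∃ σ : weightedLp Ω w q, ∀ φ : weightedLp Ω w p,
      pairing Ω w ρ (koopman h W p t φ) = pairing Ω w σ φ := by
  have := h.isFiniteMeasure
  set μ : Measure (Eucl d) := volume.restrict Ω with hμ
  set θ := flowMap Ω Φ t
  have hθ : Measurable θ := h.measurable_flowMap t
  have hqmp : Measure.QuasiMeasurePreserving θ μ μ := h.quasiMeasurePreserving t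
  obtain ⟨τ, hτc, hτ, -⟩ := h.exists_leftInverse t
  have hτθ : ∀ᵐ x ∂μ, τ (θ x) = x := by
    filter_upwards [ae_restrict_mem h.isOpen.measurableSet] with x hx using hτ x hx
  -- the density of the image measure
  set ν := μ.map θ
  have : IsFiniteMeasure ν := Measure.isFiniteMeasure_map μ θ
  set J := ν.rnDeriv μ
  have hJ : Measurable J := Measure.measurable_rnDeriv ν μ
  have hνJ : μ.withDensity J = ν := Measure.withDensity_rnDeriv_eq ν μ hqmp.absolutelyContinuous
  have hJD : ∀ᵐ x ∂μ, J x ≤ (distortion d L t : ℝ≥0∞) := by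
    refine ae_le_of_forall_setLIntegral_le_of_sigmaFinite hJ fun s hs _ => ?_
    refine (Measure.setLIntegral_rnDeriv_le s).trans ?_
    simpa using h.map_flowMap_le t s
  -- the transported predual element
  set P : Eucl d → ℝ := fun x => ρ.1 x * w x * (w x * (w (θ x))⁻¹)
  have hPm : AEStronglyMeasurable P μ :=
    (weightedLp.memLp ρ).1.mul (W.aestronglyMeasurable.mul (W.inv_memLp.1.comp_quasiMeasurePreserving hqmp))
  have hP : MemLp P q μ := by
    refine (weightedLp.memLp ρ).of_le_mul (c := Real.exp (ω * t)) hPm ?_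
    filter_upwards [W.pos, hqmp.ae W.pos, W.growth t] with x h1 h2 h3
    have h4 : w x * (w (θ x))⁻¹ ≤ Real.exp (ω * t) := by
      calc w x * (w (θ x))⁻¹ ≤ w x * (Real.exp (ω * t) * (w x)⁻¹) := by gcongr
        _ = _ := by field_simp
    rw [norm_mul, mul_comm, Real.norm_of_nonneg (by positivity : 0 ≤ w x * (w (θ x))⁻¹)]
    gcongr
  -- A genuinely measurable representative is needed, since nothing ensures that `τ` pulls null sets
  -- back to null sets.
  set P₀ := hPm.mk P
  have hP₀ : Measurable P₀ := hPm.measurable_mk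
  have hg : Measurable (P₀ ∘ τ) := hP₀.comp hτc.measurable
  have hgθ : (P₀ ∘ τ) ∘ θ =ᵐ[μ] P := by
    filter_upwards [hPm.ae_eq_mk, hτθ] with x h1 h2
    simp only [Function.comp_apply, h2]
    exact h1.symm
  have hgν : MemLp (P₀ ∘ τ) q ν :=
    (memLp_map_measure_iff hg.aestronglyMeasurable hθ.aemeasurable).2 ((memLp_congr_ae hgθ).2 hP)
  have hS := memLp_mul_toReal_of_memLp_withDensity hJ ENNReal.coe_ne_top hJD hq1 hq hg
    (hνJ ▸ hgν)
  have hcancel : (fun x => (P₀ ∘ τ) x * (J x).toReal * (w x)⁻¹ * w x) =ᵐ[μ]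
      fun x => (P₀ ∘ τ) x * (J x).toReal := by
    filter_upwards [W.pos] with x hx
    field_simp
  have hσm : AEStronglyMeasurable (fun x => (P₀ ∘ τ) x * (J x).toReal * (w x)⁻¹) μ :=
    hS.1.mul W.inv_memLp.1
  have hσ := (memLp_congr_ae hcancel).2 hS
  refine ⟨weightedLp.mk _ hσm hσ, fun φ => ?_⟩
  have e1 : pairing Ω w ρ (koopman h W p t φ) =
      ∫ x, (P₀ ∘ τ) (θ x) * (φ.1 (θ x) * w (θ x)) ∂μ := by
    refine integral_congr_ae ?_
    filter_upwards [koopman_coe h W t φ, hgθ, hqmp.ae W.pos] with x h1 h2 h3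
    rw [h1, show (P₀ ∘ τ) (θ x) = P x from h2]
    simp only [P]
    change ρ.1 x * φ.1 (θ x) * w x ^ 2 = _
    have h3' : w (θ x) ≠ 0 := h3.ne'
    field_simp
  have e2 : ∫ x, (P₀ ∘ τ) (θ x) * (φ.1 (θ x) * w (θ x)) ∂μ =
      ∫ x, (P₀ ∘ τ) x * (φ.1 x * w x) ∂ν := by
    refine (integral_map hθ.aemeasurable (f := fun x => (P₀ ∘ τ) x * (φ.1 x * w x)) ?_).symm
    exact hg.aestronglyMeasurable.mul ((weightedLp.memLp φ).1.mono_ac hqmp.absolutelyContinuous)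
  rw [e1, e2, ← hνJ, integral_withDensity_eq_integral_toReal_smul hJ
    (hJD.mono fun x hx => hx.trans_lt ENNReal.coe_lt_top)]
  refine integral_congr_ae ?_
  filter_upwards [weightedLp.coe_mk _ hσm hσ, W.pos] with x h1 h2
  rw [h1, smul_eq_mul]
  field_simp

theorem isWeakStarSemigroup_koopman (h : InvariantFlow Ω f Φ L) (W : FlowWeight Ω Φ w ω)
    [Fact (1 ≤ p)] [q.HolderTriple p 1] (hq1 : 1 ≤ q) (hq : q ≠ ∞) :
    IsWeakStarSemigroup q (koopman h W p) where
  zero := koopman_zero h W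
  add s t := koopman_add h W s t
  continuous_orbit ρ φ := continuous_pairing_koopman h W hq1 hq ρ φ
  weakStar_continuous t ρ := exists_predual_koopman h W hq1 hq t ρ

end Koopman

namespace Koopman

variable {d : ℕ} {Ω : Set (Eucl d)} {f : Eucl d → Eucl d} {Φ : ℝ≥0 → Eucl d → Eucl d} {L : ℝ≥0}
  {w : Eucl d → ℝ} {ω : ℝ} {p q : ℝ≥0∞}

/-! ### The graph of the generator -/

theorem weightedLp.integrableOn (h : InvariantFlow Ω f Φ L) (W : FlowWeight Ω Φ w ω)
    [Fact (1 ≤ p)] (φ : weightedLp Ω w p) : IntegrableOn φ.1 Ω :=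
  W.integrableOn h (weightedLp.memLp φ)

theorem weightedLp.integrable_mul (h : InvariantFlow Ω f Φ L) (W : FlowWeight Ω Φ w ω)
    [Fact (1 ≤ p)] (φ : weightedLp Ω w p) {b : Eucl d → ℝ} (hb : Continuous b) {M : ℝ}
    (hM : ∀ x, |b x| ≤ M) : Integrable (fun x => φ.1 x * b x) (volume.restrict Ω) := by
  refine ((weightedLp.integrableOn h W φ).bdd_mul (c := M) hb.aestronglyMeasurable
    (Eventually.of_forall hM)).congr (Eventually.of_forall fun x => ?_)
  simp only [mul_comm]

/-- In the weighted spaces local integrability is automatic, and a single integral, linear in `(φ,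
ψ)`, expresses the condition; hence the graph is a subspace. -/
theorem weightedLp.hasWeakDerivAlong_iff (h : InvariantFlow Ω f Φ L) (W : FlowWeight Ω Φ w ω)
    [Fact (1 ≤ p)] (φ ψ : weightedLp Ω w p) : HasWeakDerivAlong Ω f φ.1 ψ.1 ↔
      ∀ η, IsTestFunction Ω η →
        ∫ x in Ω, (φ.1 x * divergence (fun y => η y • f y) x + ψ.1 x * η x) = 0 := by
  have key : ∀ η, IsTestFunction Ω η →
      ∫ x in Ω, (φ.1 x * divergence (fun y => η y • f y) x + ψ.1 x * η x) =
        (∫ x in Ω, φ.1 x * divergence (fun y => η y • f y) x) + ∫ x in Ω, ψ.1 x * η x := by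
    intro η hη
    obtain ⟨M, hM⟩ := hη.exists_divergence_bound h.contDiff
    obtain ⟨N, hN⟩ := hη.exists_bound
    exact integral_add
      (weightedLp.integrable_mul h W φ (continuous_divergence (hη.contDiff_smul h.contDiff)) hM)
      (weightedLp.integrable_mul h W ψ hη.smooth.continuous hN)
  constructor
  · intro hw η hη
    rw [key η hη, hw.integral_eq η hη, neg_add_cancel]
  · intro hw
    refine ⟨(weightedLp.integrableOn h W φ).locallyIntegrableOn,
      (weightedLp.integrableOn h W ψ).locallyIntegrableOn, fun η hη => ?_⟩
    have := hw η hη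
    rw [key η hη] at this
    exact eq_neg_of_add_eq_zero_left this

/-- The pairs `(φ, ψ)` with `fᵀ∇φ = ψ` weakly. -/
def derivAlongGraph (h : InvariantFlow Ω f Φ L) (W : FlowWeight Ω Φ w ω) (p : ℝ≥0∞)
    [Fact (1 ≤ p)] : Submodule ℝ (weightedLp Ω w p × weightedLp Ω w p) where
  carrier := {x | HasWeakDerivAlong Ω f x.1.1 x.2.1}
  zero_mem' := by
    refine (weightedLp.hasWeakDerivAlong_iff h W 0 0).2 fun η _ => integral_eq_zero_of_ae ?_
    filter_upwards [AEEqFun.coeFn_zero (α := Eucl d) (μ := volume.restrict Ω) (β := ℝ)] with x hx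
    simp [hx]
  add_mem' := by
    intro x y hx hy
    refine (weightedLp.hasWeakDerivAlong_iff h W (x.1 + y.1) (x.2 + y.2)).2 fun η hη => ?_
    have hx' := (weightedLp.hasWeakDerivAlong_iff h W x.1 x.2).1 hx η hη
    have hy' := (weightedLp.hasWeakDerivAlong_iff h W y.1 y.2).1 hy η hη
    obtain ⟨M, hM⟩ := hη.exists_divergence_bound h.contDiff
    obtain ⟨N, hN⟩ := hη.exists_bound
    have hdiv := continuous_divergence (hη.contDiff_smul h.contDiff)
    have hint : ∀ φ ψ : weightedLp Ω w p, Integrable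
        (fun x => φ.1 x * divergence (fun y => η y • f y) x + ψ.1 x * η x)
        (volume.restrict Ω) := fun φ ψ =>
      (weightedLp.integrable_mul h W φ hdiv hM).add
        (weightedLp.integrable_mul h W ψ hη.smooth.continuous hN)
    rw [← add_zero (0 : ℝ)]
    nth_rewrite 1 [← hx']
    rw [← hy']
    rw [← integral_add (hint x.1 x.2) (hint y.1 y.2)]
    refine integral_congr_ae ?_
    filter_upwards [AEEqFun.coeFn_add x.1.1 y.1.1, AEEqFun.coeFn_add x.2.1 y.2.1] with z h1 h2
    simp only [Submodule.coe_add, h1, h2, Pi.add_apply]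
    ring
  smul_mem' := by
    intro c x hx
    refine (weightedLp.hasWeakDerivAlong_iff h W (c • x.1) (c • x.2)).2 fun η hη => ?_
    have hx' := (weightedLp.hasWeakDerivAlong_iff h W x.1 x.2).1 hx η hη
    rw [← mul_zero c, ← hx', ← integral_const_mul]
    refine integral_congr_ae ?_
    filter_upwards [AEEqFun.coeFn_smul c x.1.1, AEEqFun.coeFn_smul c x.2.1] with z h1 h2
    simp only [Submodule.coe_smul, h1, h2, Pi.smul_apply, smul_eq_mul]
    ring

/-- The operator `φ ↦ fᵀ∇φ` on its maximal domain. -/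
def derivAlong (h : InvariantFlow Ω f Φ L) (W : FlowWeight Ω Φ w ω) (p : ℝ≥0∞) [Fact (1 ≤ p)] :
    weightedLp Ω w p →ₗ.[ℝ] weightedLp Ω w p :=
  (derivAlongGraph h W p).toLinearPMap

theorem mem_graph_derivAlong (h : InvariantFlow Ω f Φ L) (W : FlowWeight Ω Φ w ω) [Fact (1 ≤ p)]
    (φ ψ : weightedLp Ω w p) :
    (φ, ψ) ∈ (derivAlong h W p).graph ↔ HasWeakDerivAlong Ω f φ.1 ψ.1 := by
  rw [derivAlong, Submodule.toLinearPMap_graph_eq]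
  · rfl
  -- The graph is single-valued because weak derivatives along `f` are unique.
  · intro x hx hx0
    have h0 : (x.1, (0 : weightedLp Ω w p)) ∈ derivAlongGraph h W p := by
      rw [hx0]; exact (derivAlongGraph h W p).zero_mem
    exact Subtype.ext (AEEqFun.ext (HasWeakDerivAlong.ae_unique h.isOpen hx
      ((h0 : HasWeakDerivAlong Ω f x.1.1 (0 : weightedLp Ω w p).1))))

/-! ### Differentiability of orbits -/

theorem tendsto_inv_mul_intervalIntegral {P : ℝ → ℝ} (hP : Continuous P) :
    Tendsto (fun t : ℝ≥0 => (t : ℝ)⁻¹ * ∫ s in (0 : ℝ)..t, P s) (𝓝[>] 0) (𝓝 (P 0)) := by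
  have h1 : HasDerivAt (fun t => ∫ s in (0 : ℝ)..t, P s) (P 0) 0 :=
    intervalIntegral.integral_hasDerivAt_right (hP.intervalIntegrable _ _)
      hP.aestronglyMeasurable.stronglyMeasurableAtFilter hP.continuousAt
  have h2 := hasDerivAt_iff_tendsto_slope_zero.1 h1
  have h3 : Tendsto (fun t : ℝ≥0 => (t : ℝ)) (𝓝[>] 0) (𝓝[≠] 0) := by
    refine tendsto_nhdsWithin_iff.2 ⟨?_, ?_⟩
    · exact (NNReal.continuous_coe.tendsto 0).mono_left nhdsWithin_le_nhds
    · filter_upwards [self_mem_nhdsWithin] with t ht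
      exact NNReal.coe_ne_zero.2 (ne_of_gt ht)
  simpa [Function.comp_def] using h2.comp h3

/-- The transport identity is known against bounded functions of compact support in `Ω`; density of
such `ρw²` and the operator bounds carry it to the whole predual. -/
theorem pairing_koopman_sub_eq (h : InvariantFlow Ω f Φ L) (W : FlowWeight Ω Φ w ω)
    [Fact (1 ≤ p)] [q.HolderTriple p 1] (hq1 : 1 ≤ q) (hq : q ≠ ∞) {φ ψ : weightedLp Ω w p}
    (hw : HasWeakDerivAlong Ω f φ.1 ψ.1) (ρ : weightedLp Ω w q) (t : ℝ≥0) :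
    pairing Ω w ρ (koopman h W p t φ) - pairing Ω w ρ φ =
      ∫ s in (0 : ℝ)..t, pairing Ω w ρ (koopman h W p s.toNNReal ψ) := by
  refine eq_of_abs_sub_le_all fun ε hε => ?_
  set B := opBound d L ω p t
  have hB : 0 ≤ B := opBound_nonneg _ _ _ _
  set Nφ := weightedLp.normFun φ
  set Nψ := weightedLp.normFun ψ
  have hNφ : 0 ≤ Nφ := weightedLp.normFun_nonneg φ
  have hNψ : 0 ≤ Nψ := weightedLp.normFun_nonneg ψ
  -- The three terms bound the pairing with `ρ - ρ'` of the orbit of `φ` at time `t`, of `φ` itself,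
  -- and of the orbit of `ψ` integrated over `[0, t]`.
  set C := B * Nφ + Nφ + B * Nψ * t with hC
  have hC0 : 0 ≤ C := by positivity
  set δ := ε / (C + 1)
  have hδ : 0 < δ := by positivity
  obtain ⟨ρ', b, M, K, hK, hKΩ, hbK, hbm, hbM, hb, hn⟩ :=
    exists_bounded_approx h W hq1 hq ρ hδ
  have hc : ∀ σ : weightedLp Ω w q,
      Continuous fun s : ℝ => pairing Ω w σ (koopman h W p s.toNNReal ψ) := fun σ =>
    (continuous_pairing_koopman h W hq1 hq σ ψ).comp continuous_real_toNNReal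
  have e := h.integral_mul_comp_sub_eq (weightedLp.integrableOn h W φ)
    (weightedLp.integrableOn h W ψ) hw hbm hbM hK hKΩ hbK t
  simp only [← pairing_koopman_eq h W hb, ← pairing_eq hb] at e
  have i1 : (∫ s in (0 : ℝ)..t, pairing Ω w (ρ - ρ' : weightedLp Ω w q)
      (koopman h W p s.toNNReal ψ)) =
      (∫ s in (0 : ℝ)..t, pairing Ω w ρ (koopman h W p s.toNNReal ψ)) -
        ∫ s in (0 : ℝ)..t, pairing Ω w ρ' (koopman h W p s.toNNReal ψ) := by
    rw [← intervalIntegral.integral_sub ((hc ρ).intervalIntegrable _ _)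
      ((hc ρ').intervalIntegrable _ _)]
    simp only [pairing_sub_left]
  have i2 := pairing_sub_left ρ ρ' (koopman h W p t φ)
  have i3 := pairing_sub_left ρ ρ' φ
  have b1 := abs_pairing_koopman_le h W le_rfl (t := t) (ρ - ρ') φ
  have b2 := abs_pairing_le (ρ - ρ') φ
  have b3 := intervalIntegral.norm_integral_le_of_norm_le_const (a := (0 : ℝ)) (b := t)
    (f := fun s => pairing Ω w (ρ - ρ' : weightedLp Ω w q) (koopman h W p s.toNNReal ψ))
    (C := weightedLp.normFun (ρ - ρ') * (B * Nψ)) fun s hs => by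
      rw [Set.uIoc_of_le t.coe_nonneg] at hs
      exact abs_pairing_koopman_le h W (Real.toNNReal_le_iff_le_coe.2 hs.2) (ρ - ρ') ψ
  rw [Real.norm_eq_abs, sub_zero, abs_of_nonneg t.coe_nonneg] at b3
  have hfin : weightedLp.normFun (ρ - ρ') * C ≤ ε := by
    calc _ ≤ δ * C := by gcongr
      _ ≤ ε := by
        rw [div_mul_eq_mul_div, div_le_iff₀ (by positivity)]
        nlinarith
  have heq : pairing Ω w ρ (koopman h W p t φ) - pairing Ω w ρ φ -
      ∫ s in (0 : ℝ)..t, pairing Ω w ρ (koopman h W p s.toNNReal ψ) =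
      pairing Ω w (ρ - ρ' : weightedLp Ω w q) (koopman h W p t φ) -
        pairing Ω w (ρ - ρ' : weightedLp Ω w q) φ -
        ∫ s in (0 : ℝ)..t, pairing Ω w (ρ - ρ' : weightedLp Ω w q)
          (koopman h W p s.toNNReal ψ) := by
    rw [i1, i2, i3, ← e]; ring
  rw [heq]
  refine (abs_sub _ _).trans ((add_le_add (abs_sub _ _) le_rfl).trans ?_)
  refine le_trans ?_ hfin
  rw [hC]
  linarith

theorem pairing_inv_smul_koopman_sub (h : InvariantFlow Ω f Φ L) (W : FlowWeight Ω Φ w ω)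
    [Fact (1 ≤ p)] [q.HolderTriple p 1] (ρ : weightedLp Ω w q) (φ : weightedLp Ω w p) (t : ℝ≥0) :
    pairing Ω w ρ ((t : ℝ)⁻¹ • (koopman h W p t φ - φ) : weightedLp Ω w p) =
      (t : ℝ)⁻¹ * (pairing Ω w ρ (koopman h W p t φ) - pairing Ω w ρ φ) := by
  rw [pairing_smul_right, pairing_sub_right]

/-- The predual element `η w⁻²`, which represents integration against `η`. -/
theorem exists_predual_test (h : InvariantFlow Ω f Φ L) (W : FlowWeight Ω Φ w ω)
    {η : Eucl d → ℝ} (hη : IsTestFunction Ω η) :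
    ∃ ρ : weightedLp Ω w q, ∀ᵐ x ∂volume.restrict Ω, ρ.1 x * w x ^ 2 = η x := by
  have := h.isFiniteMeasure
  obtain ⟨M, hM⟩ := hη.exists_bound
  have hηm : AEStronglyMeasurable η (volume.restrict Ω) :=
    hη.smooth.continuous.aestronglyMeasurable
  have hm : AEStronglyMeasurable (fun x => η x * (w x)⁻¹ ^ 2) (volume.restrict Ω) :=
    hηm.mul (W.inv_memLp.1.pow 2)
  have hmem : MemLp (fun x => η x * (w x)⁻¹ ^ 2 * w x) q (volume.restrict Ω) := by
    refine (W.inv_memLp.mono_exponent le_top : MemLp _ q _).of_le_mul (c := M)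
      (hm.mul W.aestronglyMeasurable) ?_
    filter_upwards [W.pos] with x hx
    have : η x * (w x)⁻¹ ^ 2 * w x = η x * (w x)⁻¹ := by field_simp
    rw [this, norm_mul]
    exact mul_le_mul_of_nonneg_right (hM x) (norm_nonneg _)
  refine ⟨weightedLp.mk _ hm hmem, ?_⟩
  filter_upwards [weightedLp.coe_mk _ hm hmem, W.pos] with x h1 h2
  rw [h1]
  field_simp

/-- If `fᵀ∇φ = ψ` weakly, the difference quotient is the time average of a continuous function with
value `⟨ρ, ψ⟩` at `0`. Conversely, for `ρ = ηw⁻²` the quotient also converges to `-∫ φ div(ηf)`, and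
equality of the two limits is the weak equation. -/
theorem isWeakStarGenerator_derivAlong (h : InvariantFlow Ω f Φ L) (W : FlowWeight Ω Φ w ω)
    [Fact (1 ≤ p)] [q.HolderTriple p 1] (hq1 : 1 ≤ q) (hq : q ≠ ∞) :
    IsWeakStarGenerator q (koopman h W p) (derivAlong h W p) := by
  intro φ ψ
  rw [mem_graph_derivAlong]
  simp only [pairing_inv_smul_koopman_sub]
  constructor
  · intro hw ρ
    simp only [pairing_koopman_sub_eq h W hq1 hq hw ρ]
    have hc : Continuous fun s : ℝ => pairing Ω w ρ (koopman h W p s.toNNReal ψ) :=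
      (continuous_pairing_koopman h W hq1 hq ρ ψ).comp continuous_real_toNNReal
    simpa [koopman_zero] using tendsto_inv_mul_intervalIntegral hc
  · intro hlim
    refine ⟨(weightedLp.integrableOn h W φ).locallyIntegrableOn,
      (weightedLp.integrableOn h W ψ).locallyIntegrableOn, fun η hη => ?_⟩
    obtain ⟨ρ, hρ⟩ := exists_predual_test (q := q) h W hη
    obtain ⟨M, hM⟩ := hη.exists_divergence_bound h.contDiff
    have hc := h.continuous_integral_mul_comp_real
      (continuous_divergence (hη.contDiff_smul h.contDiff)).aestronglyMeasurable hM
      (weightedLp.integrableOn h W φ)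
    have h1 := hlim ρ
    simp only [pairing_koopman_eq h W hρ, pairing_eq hρ,
      h.integral_test_mul_comp_sub_eq (weightedLp.integrableOn h W φ) hη, mul_neg] at h1
    have h2 := tendsto_nhds_unique h1 (tendsto_inv_mul_intervalIntegral hc).neg
    simp only [Real.toNNReal_zero, h.flowMap_zero] at h2
    simp only [mul_comm _ (divergence _ _), mul_comm _ (η _), h2, neg_neg]

theorem derivAlong_ae_eq (h : InvariantFlow Ω f Φ L) (W : FlowWeight Ω Φ w ω) [Fact (1 ≤ p)]
    (φ : (derivAlong h W p).domain) {G : Eucl d → Eucl d} (hG : HasWeakGradient Ω φ.1.1 G) :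
    (derivAlong h W p φ).1 =ᵐ[volume.restrict Ω] fun x => inner ℝ (f x) (G x) :=
  HasWeakDerivAlong.ae_unique h.isOpen
    ((mem_graph_derivAlong h W φ.1 _).1 ((derivAlong h W p).mem_graph φ))
    (hG.hasWeakDerivAlong h.isOpen h.contDiff)

/-- Here `(fᵀG) w = ∑ (f_i w) G_i` with `f_i w` in `L^∞` and `G_i` in `L^p`, so the weak derivative
along `f` belongs to the weighted space. -/
theorem mem_domain_derivAlong (h : InvariantFlow Ω f Φ L) (W : FlowWeight Ω Φ w ω) [Fact (1 ≤ p)]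
    (hfw : ∀ i, MemLp (fun x => f x i * w x) ∞ (volume.restrict Ω)) {φ : weightedLp Ω w p}
    (hφ : MemSobolev Ω p φ.1) : φ ∈ (derivAlong h W p).domain := by
  obtain ⟨-, G, hGp, hG⟩ := hφ
  have hm : AEStronglyMeasurable (fun x => inner ℝ (f x) (G x)) (volume.restrict Ω) :=
    h.contDiff.continuous.aestronglyMeasurable.inner hGp.1
  have hmem : MemLp (fun x => inner ℝ (f x) (G x) * w x) p (volume.restrict Ω) := by
    have hsum : MemLp (fun x => ∑ i, f x i * w x * G x i) p (volume.restrict Ω) :=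
      memLp_finsetSum _ fun i _ =>
        ((EuclideanSpace.proj (𝕜 := ℝ) i).comp_memLp' hGp).mul (hfw i)
    refine (memLp_congr_ae (Eventually.of_forall fun x => ?_)).1 hsum
    simp only [inner_eq_sum, Finset.sum_mul]
    exact Finset.sum_congr rfl fun i _ => by ring
  have hw := hG.hasWeakDerivAlong h.isOpen h.contDiff
  have hcoe := weightedLp.coe_mk _ hm hmem
  refine LinearPMap.mem_domain_of_mem_graph (y := weightedLp.mk _ hm hmem)
    ((mem_graph_derivAlong h W _ _).2 ⟨hw.locInt,
      (weightedLp.integrableOn h W _).locallyIntegrableOn, fun η hη => ?_⟩)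
  rw [hw.integral_eq η hη]
  congr 1
  refine integral_congr_ae ?_
  filter_upwards [hcoe] with x hx
  rw [hx]

/-! ### Reduction to compactly supported vector fields -/

theorem exists_compactSupport_extension {K : Set (Eucl d)} (hK : Bornology.IsBounded K)
    (hf : ContDiff ℝ 1 f) :
    ∃ g : Eucl d → Eucl d, ContDiff ℝ 1 g ∧ HasCompactSupport g ∧ ∀ x ∈ K, g x = f x := by
  obtain ⟨r, hr, hKr⟩ := hK.subset_closedBall_lt 0 0
  let χ : ContDiffBump (0 : Eucl d) := ⟨r, r + 1, hr, by linarith⟩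
  refine ⟨fun x => χ x • f x, χ.contDiff.smul hf, χ.hasCompactSupport.smul_right, fun x hx => ?_⟩
  simp only [χ.one_of_mem_closedBall (hKr hx), one_smul]

/-- Expressed through `v = w⁻¹`, the bound on `-fᵀ∇w/w` becomes `fᵀ∇v ≤ ω₀ v`, the differential
inequality needed for exponential growth. -/
theorem exists_flowWeight {g : Eucl d → Eucl d} (h : InvariantFlow Ω g Φ L)
    (hgf : ∀ x ∈ Ω, g x = f x) (hw : IsWeight Ω w) (hfw : WeightCompatible Ω f w) :
    ∃ ω, FlowWeight Ω Φ w ω := by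
  have := h.isFiniteMeasure
  obtain ⟨hv, v', hv', hwv⟩ := hw.inv_sobolev
  obtain ⟨V, ⟨v₀, hv₀, hV⟩, ω₀, hle⟩ := hfw.decay
  obtain ⟨C, hC⟩ := h.contDiff.continuous.bounded_above_of_compact_support h.compact
  have hvi : IntegrableOn (fun x => (w x)⁻¹) Ω := hv.integrable le_top
  have hψi : IntegrableOn (fun x => inner ℝ (g x) (v' x)) Ω := by
    refine Integrable.mono' ((hv'.integrable le_top).norm.const_mul C)
      (h.contDiff.continuous.aestronglyMeasurable.inner hv'.1) (Eventually.of_forall fun x => ?_)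
    exact (norm_inner_le_norm _ _).trans (mul_le_mul_of_nonneg_right (hC x) (norm_nonneg _))
  -- A nonnegative rate makes the operator bound monotone in time.
  refine ⟨max ω₀ 0, le_max_right _ _, hw.pos, hv, h.comp_flowMap_le hvi hψi
    (hwv.hasWeakDerivAlong h.isOpen h.contDiff) ?_⟩
  filter_upwards [hw.pos, hV, hle, HasWeakGradient.ae_unique h.isOpen hwv hv₀,
    ae_restrict_mem h.isOpen.measurableSet] with x h1 h2 h3 h4 h5
  rw [h2, inner_neg_right, inner_smul_right, neg_div, neg_neg] at h3
  rw [hgf x h5, h4]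
  have h6 : w x ^ 2 * inner ℝ (f x) (v₀ x) / w x = w x * inner ℝ (f x) (v₀ x) := by field_simp
  rw [h6] at h3
  rw [← div_eq_mul_inv, le_div_iff₀ h1, mul_comm]
  exact h3.trans (le_max_left _ _)

theorem koopman_ae_eq (h : InvariantFlow Ω f Φ L) (W : FlowWeight Ω Φ w ω) [Fact (1 ≤ p)]
    (t : ℝ≥0) (φ : weightedLp Ω w p) {φ' : Eucl d → ℝ} (hφ : φ' =ᵐ[volume.restrict Ω] φ.1) :
    (koopman h W p t φ).1 =ᵐ[volume.restrict Ω] fun z => φ' (Φ t z) := by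
  filter_upwards [koopman_coe h W t φ, (h.quasiMeasurePreserving t).ae hφ,
    ae_restrict_mem h.isOpen.measurableSet] with x h1 h2 h3
  rw [h1, ← h2, InvariantFlow.flowMap_of_mem h3]

end Koopman

end

/-! ### The main theorem. -/

open Koopman
theorem mainTheorem6 {d : ℕ} (Ω : Set (Eucl d)) (hΩ_open : IsOpen Ω)
    (hΩ_bdd : Bornology.IsBounded Ω) (hΩ_bdry : HasC1Boundary Ω)
    (f : Eucl d → Eucl d) (w : Eucl d → ℝ) (hw : IsWeight Ω w) (hfw : WeightCompatible Ω f w)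
    (Φ : ℝ≥0 → Eucl d → Eucl d) (hΦ : IsSolutionMap f (closure Ω) Φ)
    (hinv : FlowInvariant (closure Ω) Φ)
    -- `q = 1`, `p = ∞` is the case `Y = L¹_w`, `Y* = L^∞_w`; `q = p = 2` is `Y = Y* = L²_{w²}`
    (q p : ℝ≥0∞) [Fact (1 ≤ p)] (hqp : (q = 1 ∧ p = ⊤) ∨ (q = 2 ∧ p = 2)) :
    ∃ S : ℝ≥0 → (weightedLp Ω w p →L[ℝ] weightedLp Ω w p),
      -- `S t φ = φ ∘ Φ t`, whichever representative of `φ` is chosen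
      (∀ (t : ℝ≥0) (φ : weightedLp Ω w p) (φ' : Eucl d → ℝ),
        φ' =ᵐ[volume.restrict Ω] φ.1 →
          (S t φ).1 =ᵐ[volume.restrict Ω] fun z => φ' (Φ t z)) ∧
      IsWeakStarSemigroup q S ∧
      ∃ A : weightedLp Ω w p →ₗ.[ℝ] weightedLp Ω w p,
        IsWeakStarGenerator q S A ∧
        -- `A φ = fᵀ∇φ`, with domain all `φ` for which `fᵀ∇φ` exists weakly in the space
        (∀ φ ψ : weightedLp Ω w p, (φ, ψ) ∈ A.graph ↔ HasWeakDerivAlong Ω f φ.1 ψ.1) ∧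
        -- the same formula with the weak gradient of `φ`, if there is one
        (∀ (φ : A.domain) (G : Eucl d → Eucl d), HasWeakGradient Ω φ.1.1 G →
          (A φ).1 =ᵐ[volume.restrict Ω] fun x => inner ℝ (f x) (G x)) ∧
        (∀ φ : weightedLp Ω w p, MemSobolev Ω p φ.1 → φ ∈ A.domain) := by
  obtain ⟨g, hg, hgs, hgf⟩ := exists_compactSupport_extension hΩ_bdd.closure hfw.contDiff
  obtain ⟨L, hL⟩ := hg.lipschitzWith_of_hasCompactSupport hgs one_ne_zero
  have h : InvariantFlow Ω g Φ L :=
    { isOpen := hΩ_open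
      bounded := hΩ_bdd
      regular := hΩ_bdry.interior_closure_subset hΩ_open
      contDiff := hg
      compact := hgs
      lipschitz := hL
      -- Trajectories never leave `closure Ω`, where `g = f`, so they also solve the ODE of the
      -- cut-off field.
      sol := ⟨hΦ.initial, fun z hz t ht => by
        rw [hgf _ (hinv z hz _)]; exact hΦ.ode z hz t ht⟩
      inv := hinv }
  have hgf' : ∀ x ∈ Ω, g x = f x := fun x hx => hgf x (subset_closure hx)
  obtain ⟨ω, W⟩ := exists_flowWeight h hgf' hw hfw
  have hq1 : 1 ≤ q := by
    rcases hqp with ⟨rfl, -⟩ | ⟨rfl, -⟩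
    · exact le_rfl
    · exact one_le_two
  have hq : q ≠ ∞ := by
    rcases hqp with ⟨rfl, -⟩ | ⟨rfl, -⟩
    · exact ENNReal.one_ne_top
    · exact ENNReal.ofNat_ne_top
  have : q.HolderTriple p 1 := by
    rcases hqp with ⟨rfl, rfl⟩ | ⟨rfl, rfl⟩ <;> infer_instance
  refine ⟨koopman h W p, fun t φ φ' => koopman_ae_eq h W t φ,
    isWeakStarSemigroup_koopman h W hq1 hq, derivAlong h W p,
    isWeakStarGenerator_derivAlong h W hq1 hq, fun φ ψ => ?_, fun φ G hG => ?_, fun φ hφ => ?_⟩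
  · rw [mem_graph_derivAlong]
    exact ⟨HasWeakDerivAlong.congr_field hΩ_open hgf',
      HasWeakDerivAlong.congr_field hΩ_open fun x hx => (hgf' x hx).symm⟩
  · filter_upwards [derivAlong_ae_eq h W φ hG, ae_restrict_mem hΩ_open.measurableSet] with x h1 h2
    rw [h1, hgf' x h2]
  · refine mem_domain_derivAlong h W (fun i => ?_) hφ
    refine (memLp_congr_ae ?_).1 (hfw.bounded i)
    filter_upwards [ae_restrict_mem hΩ_open.measurableSet] with x hx
    rw [hgf' x hx]
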